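/- **Setting.** Let $e\ge 1$, let $\mathbf m=(m_0,\dots,m_{e-1})$ be positive integers, $n\ge 0$, $F=\mathbb C(q,t)$, and let $x=(x^{(k)}_j)$ ($0\le k\le e-1$, $1\le j\le m_k$) be variables, the upper index being read modulo $e$. Put $\mathfrak S_{\mathbf m}=\prod_k\mathfrak S_{m_k}$ (permuting the variables in each row), $\Xi_{\mathbf m,F}=F[x]^{\mathfrak S_{\mathbf m}}$. Let $\mathcal P_{\mathbf m}$ be the set of $e$-tuples of partitions $\alpha=(\alpha^{(k)}_j)$ with $\alpha^{(k)}_1\ge\dots\ge\alpha^{(k)}_{m_k}\ge 0$, and $Z_n$ the set of those of size $n$. For $\beta=(\beta^{(k)}_j)$ with entries in $\mathbb Z_{\ge 0}$ put $x^\beta=\prod (x_j^{(k)})^{\beta_j^{(k)}}$ and $a_\beta=\sum_{w\in\mathfrak S_{\mathbf m}}\varepsilon(w)\,w(x^\beta)$. Let $\delta^{(k)}=(m_k-1,\dots,1,0)$, $m_\alpha=\prod_k m_{\alpha^{(k)}}(x^{(k)})$ (monomial symmetric polynomials) and $s_\alpha=\prod_k s_{\alpha^{(k)}}(x^{(k)})=a_{\alpha+\delta}/a_\delta$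 (Schur polynomials). **Symbols.** The symbol of type $(1,0)$ of $\alpha$ is $\Lambda(\alpha)=\alpha+\delta$. Write $\alpha\sim\beta$ if $\Lambda(\alpha)$ and $\Lambda(\beta)$ have the same entries with multiplicities; the classes are called families. Let $a(\alpha)=\sum\min\{\lambda,\lambda'\}-\sum\min\{\mu,\mu'\}$, the sums being over unordered pairs of entries (at distinct positions) of $\Lambda(\alpha)$ and of $\delta$ respectively. Fix a total order $\prec$ on $Z_n$ such that $a(\alpha)\ge a(\beta)$ whenever $\alpha\prec\beta$ and each family is an interval. **Scalar product.** Let $g^{(k)}_{d,\pm}\in\Xi_{\mathbf m,F}$ be the coefficient of $y^d$ in $$\prod_{r\ge 0}\frac{\prod_i\bigl(1-t\,x_i^{(k\mp r\mp 1)}y\,q^r\bigr)}{\prod_i\bigl(1-x_i^{(k\mp r)}y\,q^r\bigr)}$$ (the infinite product converges $q$-adically, coefficient by coefficient), and put $g_{\alpha,\pm}=\prod_{k,j}g^{(k)}_{\alpha^{(k)}_j,\pm}$. There is a unique form $\langle\ ,\ \rangle$ on $\Xi_{\mathbf m,F}$, linear in the first argument and conjugate-linear in the second (conjugation acting on complex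 coefficients and fixing $q,t$), such that $\langle g_{\alpha,+},m_\beta\rangle=\langle m_\alpha,g_{\beta,-}\rangle=\delta_{\alpha,\beta}$ for all $\alpha,\beta\in\mathcal P_{\mathbf m}$. **Macdonald functions.** There are unique $P^{\pm}_{\Lambda(\alpha)}\in\Xi_{\mathbf m,F}$ ($\alpha\in Z_n$) such that (i) $P^\pm_{\Lambda(\alpha)}=s_\alpha+\sum_{\beta\in Z_n} u^\pm_{\alpha,\beta}s_\beta$ with $u^\pm_{\alpha,\beta}\in F$ and $u^{\pm}_{\alpha,\beta}=0$ unless $\beta\prec\alpha$ and $\beta\not\sim\alpha$; (ii) $\langle P^+_{\Lambda(\alpha)},P^-_{\Lambda(\beta)}\rangle=0$ unless $\alpha\sim\beta$. **Macdonald operators.** For $1\le r\le\min_k m_k$ let $\mathcal I_r$ be the set of sets $J$ of $r$ vectors $\mathbf i=(i_0,\dots,i_{e-1})$, $1\le i_k\le m_k$, any two of which differ in every entry. Write $(k,j)\in J$ if $j=i_k$ for some $\mathbf i\in J$, and $\langle\beta,J\rangle=\sum_{(k,j)\in J}\beta^{(k)}_j$. For $u\in F$ let $T^\pm_{u,J}$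 be the substitution replacing $x^{(k)}_{i_k}$ by $u\,x^{(k\mp1)}_{i_{k\mp1}}$ for all $\mathbf i\in J$ and all $k$; define $\beta_{J\pm}$ by $T^{\pm}_{u,J}x^\beta=u^{\langle\beta,J\rangle}x^{\beta_{J\pm}}$. Put $$D^r_\pm=a_\delta^{-1}\sum_{w\in\mathfrak S_{\mathbf m}}\varepsilon(w)\sum_{J\in\mathcal I_r}x^{w(\delta)_{J\pm}}\,t^{\langle w(\delta),J\rangle}\,T^\pm_{q,J}.$$ **Proposition 2.7.** With these notations, the form $\langle\ ,\ \rangle$ and the functions $P^\pm_{\Lambda(\alpha)}$ exist and are unique; for each sign and each $r$ with $1\le r\le\min_k m_k$ there is a unique matrix $(b^{r,\pm}_{\alpha,\beta})_{\alpha,\beta\in Z_n}$ over $F$ with $$D^r_\pm m_\alpha=\sum_{\beta\in Z_n}b^{r,\pm}_{\alpha,\beta}\,m_\beta\qquad(\alpha\in Z_n),$$ and for every $\alpha\in Z_n$ $$D^r_\pm P^\pm_{\Lambda(\alpha)}=\sum_{\beta\sim\alpha}b^{r,\pm}_{\alpha,\beta}\,P^\pm_{\Lambda(\beta)}.$$ 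-/

import Mathlib

noncomputable section

namespace WMac

open Filter Topology

/-! ### The ground field `F = ℂ(q,t)`, realised as `ℂ(t)(q)` -/

abbrev F : Type := RatFunc (RatFunc ℂ)

def q : F := RatFunc.X

def t : F := RatFunc.C RatFunc.X

/-- The map on rational functions in one variable induced by an injective map of coefficients. -/
def ratMap {K L : Type} [Field K] [Field L] (φ : K →+* L) : RatFunc K →+* RatFunc L :=
  RatFunc.mapRingHom (Polynomial.mapRingHom φ) (by
    intro p hp
    rw [Submonoid.mem_comap, mem_nonZeroDivisors_iff_ne_zero]
    rw [mem_nonZeroDivisors_iff_ne_zero] at hp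
    simpa [Polynomial.map_eq_zero] using hp)

/-- Complex conjugation of the coefficients of a rational function in `q` and `t`
(the indeterminates `q` and `t` are fixed). -/
def conjF : F →+* F := ratMap (ratMap (starRingEnd ℂ))

/-! ### Variables, symmetric polynomials, `e`-partitions

Rows are indexed by `ZMod e`, so that upper indices are read modulo `e`.  The columns of row `k`
are indexed by `Fin (m k)`, that is, by `0, …, m_k - 1` instead of `1, …, m_k`. -/

variable {e : ℕ} [NeZero e]

/-- The index set of the variables `x_j^{(k)}`. -/
abbrev Var (m : ZMod e → ℕ) : Type := Σ k : ZMod e, Fin (m k)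

abbrev Poly (m : ZMod e → ℕ) : Type := MvPolynomial (Var m) F

/-- The field of rational functions in the variables `x_j^{(k)}` over `F`. -/
abbrev RatFn (m : ZMod e → ℕ) : Type := FractionRing (Poly m)

/-- The group `S_m`, the product of the symmetric groups on the rows. -/
abbrev RowPerm (m : ZMod e → ℕ) : Type := ∀ k : ZMod e, Equiv.Perm (Fin (m k))

/-- The permutation of the variables given by an element of `S_m`. -/
def toPerm {m : ZMod e → ℕ} (w : RowPerm m) : Equiv.Perm (Var m) := Equiv.sigmaCongrRight w

/-- The sign of an element of `S_m`. -/
def sgn {m : ZMod e → ℕ} (w : RowPerm m) : ℤˣ := ∏ k, Equiv.Perm.sign (w k)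

/-- The action of `S_m` on sequences `β = (β_j^{(k)})` by permuting the entries of each row. -/
def actSeq {m : ZMod e → ℕ} (w : RowPerm m) (β : Var m → ℕ) : Var m → ℕ :=
  fun v => β ((toPerm w).symm v)

/-- The action of `S_m` on polynomials. -/
def actPoly {m : ZMod e → ℕ} (w : RowPerm m) : Poly m →ₐ[F] Poly m :=
  MvPolynomial.rename (toPerm w)

/-- The algebra of `S_m`-symmetric polynomials with coefficients in `F`. -/
def Xi (m : ZMod e → ℕ) : Subalgebra F (Poly m) where
  carrier := {f | ∀ w : RowPerm m, actPoly w f = f}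
  mul_mem' := by
    intro a b ha hb w
    rw [map_mul, ha w, hb w]
  add_mem' := by
    intro a b ha hb w
    rw [map_add, ha w, hb w]
  algebraMap_mem' := by
    intro c w
    exact (actPoly w).commutes c

/-- The inclusion of symmetric polynomials into the field of rational functions. -/
def toRat {m : ZMod e → ℕ} (f : Xi m) : RatFn m := algebraMap (Poly m) (RatFn m) (f : Poly m)

/-- The monomial `x^β`. -/
def xpow {m : ZMod e → ℕ} (β : Var m → ℕ) : Poly m :=
  MvPolynomial.monomial (Finsupp.equivFunOnFinite.symm β) 1

/-- `e`-partitions `α = (α_j^{(k)})` whose `k`-th row has at most `m_k` non-zero parts. -/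
abbrev EPart (m : ZMod e → ℕ) : Type :=
  {α : Var m → ℕ // ∀ k : ZMod e, Antitone fun j : Fin (m k) => α ⟨k, j⟩}

/-- The `e`-partitions of size `n` whose `k`-th row has at most `m_k` non-zero parts. -/
abbrev Zn (m : ZMod e → ℕ) (n : ℕ) : Type := {α : EPart m // ∑ v, α.1 v = n}

instance {m : ZMod e → ℕ} {n : ℕ} : Fintype (Zn m n) :=
  Fintype.ofInjective
    (fun (α : Zn m n) (v : Var m) => (⟨α.1.1 v, by
      have h : α.1.1 v ≤ ∑ v, α.1.1 v :=
        Finset.single_le_sum (f := α.1.1) (fun _ _ => Nat.zero_le _) (Finset.mem_univ v)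
      have h2 := α.2
      omega⟩ : Fin (n + 1)))
    (by
      intro α β h
      apply Subtype.ext
      apply Subtype.ext
      funext v
      exact congrArg Fin.val (congrFun h v))

/-- The set of all row permutations of `α`. -/
def orbit {m : ZMod e → ℕ} (α : Var m → ℕ) : Finset (Var m → ℕ) :=
  Finset.univ.image fun w : RowPerm m => actSeq w α

theorem actPoly_xpow {m : ZMod e → ℕ} (w : RowPerm m) (β : Var m → ℕ) :
    actPoly w (xpow β) = xpow (actSeq w β) := by
  unfold actPoly xpow
  rw [MvPolynomial.rename_monomial]
  refine congrArg (fun c : Var m →₀ ℕ => MvPolynomial.monomial c (1 : F)) ?_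
  refine Finsupp.ext fun v => ?_
  have h := Finsupp.mapDomain_apply (toPerm w).injective
    (Finsupp.equivFunOnFinite.symm β : Var m →₀ ℕ) ((toPerm w).symm v)
  rw [Equiv.apply_symm_apply] at h
  rw [h]
  rfl

theorem actSeq_mul {m : ZMod e → ℕ} (w w' : RowPerm m) (β : Var m → ℕ) :
    actSeq w (actSeq w' β) = actSeq (w * w') β := by
  funext v
  rfl

/-- The monomial symmetric polynomial `m_α(x) = ∏ₖ m_{α^{(k)}}(x^{(k)})`: the sum of `x^β` over
all the distinct row permutations `β` of `α`. -/
def monSym {m : ZMod e → ℕ} (α : EPart m) : Xi m :=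
  ⟨∑ β ∈ orbit α.1, xpow β, by
    intro w
    rw [map_sum]
    simp only [actPoly_xpow]
    refine Finset.sum_bij (fun β _ => actSeq w β) ?_ ?_ ?_ ?_
    · intro β hβ
      obtain ⟨w', _, rfl⟩ := Finset.mem_image.1 hβ
      rw [actSeq_mul]
      exact Finset.mem_image_of_mem _ (Finset.mem_univ _)
    · intro a _ b _ h
      have h' := congrArg (actSeq w⁻¹) h
      simp only [actSeq_mul, inv_mul_cancel] at h'
      exact h'
    · intro β hβ
      obtain ⟨w', _, rfl⟩ := Finset.mem_image.1 hβ
      refine ⟨actSeq (w⁻¹ * w') α.1, Finset.mem_image_of_mem _ (Finset.mem_univ _), ?_⟩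
      rw [actSeq_mul, mul_inv_cancel_left]
    · intro _ _
      rfl⟩

/-! ### Symbols of type `(1,0)`, families, the `a`-function -/

/-- `δ^{(k)} = (m_k - 1, …, 1, 0)`. -/
def delta (m : ZMod e → ℕ) : Var m → ℕ := fun v => m v.1 - 1 - v.2

/-- The symbol `Λ(α) = α + δ` of type `(1,0)`. -/
def symbol {m : ZMod e → ℕ} (α : EPart m) : Var m → ℕ := fun v => α.1 v + delta m v

/-- `α ∼ β`: the symbols of `α` and `β` have the same entries, with multiplicities. -/
def Similar {m : ZMod e → ℕ} {n : ℕ} (α β : Zn m n) : Prop :=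
  (Finset.univ : Finset (Var m)).val.map (symbol α.1) =
    (Finset.univ : Finset (Var m)).val.map (symbol β.1)

/-- The sum of `min{λ, λ'}` over all unordered pairs of (distinct positions of) entries. -/
def minSum {m : ZMod e → ℕ} (L : Var m → ℕ) : ℕ :=
  ∑ z : Sym2 (Var m) with ¬ z.IsDiag,
    Sym2.lift ⟨fun v w => min (L v) (L w), fun _ _ => min_comm _ _⟩ z

/-- The `a`-function. -/
def aFun {m : ZMod e → ℕ} {n : ℕ} (α : Zn m n) : ℤ :=
  (minSum (symbol α.1) : ℤ) - (minSum (delta m) : ℤ)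

/-- The total orders `≺` used to define Macdonald functions: `a(α) ≥ a(β)` whenever `α ≺ β`, and
each family is an interval. -/
structure IsAdmissible {m : ZMod e → ℕ} {n : ℕ} (prec : Zn m n → Zn m n → Prop) : Prop where
  total : IsStrictTotalOrder (Zn m n) prec
  aFun_le : ∀ α β, prec α β → aFun β ≤ aFun α
  interval : ∀ α β γ, Similar α β → prec α γ → prec γ β → Similar α γ

/-! ### The functions `g` and the scalar product

The sign `±` is an element `s` of `ℤˣ = {1, -1}`; the row `k ∓ a` is `shift s k a`. -/

/-- The row `k ∓ a`, where `∓` is opposite to the sign `s`. -/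
def shift (s : ℤˣ) (k : ZMod e) (a : ℕ) : ZMod e := k - ((s : ℤ) : ZMod e) * (a : ZMod e)

/-- The power series `1 - c x_v Y` in one variable `Y`. -/
def linFactor {m : ZMod e → ℕ} (c : F) (v : Var m) : PowerSeries (Poly m) :=
  1 - PowerSeries.C (MvPolynomial.C c * MvPolynomial.X v) * PowerSeries.X

/-- The product over `i` and over `0 ≤ r < N` of
`(1 - t x_i^{(k∓r∓1)} Y q^r) / (1 - x_i^{(k∓r)} Y q^r)`, as a power series in `Y`. -/
def gPartial {m : ZMod e → ℕ} (s : ℤˣ) (k : ZMod e) (N : ℕ) : PowerSeries (Poly m) :=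
  ∏ r ∈ Finset.range N,
    (∏ i : Fin (m (shift s k (r + 1))), linFactor (t * q ^ r) ⟨shift s k (r + 1), i⟩) *
      ∏ i : Fin (m (shift s k r)),
        PowerSeries.invOfUnit (linFactor (q ^ r) ⟨shift s k r, i⟩) 1

/-- `g` is the coefficient of `Y^d` in the infinite product over all `i` and all `r ≥ 0` of
`(1 - t x_i^{(k∓r∓1)} Y q^r) / (1 - x_i^{(k∓r)} Y q^r)`.  Coefficients of the infinite product are
limits of those of the partial products, for the `q`-adic topology of `F = ℂ(t)(q)`
(which is the topology that Mathlib puts on a field of rational functions). -/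
def IsGCoeff {m : ZMod e → ℕ} (s : ℤˣ) (k : ZMod e) (d : ℕ) (g : Xi m) : Prop :=
  ∀ μ : Var m →₀ ℕ,
    Tendsto
      (fun N => MvPolynomial.coeff μ (PowerSeries.coeff d (gPartial (m := m) s k N)))
      atTop (𝓝 (MvPolynomial.coeff μ (g : Poly m)))

/-- The symmetric polynomial `g_{d,±}^{(k)}(x;q,t)`. -/
def gOne {m : ZMod e → ℕ} (s : ℤˣ) (k : ZMod e) (d : ℕ) : Xi m :=
  Classical.epsilon (IsGCoeff s k d)

/-- `g_{α,±}(x;q,t)`, the product of the `g_{d,±}^{(k)}` for `d = α_j^{(k)}`. -/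
def gFun {m : ZMod e → ℕ} (s : ℤˣ) (α : EPart m) : Xi m := ∏ v : Var m, gOne s v.1 (α.1 v)

open Classical in
/-- `B` (linear in the first and conjugate-linear in the second argument) is the scalar product
on symmetric polynomials: the bases `g_{α,+}` and `m_β` are dual to each other, and so are
`m_α` and `g_{β,-}`. -/
def IsScalarProduct {m : ZMod e → ℕ} (B : Xi m →ₗ[F] Xi m →ₛₗ[conjF] F) : Prop :=
  ∀ α β : EPart m,
    B (gFun 1 α) (monSym β) = (if α = β then 1 else 0) ∧
    B (monSym α) (gFun (-1) β) = (if α = β then 1 else 0)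

/-! ### Schur functions and Macdonald functions -/

/-- `a_β(x) = ∑_{w ∈ S_m} ε(w) w(x^β)`. -/
def alternant {m : ZMod e → ℕ} (β : Var m → ℕ) : Poly m :=
  ∑ w : RowPerm m, ((sgn w : ℤˣ) : ℤ) • actPoly w (xpow β)

/-- The Schur function `s_α(x) = ∏ₖ s_{α^{(k)}}(x^{(k)})`, as the quotient `a_{α+δ} / a_δ` of
alternants (both alternants are the products of the usual alternants of the rows). -/
def schur {m : ZMod e → ℕ} (α : EPart m) : RatFn m :=
  algebraMap (Poly m) (RatFn m) (alternant fun v => α.1 v + delta m v) /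
    algebraMap (Poly m) (RatFn m) (alternant (delta m))

/-- `P s α`, for `s = ±`, are the Macdonald functions `P^±_{Λ(α)}(x;q,t)` with respect to the
total order `prec` and the scalar product `B`. -/
structure IsMacdonald {m : ZMod e → ℕ} {n : ℕ} (prec : Zn m n → Zn m n → Prop)
    (B : Xi m →ₗ[F] Xi m →ₛₗ[conjF] F) (P : ℤˣ → Zn m n → Xi m) : Prop where
  expansion : ∀ (s : ℤˣ) (α : Zn m n), ∃ u : Zn m n → F,
    (∀ β, ¬ (prec β α ∧ ¬ Similar β α) → u β = 0) ∧
      toRat (P s α) = schur α.1 + ∑ β, u β • schur β.1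
  orthogonal : ∀ α β : Zn m n, ¬ Similar α β → B (P 1 α) (P (-1) β) = 0

/-! ### Macdonald operators -/

/-- The set `I_r` of all sets `J` of `r` vectors `i = (i_k)`, any two of which have no
common entries. -/
def IndexSets (m : ZMod e → ℕ) (r : ℕ) : Finset (Finset (∀ k : ZMod e, Fin (m k))) :=
  Finset.univ.filter fun J => J.card = r ∧ ∀ i ∈ J, ∀ j ∈ J, i ≠ j → ∀ k, i k ≠ j k

/-- The position `v = (k, j)` belongs to (the set of positions occupied by) `J`. -/
abbrev Occ {m : ZMod e → ℕ} (J : Finset (∀ k : ZMod e, Fin (m k))) (v : Var m) : Prop :=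
  ∃ i ∈ J, i v.1 = v.2

open Classical in
/-- For `i ∈ J`, the position `(k, i_k)` is moved to `(k ∓ 1, i_{k∓1})`; the positions outside `J`
are fixed. -/
def move {m : ZMod e → ℕ} (s : ℤˣ) (J : Finset (∀ k : ZMod e, Fin (m k))) (v : Var m) : Var m :=
  if h : Occ J v then ⟨shift s v.1 1, h.choose (shift s v.1 1)⟩ else v

open Classical in
/-- The operator `T^±_{u,J}`: for each `i ∈ J`, the variable `x_{i_k}^{(k)}` is replaced by
`u x_{i_{k∓1}}^{(k∓1)}`, for all `k`. -/
def opT {m : ZMod e → ℕ} (s : ℤˣ) (u : F) (J : Finset (∀ k : ZMod e, Fin (m k))) :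
    Poly m →ₐ[F] Poly m :=
  MvPolynomial.aeval fun v =>
    if Occ J v then MvPolynomial.C u * MvPolynomial.X (move s J v) else MvPolynomial.X v

open Classical in
/-- `⟨β, J⟩`, the sum of the entries of `β` at the positions in `J`. -/
def pairing {m : ZMod e → ℕ} (β : Var m → ℕ) (J : Finset (∀ k : ZMod e, Fin (m k))) : ℕ :=
  ∑ v : Var m with Occ J v, β v

/-- `β_{J±}`, characterised by `T^±_{u,J} x^β = u^{⟨β,J⟩} x^{β_{J±}}`: the entry of `β` at a
position `v` is moved to the position `move s J v`.  For `J` in `I_r`, the maps `move s J` and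
`move (-s) J` are inverse to each other. -/
def seqMove {m : ZMod e → ℕ} (s : ℤˣ) (J : Finset (∀ k : ZMod e, Fin (m k)))
    (β : Var m → ℕ) : Var m → ℕ :=
  fun v => β (move (-s) J v)

/-- The Macdonald operator `D^r_±(q,t)`, with values in rational functions because of the
factor `a_δ(x)⁻¹`. -/
def opD {m : ZMod e → ℕ} (s : ℤˣ) (r : ℕ) (f : Poly m) : RatFn m :=
  (algebraMap (Poly m) (RatFn m) (alternant (delta m)))⁻¹ *
    ∑ w : RowPerm m, ((sgn w : ℤˣ) : ℤ) • ∑ J ∈ IndexSets m r,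
      algebraMap (Poly m) (RatFn m)
        (xpow (seqMove s J (actSeq w (delta m))) *
          MvPolynomial.C (t ^ pairing (actSeq w (delta m)) J) * opT s q J f)

/-- `b` is the matrix of `D^r_±` on the monomial basis of the symmetric polynomials of
degree `n`. -/
def IsMonomialMatrix {m : ZMod e → ℕ} {n : ℕ} (s : ℤˣ) (r : ℕ) (b : Zn m n → Zn m n → F) : Prop :=
  ∀ α : Zn m n, opD s r (monSym α.1 : Poly m) = ∑ β, b α β • toRat (monSym β.1)

end WMac

end

/-!
The coefficients of the infinite product defining `g_{d,±}` solve a `q`-difference recursion, so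
the `g_{α,±}` are the coefficients of a kernel `K_±(x, y) = ∑ g_{α,±}(x) m_α(y)`, and
`K_-(x, y) = K_+(y, x)`: the two matrices expressing the `g_{α,±}` by monomial symmetric polynomials
are transposes of each other, which gives the scalar product.  Applying a Macdonald operator in `x`
or the opposite one in `y` to the kernel gives the same result by Cauchy's determinant, so `D^r_+`
and `D^r_-` are adjoint.  At `q = t = 0` the kernel becomes the Cauchy product, for which Schur
functions are orthonormal; hence the Gram determinants of Schur functions do not vanish
identically, and Gram-Schmidt by families produces the Macdonald functions.  Finally, `D^r_±` is
triangular by blocks with respect to families, because outside the family of `α` only sequences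
with a larger value of the `a`-function occur in the expansion of `D^r_± m_α`, and an operator with
a triangular adjoint maps each block of an orthogonalized family to itself by the diagonal block of
its matrix.
-/

noncomputable section

namespace WMac

open Finset

section Sequences

variable {e : ℕ} {m : ZMod e → ℕ}

theorem actSeq_apply (w : RowPerm m) (β : Var m → ℕ) (k : ZMod e) (j : Fin (m k)) :
    actSeq w β ⟨k, j⟩ = β ⟨k, (w k)⁻¹ j⟩ := rfl

theorem actSeq_toPerm (w : RowPerm m) (β : Var m → ℕ) (v : Var m) :
    actSeq w β (toPerm w v) = β v := by
  rw [actSeq, Equiv.symm_apply_apply]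

theorem actSeq_add (w : RowPerm m) (β γ : Var m → ℕ) :
    actSeq w (β + γ) = actSeq w β + actSeq w γ := rfl

theorem actSeq_inv_actSeq (w : RowPerm m) (β : Var m → ℕ) : actSeq w⁻¹ (actSeq w β) = β := by
  funext ⟨k, j⟩
  simp [actSeq_apply]

theorem actSeq_actSeq_inv (w : RowPerm m) (β : Var m → ℕ) : actSeq w (actSeq w⁻¹ β) = β := by
  simpa only [inv_inv] using actSeq_inv_actSeq w⁻¹ β

/-- A sequence whose rows are weakly decreasing. -/
def RowAntitone (β : Var m → ℕ) : Prop := ∀ k : ZMod e, Antitone fun j : Fin (m k) => β ⟨k, j⟩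

theorem actSeq_mulSingle_swap [DecidableEq (ZMod e)] (k : ZMod e) (i j : Fin (m k))
    (β : Var m → ℕ) :
    actSeq (Pi.mulSingle k (Equiv.swap i j)) β = β ∘ Equiv.swap ⟨k, i⟩ ⟨k, j⟩ := by
  funext ⟨k', l⟩
  obtain rfl | hk := eq_or_ne k' k
  · simp only [actSeq_apply, Pi.mulSingle_eq_same, Equiv.swap_inv, Function.comp_apply,
      Equiv.swap_apply_def, Sigma.mk.injEq, heq_eq_eq, true_and]
    split_ifs <;> rfl
  · simp [actSeq_apply, Equiv.swap_apply_def, hk]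

theorem exists_rowAntitone_actSeq (β : Var m → ℕ) :
    ∃ w : RowPerm m, RowAntitone (actSeq w β) := by
  let row (k : ZMod e) (j : Fin (m k)) : ℕᵒᵈ := OrderDual.toDual (β ⟨k, j⟩)
  refine ⟨fun k => (Tuple.sort (row k))⁻¹, fun k i j hij => ?_⟩
  simp only [actSeq_apply, inv_inv]
  exact Tuple.monotone_sort (row k) hij

theorem actSeq_eq_self_of_rowAntitone {β : Var m → ℕ} {w : RowPerm m} (hβ : RowAntitone β)
    (hwβ : RowAntitone (actSeq w β)) : actSeq w β = β := by
  funext ⟨k, j⟩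
  let row (j : Fin (m k)) : ℕ := β ⟨k, j⟩
  exact congrFun (Tuple.unique_antitone (f := row) (σ := (w k)⁻¹) (τ := 1) (hwβ k) (hβ k)) j

theorem strictAnti_delta (k : ZMod e) : StrictAnti fun j : Fin (m k) => delta m ⟨k, j⟩ := by
  intro i j (hij : (i : ℕ) < j)
  simp only [delta]
  omega

theorem strictAnti_symbol (α : EPart m) (k : ZMod e) :
    StrictAnti fun j : Fin (m k) => symbol α ⟨k, j⟩ :=
  fun _ _ hij => add_lt_add_of_le_of_lt (α.2 k hij.le) (strictAnti_delta k hij)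

theorem symbol_eq_add (α : EPart m) : symbol α = delta m + α.1 :=
  funext fun v => add_comm (α.1 v) (delta m v)

theorem symbol_zero : symbol (⟨0, fun _ _ _ _ => le_rfl⟩ : EPart m) = delta m := by
  rw [symbol_eq_add, add_zero]

theorem symbol_injective : Function.Injective (symbol : EPart m → _) := fun _ _ h =>
  Subtype.ext (add_left_injective (delta m) h)

theorem antitone_add_val {n : ℕ} {f : Fin n → ℕ} (hf : StrictAnti f) :
    Antitone fun i => f i + i := by
  cases n with
  | zero => exact fun i => i.elim0
  | succ n =>
    refine Fin.antitone_iff_succ_le.2 fun i => ?_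
    have := hf i.castSucc_lt_succ
    simp only [Fin.val_succ, Fin.val_castSucc]
    omega

theorem exists_symbol_eq {κ : Var m → ℕ} (hκ : ∀ k, StrictAnti fun j : Fin (m k) => κ ⟨k, j⟩) :
    ∃ β : EPart m, symbol β = κ := by
  have hδ : delta m ≤ κ := by
    rintro ⟨k, j⟩
    have hj := j.2
    have := antitone_add_val (hκ k) (show j ≤ ⟨m k - 1, by omega⟩ from Nat.le_sub_one_of_lt hj)
    simp only [delta] at this ⊢
    omega
  refine ⟨⟨κ - delta m, fun k i j hij => ?_⟩, funext fun v => Nat.sub_add_cancel (hδ v)⟩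
  have h := antitone_add_val (hκ k) hij
  have hi := hδ ⟨k, i⟩
  simp only [delta, Pi.sub_apply] at *
  omega

theorem exists_actSeq_eq_symbol {γ : Var m → ℕ}
    (hγ : ∀ k, Function.Injective fun j : Fin (m k) => γ ⟨k, j⟩) :
    ∃ (w : RowPerm m) (β : EPart m), actSeq w γ = symbol β := by
  obtain ⟨w, hw⟩ := exists_rowAntitone_actSeq γ
  obtain ⟨β, hβ⟩ := exists_symbol_eq fun k =>
    (hw k).strictAnti_of_injective ((hγ k).comp (w k)⁻¹.injective)
  exact ⟨w, β, hβ.symm⟩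

theorem actSeq_symbol_eq_symbol_iff {w : RowPerm m} {β β' : EPart m} :
    actSeq w (symbol β) = symbol β' ↔ w = 1 ∧ β = β' := by
  refine ⟨fun h => ?_, by rintro ⟨rfl, rfl⟩; rfl⟩
  have hfix : actSeq w (symbol β) = symbol β :=
    actSeq_eq_self_of_rowAntitone (fun k => (strictAnti_symbol β k).antitone)
      (h ▸ fun k => (strictAnti_symbol β' k).antitone)
  refine ⟨funext fun k => inv_eq_one.1 (Equiv.ext fun j => ?_),
    symbol_injective (hfix.symm.trans h)⟩
  exact (strictAnti_symbol β k).injective (congrFun hfix ⟨k, j⟩)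

end Sequences

section Alternants

variable {e : ℕ} [NeZero e] {m : ZMod e → ℕ}

theorem sum_actSeq (w : RowPerm m) (β : Var m → ℕ) : ∑ v, actSeq w β v = ∑ v, β v :=
  Equiv.sum_comp (toPerm w).symm β

theorem map_univ_actSeq (w : RowPerm m) (β : Var m → ℕ) :
    (univ : Finset (Var m)).val.map (actSeq w β) = (univ : Finset (Var m)).val.map β := by
  conv_rhs => rw [← Multiset.map_univ_val_equiv (toPerm w).symm, Multiset.map_map]
  rfl

theorem sum_symbol (β : EPart m) : ∑ v, symbol β v = ∑ v, β.1 v + ∑ v, delta m v :=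
  Finset.sum_add_distrib

/-- The sequence `β`, seen as the exponent vector of `x^β`. -/
abbrev expo (β : Var m → ℕ) : Var m →₀ ℕ := Finsupp.equivFunOnFinite.symm β

theorem coeff_xpow (β γ : Var m → ℕ) :
    MvPolynomial.coeff (expo γ) (xpow β) = if β = γ then (1 : F) else 0 := by
  simp only [xpow, MvPolynomial.coeff_monomial, EmbeddingLike.apply_eq_iff_eq]

theorem xpow_add (β γ : Var m → ℕ) : xpow (β + γ) = xpow β * xpow γ := by
  have hexpo : expo (β + γ) = expo β + expo γ := Finsupp.ext fun _ => rfl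
  rw [xpow, xpow, xpow, MvPolynomial.monomial_mul, one_mul, ← hexpo]

theorem sgn_mul (w w' : RowPerm m) : sgn (w * w') = sgn w * sgn w' := by
  simp [sgn, Finset.prod_mul_distrib]

theorem sgn_mulSingle (k : ZMod e) (σ : Equiv.Perm (Fin (m k))) :
    sgn (Pi.mulSingle k σ : RowPerm m) = Equiv.Perm.sign σ := by
  rw [sgn, Fintype.prod_eq_single k fun k' hk => by rw [Pi.mulSingle_eq_of_ne hk, map_one],
    Pi.mulSingle_eq_same]

theorem alternant_eq_sum (β : Var m → ℕ) :
    alternant β = ∑ w : RowPerm m, (sgn w : ℤ) • xpow (actSeq w β) := by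
  simp only [alternant, actPoly_xpow]

theorem alternant_actSeq (w : RowPerm m) (β : Var m → ℕ) :
    alternant (actSeq w β) = (sgn w : ℤ) • alternant β := by
  rw [alternant_eq_sum, alternant_eq_sum, Finset.smul_sum,
    ← Equiv.sum_comp (Equiv.mulRight w) fun w' => (sgn w : ℤ) • (sgn w' : ℤ) • xpow (actSeq w' β)]
  refine Finset.sum_congr rfl fun w' _ => ?_
  rw [Equiv.coe_mulRight, actSeq_mul, smul_smul, sgn_mul, ← Units.val_mul, mul_left_comm,
    Int.units_mul_self, mul_one]

theorem alternant_eq_zero_of_apply_eq {γ : Var m → ℕ} {k : ZMod e} {i j : Fin (m k)} (hij : i ≠ j)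
    (hγ : γ ⟨k, i⟩ = γ ⟨k, j⟩) : alternant γ = 0 := by
  let w : RowPerm m := Pi.mulSingle k (Equiv.swap i j)
  have hfix : actSeq w γ = γ := by
    rw [actSeq_mulSingle_swap]
    funext v
    simp only [Function.comp_apply, Equiv.swap_apply_def]
    split_ifs with hi hj
    exacts [hi ▸ hγ.symm, hj ▸ hγ, rfl]
  have hneg := alternant_actSeq w γ
  rw [hfix, sgn_mulSingle, Equiv.Perm.sign_swap hij] at hneg
  simpa [self_eq_neg] using hneg

/-- The coefficient of `x^κ` in the alternant `a_γ`, as an integer. -/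
def altCoeff (γ κ : Var m → ℕ) : ℤ :=
  ∑ w : RowPerm m, (sgn w : ℤ) * if actSeq w γ = κ then 1 else 0

theorem coeff_alternant (γ κ : Var m → ℕ) :
    MvPolynomial.coeff (expo κ) (alternant γ) = (altCoeff γ κ : F) := by
  rw [alternant_eq_sum, MvPolynomial.coeff_sum, altCoeff, Int.cast_sum]
  refine Finset.sum_congr rfl fun w _ => ?_
  rw [MvPolynomial.coeff_smul, coeff_xpow, zsmul_eq_mul]
  push_cast
  rfl

theorem altCoeff_symbol (β β' : EPart m) :
    altCoeff (symbol β) (symbol β') = if β = β' then 1 else 0 := by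
  simp only [altCoeff, actSeq_symbol_eq_symbol_iff]
  by_cases h : β = β' <;> simp [h, sgn]

theorem exists_actSeq_eq_of_altCoeff_ne_zero {γ κ : Var m → ℕ} (h : altCoeff γ κ ≠ 0) :
    ∃ w : RowPerm m, actSeq w γ = κ := by
  obtain ⟨w, -, hw⟩ := Finset.exists_ne_zero_of_sum_ne_zero h
  exact ⟨w, by_contra fun hne => hw (by rw [if_neg hne, mul_zero])⟩

theorem alternant_eq_sum_symbol {n : ℕ} {γ : Var m → ℕ}
    (hγ : ∑ v, γ v = n + ∑ v, delta m v) :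
    alternant γ = ∑ β : Zn m n, (altCoeff γ (symbol β.1) : F) • alternant (symbol β.1) := by
  simp only [← coeff_alternant]
  by_cases h0 : alternant γ = 0
  · simp [h0]
  have hinj (k : ZMod e) : Function.Injective fun j : Fin (m k) => γ ⟨k, j⟩ := fun i j hij =>
    by_contra fun hne => h0 (alternant_eq_zero_of_apply_eq hne hij)
  obtain ⟨w, β, hw⟩ := exists_actSeq_eq_symbol hinj
  have hγβ : alternant γ = (sgn w : ℤ) • alternant (symbol β) := by
    rw [← hw, alternant_actSeq, smul_smul, ← Units.val_mul, Int.units_mul_self, Units.val_one,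
      one_smul]
  have hβ : ∑ v, β.1 v = n := by
    have := sum_actSeq w γ
    rw [hw, sum_symbol, hγ] at this
    exact Nat.add_right_cancel this
  have hcoeff (β' : Zn m n) : MvPolynomial.coeff (expo (symbol β'.1)) (alternant γ) =
      if β = β'.1 then ((sgn w : ℤ) : F) else 0 := by
    rw [hγβ, MvPolynomial.coeff_smul, coeff_alternant, altCoeff_symbol]
    split_ifs <;> simp
  rw [Fintype.sum_eq_single (⟨β, hβ⟩ : Zn m n), hcoeff, if_pos rfl, hγβ, Int.cast_smul_eq_zsmul]
  intro β' hne
  rw [hcoeff, if_neg fun h => hne (Subtype.ext h.symm), zero_smul]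

theorem alternant_delta_ne_zero : alternant (delta m) ≠ 0 := by
  intro h
  have := coeff_alternant (symbol (⟨0, fun _ _ _ _ => le_rfl⟩ : EPart m)) (delta m)
  rw [← symbol_zero, altCoeff_symbol, symbol_zero, h] at this
  simp at this

end Alternants

section PairSums

variable {ι : Type*} [Fintype ι]

theorem two_nsmul_sum_not_isDiag [DecidableEq ι] {M : Type*} [AddCommMonoid M] (f : Sym2 ι → M) :
    2 • ∑ z with ¬ z.IsDiag, f z = ∑ p ∈ (univ : Finset ι).offDiag, f s(p.1, p.2) := by
  have hmaps : ∀ p ∈ (univ : Finset ι).offDiag,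
      s(p.1, p.2) ∈ (univ : Finset (Sym2 ι)).filter (¬ ·.IsDiag) := by simp
  rw [← Finset.sum_fiberwise_of_maps_to hmaps, Finset.smul_sum]
  refine Finset.sum_congr rfl fun z hz => ?_
  induction z with | _ a b
  have hab : a ≠ b := by simpa using hz
  have hfiber : {p ∈ (univ : Finset ι).offDiag | s(p.1, p.2) = s(a, b)} = {(a, b), (b, a)} := by
    ext ⟨c, d⟩
    simp only [mem_filter, mem_offDiag, mem_univ, true_and, Sym2.eq_iff, mem_insert, mem_singleton,
      Prod.mk.injEq]
    exact ⟨fun h => h.2, by rintro (⟨rfl, rfl⟩ | ⟨rfl, rfl⟩) <;> simp [hab, hab.symm]⟩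
  rw [hfiber, Finset.sum_pair (by simp [hab]), Sym2.eq_swap (a := b), two_nsmul]

theorem sum_sum_min_eq_add_compl [DecidableEq ι] (L : ι → ℕ) {v w : ι} (hvw : v ≠ w) :
    ∑ a, ∑ b, min (L a) (L b) = L v + L w + 2 * min (L v) (L w) +
      2 * ∑ b ∈ {v, w}ᶜ, (min (L v) (L b) + min (L w) (L b)) +
      ∑ a ∈ {v, w}ᶜ, ∑ b ∈ {v, w}ᶜ, min (L a) (L b) := by
  have hsplit (f : ι → ℕ) : ∑ a, f a = f v + f w + ∑ a ∈ {v, w}ᶜ, f a := by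
    rw [← Finset.sum_add_sum_compl {v, w} f, Finset.sum_pair hvw]
  have hcross (u : ι) : ∑ a ∈ {v, w}ᶜ, min (L a) (L u) = ∑ a ∈ {v, w}ᶜ, min (L u) (L a) :=
    Finset.sum_congr rfl fun _ _ => min_comm _ _
  simp only [hsplit, Finset.sum_add_distrib, min_self, hcross, min_comm (L w) (L v)]
  ring

theorem sum_sum_min_lt {L L' : ι → ℕ} {v w : ι} (hvw : v ≠ w)
    (heq : ∀ u, u ≠ v → u ≠ w → L' u = L u) (hsum : L' v + L' w = L v + L w)
    (hv : L v < L' v) (hw : L w < L' v) :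
    ∑ a, ∑ b, min (L' a) (L' b) < ∑ a, ∑ b, min (L a) (L b) := by
  classical
  have hcompl : ∀ u ∈ ({v, w} : Finset ι)ᶜ, L' u = L u := fun u hu => by
    simp only [mem_compl, mem_insert, mem_singleton, not_or] at hu
    exact heq u hu.1 hu.2
  have hcross : ∑ b ∈ {v, w}ᶜ, (min (L' v) (L' b) + min (L' w) (L' b)) ≤
      ∑ b ∈ {v, w}ᶜ, (min (L v) (L b) + min (L w) (L b)) :=
    Finset.sum_le_sum fun b hb => by rw [hcompl b hb]; omega
  have hrest : ∑ a ∈ {v, w}ᶜ, ∑ b ∈ {v, w}ᶜ, min (L' a) (L' b) =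
      ∑ a ∈ {v, w}ᶜ, ∑ b ∈ {v, w}ᶜ, min (L a) (L b) :=
    Finset.sum_congr rfl fun a ha => Finset.sum_congr rfl fun b hb => by
      rw [hcompl a ha, hcompl b hb]
  rw [sum_sum_min_eq_add_compl L hvw, sum_sum_min_eq_add_compl L' hvw, hrest]
  omega

end PairSums

section MonomialSymmetric

variable {e : ℕ} [NeZero e] {m : ZMod e → ℕ}

theorem mem_orbit {α β : Var m → ℕ} : β ∈ orbit α ↔ ∃ w : RowPerm m, actSeq w α = β := by
  simp [orbit]

theorem self_mem_orbit (α : Var m → ℕ) : α ∈ orbit α := mem_orbit.2 ⟨1, rfl⟩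

theorem actSeq_mem_orbit {α β : Var m → ℕ} (w : RowPerm m) (h : β ∈ orbit α) :
    actSeq w β ∈ orbit α := by
  obtain ⟨w', rfl⟩ := mem_orbit.1 h
  exact mem_orbit.2 ⟨w * w', (actSeq_mul _ _ _).symm⟩

theorem eq_of_mem_orbit_of_rowAntitone {α : EPart m} {β : Var m → ℕ} (h : β ∈ orbit α.1)
    (hβ : RowAntitone β) : β = α.1 := by
  obtain ⟨w, rfl⟩ := mem_orbit.1 h
  exact actSeq_eq_self_of_rowAntitone α.2 hβ

theorem sum_of_mem_orbit {α β : Var m → ℕ} (h : β ∈ orbit α) : ∑ v, β v = ∑ v, α v := by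
  obtain ⟨w, rfl⟩ := mem_orbit.1 h
  exact sum_actSeq w α

theorem sum_orbit_actSeq {M : Type*} [AddCommMonoid M] (α : Var m → ℕ) (w : RowPerm m)
    (f : (Var m → ℕ) → M) : ∑ β ∈ orbit α, f (actSeq w β) = ∑ β ∈ orbit α, f β :=
  Finset.sum_bij' (fun β _ => actSeq w β) (fun β _ => actSeq w⁻¹ β)
    (fun _ => actSeq_mem_orbit w) (fun _ => actSeq_mem_orbit w⁻¹)
    (fun β _ => actSeq_inv_actSeq w β) (fun β _ => actSeq_actSeq_inv w β) (fun _ _ => rfl)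

theorem coe_monSym (α : EPart m) : (monSym α : Poly m) = ∑ β ∈ orbit α.1, xpow β := rfl

theorem coeff_monSym (α β : EPart m) :
    MvPolynomial.coeff (expo β.1) (monSym α : Poly m) = if α = β then 1 else 0 := by
  have hmem : β.1 ∈ orbit α.1 ↔ α = β :=
    ⟨fun h => Subtype.ext (eq_of_mem_orbit_of_rowAntitone h β.2).symm,
      by rintro rfl; exact self_mem_orbit _⟩
  simp only [coe_monSym, MvPolynomial.coeff_sum, coeff_xpow, Finset.sum_ite_eq', hmem]

theorem alternant_mul_monSym (κ : Var m → ℕ) (α : EPart m) :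
    alternant κ * (monSym α : Poly m) = ∑ β ∈ orbit α.1, alternant (κ + β) := by
  simp only [alternant_eq_sum, Finset.sum_mul]
  rw [Finset.sum_comm]
  refine Finset.sum_congr rfl fun w _ => ?_
  rw [coe_monSym, smul_mul_assoc, ← sum_orbit_actSeq α.1 w, Finset.mul_sum, Finset.smul_sum]
  simp only [actSeq_add, xpow_add]

/-- The coefficient of the Schur function `s_β` in the monomial symmetric polynomial `m_α`. -/
def monToSchur {n : ℕ} (α β : Zn m n) : ℤ :=
  ∑ γ ∈ orbit α.1.1, altCoeff (delta m + γ) (symbol β.1)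

theorem alternant_delta_mul_monSym {n : ℕ} (α : Zn m n) :
    alternant (delta m) * (monSym α.1 : Poly m) =
      ∑ β : Zn m n, (monToSchur α β : F) • alternant (symbol β.1) := by
  rw [alternant_mul_monSym]
  simp only [monToSchur, Int.cast_sum, Finset.sum_smul]
  rw [Finset.sum_comm]
  refine Finset.sum_congr rfl fun γ hγ => alternant_eq_sum_symbol ?_
  simp only [Pi.add_apply, Finset.sum_add_distrib]
  rw [sum_of_mem_orbit hγ, α.2, add_comm]

end MonomialSymmetric

section AFunction

variable {e : ℕ} [NeZero e] {m : ZMod e → ℕ}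

theorem two_mul_minSum (L : Var m → ℕ) :
    2 * minSum L + ∑ v, L v = ∑ v, ∑ w, min (L v) (L w) := by
  rw [minSum, ← smul_eq_mul, two_nsmul_sum_not_isDiag, ← Fintype.sum_prod_type',
    ← Finset.univ_product_univ, ← Finset.diag_union_offDiag univ,
    Finset.sum_union (Finset.disjoint_diag_offDiag _), Finset.sum_diag, add_comm]
  simp only [min_self, Sym2.lift_mk]

theorem minSum_congr {L L' : Var m → ℕ}
    (h : (univ : Finset (Var m)).val.map L = (univ : Finset (Var m)).val.map L') :
    minSum L = minSum L' := by
  have hmultiset (L : Var m → ℕ) : 2 * minSum L + ((univ : Finset (Var m)).val.map L).sum =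
      (((univ : Finset (Var m)).val.map L).map fun x =>
        (((univ : Finset (Var m)).val.map L).map fun y => min x y).sum).sum := by
    simp only [Multiset.map_map]
    exact two_mul_minSum L
  have hL := hmultiset L
  rw [h, ← hmultiset L'] at hL
  omega

theorem exists_minSum_delta_add_actSeq_lt {β : Var m → ℕ} (hβ : ¬ RowAntitone β) :
    ∃ w : RowPerm m, minSum (delta m + actSeq w β) < minSum (delta m + β) := by
  simp only [RowAntitone, Antitone, not_forall, not_le] at hβ
  obtain ⟨k, i, j, hij, hlt⟩ := hβ
  have hij : i < j := lt_of_le_of_ne hij (by rintro rfl; exact lt_irrefl _ hlt)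
  have hne : (⟨k, i⟩ : Var m) ≠ ⟨k, j⟩ := by simp [hij.ne]
  have hδ : delta m ⟨k, j⟩ < delta m ⟨k, i⟩ := strictAnti_delta k hij
  let w : RowPerm m := Pi.mulSingle k (Equiv.swap i j)
  have hw : actSeq w β = β ∘ Equiv.swap ⟨k, i⟩ ⟨k, j⟩ := actSeq_mulSingle_swap k i j β
  have hi : actSeq w β ⟨k, i⟩ = β ⟨k, j⟩ := by simp [hw]
  have hj : actSeq w β ⟨k, j⟩ = β ⟨k, i⟩ := by simp [hw]
  have hpairs := sum_sum_min_lt (L := delta m + β) (L' := delta m + actSeq w β) hne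
    (fun u hui huj => by simp [hw, Equiv.swap_apply_of_ne_of_ne hui huj])
    (by simp only [Pi.add_apply, hi, hj]; omega)
    (by simp only [Pi.add_apply, hi]; omega) (by simp only [Pi.add_apply, hi]; omega)
  have hsum : ∑ v, (delta m + actSeq w β) v = ∑ v, (delta m + β) v := by
    simp only [Pi.add_apply, Finset.sum_add_distrib, sum_actSeq]
  rw [← two_mul_minSum, ← two_mul_minSum] at hpairs
  exact ⟨w, by omega⟩

theorem minSum_symbol_le_of_mem_orbit {α : EPart m} {β : Var m → ℕ} (hβ : β ∈ orbit α.1) :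
    minSum (symbol α) ≤ minSum (delta m + β) := by
  obtain ⟨γ, hγ, hmin⟩ := Finset.exists_min_image (orbit α.1) (fun γ => minSum (delta m + γ))
    ⟨_, self_mem_orbit _⟩
  have hanti : RowAntitone γ := by
    by_contra hcon
    obtain ⟨w, hw⟩ := exists_minSum_delta_add_actSeq_lt hcon
    exact (hmin _ (actSeq_mem_orbit w hγ)).not_gt hw
  rw [symbol_eq_add, ← eq_of_mem_orbit_of_rowAntitone hγ hanti]
  exact hmin β hβ

theorem minSum_symbol_lt_of_mem_orbit {α : EPart m} {β : Var m → ℕ} (hβ : β ∈ orbit α.1)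
    (hne : β ≠ α.1) : minSum (symbol α) < minSum (delta m + β) := by
  obtain ⟨w, hw⟩ := exists_minSum_delta_add_actSeq_lt fun h =>
    hne (eq_of_mem_orbit_of_rowAntitone hβ h)
  exact (minSum_symbol_le_of_mem_orbit (actSeq_mem_orbit w hβ)).trans_lt hw

end AFunction

section Families

variable {e : ℕ} [NeZero e] {m : ZMod e → ℕ} {n : ℕ} {prec : Zn m n → Zn m n → Prop}

theorem Similar.aFun_eq {α β : Zn m n} (h : Similar α β) : aFun α = aFun β := by
  rw [aFun, aFun, minSum_congr h]

open Classical in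
/-- The number of `β ≺ α` outside the family of `α`. For an admissible order, families are the
level sets of `familyRank`, and comparing ranks is comparing families. -/
def familyRank (prec : Zn m n → Zn m n → Prop) (α : Zn m n) : ℕ :=
  #{β | prec β α ∧ ¬ Similar β α}

theorem IsAdmissible.prec_of_similar (h : IsAdmissible prec) {α β γ : Zn m n} (hγβ : prec γ β)
    (hs : Similar β α) (hns : ¬ Similar γ α) : prec γ α := by
  have := h.total
  rcases trichotomous_of prec γ α with hlt | rfl | hgt
  · exact hlt
  · exact absurd rfl hns
  · exact absurd (h.interval _ _ _ hs.symm hgt hγβ).symm hns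

theorem IsAdmissible.familyRank_eq (h : IsAdmissible prec) {α β : Zn m n} (hs : Similar β α) :
    familyRank prec β = familyRank prec α := by
  rw [familyRank, familyRank]
  congr! 2 with γ
  refine ⟨fun hγ => ?_, fun hγ => ?_⟩
  · have hns : ¬ Similar γ α := fun h' => hγ.2 (h'.trans hs.symm)
    exact ⟨h.prec_of_similar hγ.1 hs hns, hns⟩
  · have hns : ¬ Similar γ β := fun h' => hγ.2 (h'.trans hs)
    exact ⟨h.prec_of_similar hγ.1 hs.symm hns, hns⟩

theorem IsAdmissible.familyRank_lt (h : IsAdmissible prec) {α β : Zn m n} (hβα : prec β α)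
    (hns : ¬ Similar β α) : familyRank prec β < familyRank prec α := by
  have := h.total
  classical
  refine Finset.card_lt_card ((Finset.ssubset_iff_of_subset fun γ hγ => ?_).2 ⟨β, ?_, ?_⟩)
  · simp only [mem_filter, mem_univ, true_and] at hγ ⊢
    exact ⟨_root_.trans hγ.1 hβα, fun hs => hns (hs.symm.trans (h.interval _ _ _ hs hγ.1 hβα)).symm⟩
  · simp [hβα, hns]
  · simp [irrefl_of prec β]

theorem IsAdmissible.familyRank_lt_iff (h : IsAdmissible prec) {α β : Zn m n} :
    familyRank prec β < familyRank prec α ↔ prec β α ∧ ¬ Similar β α := by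
  refine ⟨fun hlt => ?_, fun hβα => h.familyRank_lt hβα.1 hβα.2⟩
  have hns : ¬ Similar β α := fun hs => hlt.ne (h.familyRank_eq hs)
  have := h.total
  rcases trichotomous_of prec β α with hβα | rfl | hαβ
  · exact ⟨hβα, hns⟩
  · exact absurd hlt (lt_irrefl _)
  · exact absurd (h.familyRank_lt hαβ fun hs => hns hs.symm) hlt.not_gt

theorem IsAdmissible.familyRank_eq_iff (h : IsAdmissible prec) {α β : Zn m n} :
    familyRank prec β = familyRank prec α ↔ Similar β α := by
  refine ⟨fun heq => by_contra fun hns => ?_, h.familyRank_eq⟩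
  have := h.total
  rcases trichotomous_of prec β α with hβα | rfl | hαβ
  · exact (h.familyRank_lt hβα hns).ne heq
  · exact hns rfl
  · exact (h.familyRank_lt hαβ fun hs => hns hs.symm).ne' heq

theorem IsAdmissible.familyRank_lt_of_aFun_lt (h : IsAdmissible prec) {α β : Zn m n}
    (hlt : aFun α < aFun β) : familyRank prec β < familyRank prec α := by
  have := h.total
  refine h.familyRank_lt ?_ fun hs => hlt.ne' hs.aFun_eq
  rcases trichotomous_of prec β α with hβα | rfl | hαβ
  · exact hβα
  · exact absurd hlt (lt_irrefl _)
  · exact absurd (h.aFun_le _ _ hαβ) hlt.not_ge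

theorem map_univ_eq_of_altCoeff_ne_zero {κ κ' : Var m → ℕ} (h : altCoeff κ κ' ≠ 0) :
    (univ : Finset (Var m)).val.map κ' = (univ : Finset (Var m)).val.map κ := by
  obtain ⟨w, rfl⟩ := exists_actSeq_eq_of_altCoeff_ne_zero h
  exact map_univ_actSeq w κ

theorem IsAdmissible.familyRank_lt_of_altCoeff_ne_zero (h : IsAdmissible prec) {α β : Zn m n}
    {γ κ : Var m → ℕ} (hγ : γ ∈ orbit α.1.1) (hne : γ ≠ α.1.1)
    (hκ : (univ : Finset (Var m)).val.map κ = (univ : Finset (Var m)).val.map (delta m + γ))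
    (hc : altCoeff κ (symbol β.1) ≠ 0) : familyRank prec β < familyRank prec α := by
  have hα := minSum_symbol_lt_of_mem_orbit hγ hne
  have hβ := minSum_congr ((map_univ_eq_of_altCoeff_ne_zero hc).trans hκ)
  refine h.familyRank_lt_of_aFun_lt ?_
  rw [aFun, aFun]
  omega

theorem monToSchur_eq (h : IsAdmissible prec) {α β : Zn m n}
    (hαβ : familyRank prec α ≤ familyRank prec β) :
    monToSchur α β = if α = β then 1 else 0 := by
  rw [monToSchur, Finset.sum_eq_single α.1.1]
  · rw [← symbol_eq_add, altCoeff_symbol]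
    simp only [Subtype.ext_iff]
  · intro γ hγ hne
    by_contra hc
    exact hαβ.not_gt (h.familyRank_lt_of_altCoeff_ne_zero hγ hne rfl hc)
  · exact fun hα => absurd (self_mem_orbit _) hα

end Families

section IndexSets

variable {e : ℕ} {m : ZMod e → ℕ} {J : Finset (∀ k : ZMod e, Fin (m k))}

theorem shift_neg_shift (s : ℤˣ) (k : ZMod e) : shift (-s) (shift s k 1) 1 = k := by
  simp [shift]

/-- Any two distinct vectors of `J` differ in every entry. -/
def EntrywiseDisjoint (J : Finset (∀ k : ZMod e, Fin (m k))) : Prop :=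
  ∀ i ∈ J, ∀ j ∈ J, i ≠ j → ∀ k, i k ≠ j k

theorem move_of_mem (hJ : EntrywiseDisjoint J) (s : ℤˣ) {i : ∀ k, Fin (m k)} (hi : i ∈ J)
    (k : ZMod e) : move s J ⟨k, i k⟩ = ⟨shift s k 1, i (shift s k 1)⟩ := by
  have hocc : Occ J ⟨k, i k⟩ := ⟨i, hi, rfl⟩
  obtain ⟨hmem, hk⟩ := hocc.choose_spec
  have heq : hocc.choose = i := by_contra fun hne => hJ _ hmem i hi hne k hk
  rw [move, dif_pos hocc, heq]

theorem move_of_not_occ (s : ℤˣ) {v : Var m} (hv : ¬ Occ J v) : move s J v = v :=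
  dif_neg hv

theorem Occ.exists_mem {v : Var m} (hv : Occ J v) : ∃ i ∈ J, v = ⟨v.1, i v.1⟩ := by
  obtain ⟨i, hi, hiv⟩ := hv
  exact ⟨i, hi, by rw [hiv]⟩

theorem occ_move (hJ : EntrywiseDisjoint J) (s : ℤˣ) (v : Var m) :
    Occ J (move s J v) ↔ Occ J v := by
  by_cases hv : Occ J v
  · obtain ⟨i, hi, hiv⟩ := hv.exists_mem
    rw [hiv, move_of_mem hJ s hi]
    exact ⟨fun _ => ⟨i, hi, rfl⟩, fun _ => ⟨i, hi, rfl⟩⟩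
  · rw [move_of_not_occ s hv]

theorem move_neg_move (hJ : EntrywiseDisjoint J) (s : ℤˣ) (v : Var m) :
    move (-s) J (move s J v) = v := by
  by_cases hv : Occ J v
  · obtain ⟨i, hi, hiv⟩ := hv.exists_mem
    rw [hiv, move_of_mem hJ s hi, move_of_mem hJ (-s) hi, shift_neg_shift]
  · rw [move_of_not_occ s hv, move_of_not_occ _ hv]

/-- The permutation of the positions given by `move s J`. -/
def moveEquiv (hJ : EntrywiseDisjoint J) (s : ℤˣ) : Equiv.Perm (Var m) where
  toFun := move s J
  invFun := move (-s) J
  left_inv := move_neg_move hJ s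
  right_inv v := by simpa only [neg_neg] using move_neg_move hJ (-s) v

open Classical in
/-- The scalar by which `T_{u,J}` multiplies the variable at the position `v`. -/
def occVal (u : F) (J : Finset (∀ k : ZMod e, Fin (m k))) (v : Var m) : F :=
  if Occ J v then u else 1

theorem occVal_move (hJ : EntrywiseDisjoint J) (u : F) (s : ℤˣ) (v : Var m) :
    occVal u J (move s J v) = occVal u J v := by
  simp only [occVal, occ_move hJ s v]

theorem opT_X (s : ℤˣ) (u : F) (J : Finset (∀ k : ZMod e, Fin (m k))) (v : Var m) :
    opT s u J (MvPolynomial.X v) =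
      MvPolynomial.C (occVal u J v) * MvPolynomial.X (move s J v) := by
  rw [opT, MvPolynomial.aeval_X, occVal]
  split_ifs with hv
  · rfl
  · rw [move_of_not_occ s hv, map_one, one_mul]

theorem seqMove_add (s : ℤˣ) (J : Finset (∀ k : ZMod e, Fin (m k))) (β γ : Var m → ℕ) :
    seqMove s J (β + γ) = seqMove s J β + seqMove s J γ := rfl

/-- The action of row permutations on sets of vectors. -/
def actSet (w : RowPerm m) (J : Finset (∀ k : ZMod e, Fin (m k))) :
    Finset (∀ k : ZMod e, Fin (m k)) := J.map (Equiv.piCongrRight w).toEmbedding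

theorem mem_actSet (w : RowPerm m) {i : ∀ k : ZMod e, Fin (m k)} :
    i ∈ actSet w J ↔ ∃ j ∈ J, (fun k => w k (j k)) = i := by
  simp only [actSet, mem_map, Equiv.coe_toEmbedding]
  rfl

theorem actSet_inv_actSet (w : RowPerm m) (J : Finset (∀ k : ZMod e, Fin (m k))) :
    actSet w⁻¹ (actSet w J) = J := by
  ext i
  simp [mem_actSet]

theorem occ_actSet (w : RowPerm m) (v : Var m) : Occ (actSet w J) (toPerm w v) ↔ Occ J v := by
  constructor
  · rintro ⟨i, hi, hiv⟩
    obtain ⟨j, hj, rfl⟩ := (mem_actSet w).1 hi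
    exact ⟨j, hj, (w v.1).injective hiv⟩
  · rintro ⟨i, hi, hiv⟩
    exact ⟨_, (mem_actSet w).2 ⟨i, hi, rfl⟩, congrArg (w v.1) hiv⟩

theorem EntrywiseDisjoint.actSet (hJ : EntrywiseDisjoint J) (w : RowPerm m) :
    EntrywiseDisjoint (actSet w J) := by
  intro i hi j hj hne k hk
  obtain ⟨i', hi', rfl⟩ := (mem_actSet w).1 hi
  obtain ⟨j', hj', rfl⟩ := (mem_actSet w).1 hj
  exact hJ i' hi' j' hj' (fun h => hne (by rw [h])) k ((w k).injective hk)

theorem move_actSet (hJ : EntrywiseDisjoint J) (s : ℤˣ) (w : RowPerm m) (v : Var m) :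
    move s (actSet w J) (toPerm w v) = toPerm w (move s J v) := by
  by_cases hv : Occ J v
  · obtain ⟨i, hi, hiv⟩ := hv.exists_mem
    rw [hiv, move_of_mem hJ s hi]
    exact move_of_mem (hJ.actSet w) s ((mem_actSet w).2 ⟨i, hi, rfl⟩) v.1
  · rw [move_of_not_occ s hv, move_of_not_occ s (by rwa [occ_actSet])]

theorem opT_actSet_actPoly (hJ : EntrywiseDisjoint J) (s : ℤˣ) (u : F) (w : RowPerm m)
    (f : Poly m) : opT s u (actSet w J) (actPoly w f) = actPoly w (opT s u J f) := by
  suffices (opT s u (actSet w J)).comp (actPoly w) = (actPoly w).comp (opT s u J) from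
    DFunLike.congr_fun this f
  refine MvPolynomial.algHom_ext fun v => ?_
  simp only [AlgHom.comp_apply, actPoly, MvPolynomial.rename_X, opT_X, map_mul,
    MvPolynomial.rename_C, move_actSet hJ, occVal, occ_actSet]

end IndexSets

section MacdonaldOperators

variable {e : ℕ} [NeZero e] {m : ZMod e → ℕ} {J : Finset (∀ k : ZMod e, Fin (m k))}

theorem entrywiseDisjoint_of_mem {r : ℕ} (hJ : J ∈ IndexSets m r) : EntrywiseDisjoint J :=
  (mem_filter.1 hJ).2.2

theorem actSet_mem_indexSets {r : ℕ} (w : RowPerm m) (hJ : J ∈ IndexSets m r) :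
    actSet w J ∈ IndexSets m r :=
  mem_filter.2 ⟨mem_univ _, (card_map _).trans (mem_filter.1 hJ).2.1,
    (entrywiseDisjoint_of_mem hJ).actSet w⟩

theorem sum_indexSets_actSet {M : Type*} [AddCommMonoid M] (r : ℕ) (w : RowPerm m)
    (f : Finset (∀ k : ZMod e, Fin (m k)) → M) :
    ∑ J ∈ IndexSets m r, f (actSet w J) = ∑ J ∈ IndexSets m r, f J :=
  Finset.sum_bij' (fun J _ => actSet w J) (fun J _ => actSet w⁻¹ J)
    (fun _ => actSet_mem_indexSets w) (fun _ => actSet_mem_indexSets w⁻¹)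
    (fun J _ => actSet_inv_actSet w J)
    (fun J _ => by simpa only [inv_inv] using actSet_inv_actSet w⁻¹ J) (fun _ _ => rfl)

theorem xpow_eq_prod (β : Var m → ℕ) : xpow β = ∏ v, (MvPolynomial.X v : Poly m) ^ β v := by
  rw [xpow, MvPolynomial.monomial_eq, map_one, one_mul,
    Finsupp.prod_fintype _ _ fun _ => pow_zero _]
  rfl

theorem prod_occVal_pow (u : F) (J : Finset (∀ k : ZMod e, Fin (m k))) (β : Var m → ℕ) :
    ∏ v, occVal u J v ^ β v = u ^ pairing β J := by
  simp only [pairing, occVal, ← Finset.prod_pow_eq_pow_sum, Finset.prod_filter, ite_pow, one_pow]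

theorem opT_xpow (hJ : EntrywiseDisjoint J) (s : ℤˣ) (u : F) (β : Var m → ℕ) :
    opT s u J (xpow β) = MvPolynomial.C (u ^ pairing β J) * xpow (seqMove s J β) := by
  simp only [xpow_eq_prod, map_prod, map_pow, opT_X, mul_pow, Finset.prod_mul_distrib]
  congr 1
  · rw [← map_pow, ← prod_occVal_pow, map_prod]
    simp only [map_pow]
  · conv_rhs => rw [← Equiv.prod_comp (moveEquiv hJ s)]
    simp only [moveEquiv, Equiv.coe_fn_mk, seqMove, move_neg_move hJ s]

theorem map_univ_seqMove (hJ : EntrywiseDisjoint J) (s : ℤˣ) (β : Var m → ℕ) :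
    (univ : Finset (Var m)).val.map (seqMove s J β) = (univ : Finset (Var m)).val.map β := by
  conv_rhs => rw [← Multiset.map_univ_val_equiv (moveEquiv hJ (-s)), Multiset.map_map]
  rfl

/-- The numerator `a_δ D^r_±` of the Macdonald operator, which preserves polynomials. -/
def opNum (s : ℤˣ) (r : ℕ) : Poly m →ₗ[F] Poly m :=
  ∑ J ∈ IndexSets m r,
    LinearMap.mulLeft F (opT s t J (alternant (delta m))) ∘ₗ (opT s q J).toLinearMap

theorem opNum_apply (s : ℤˣ) (r : ℕ) (f : Poly m) :
    opNum s r f = ∑ J ∈ IndexSets m r, opT s t J (alternant (delta m)) * opT s q J f := by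
  simp only [opNum, LinearMap.sum_apply, LinearMap.comp_apply, LinearMap.mulLeft_apply,
    AlgHom.toLinearMap_apply]

theorem opNum_eq_sum_smul (s : ℤˣ) (r : ℕ) (f : Poly m) :
    opNum s r f = ∑ w : RowPerm m, (sgn w : ℤ) • ∑ J ∈ IndexSets m r,
      opT s t J (xpow (actSeq w (delta m))) * opT s q J f := by
  simp only [opNum_apply, alternant_eq_sum, map_sum, map_zsmul, Finset.sum_mul, smul_mul_assoc,
    Finset.smul_sum]
  exact Finset.sum_comm

theorem opD_eq (s : ℤˣ) (r : ℕ) (f : Poly m) :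
    opD s r f = (algebraMap (Poly m) (RatFn m) (alternant (delta m)))⁻¹ *
      algebraMap (Poly m) (RatFn m) (opNum s r f) := by
  rw [opD, opNum_eq_sum_smul]
  simp only [map_sum, map_zsmul]
  congr! 5 with w _ J hJ
  rw [opT_xpow (entrywiseDisjoint_of_mem hJ), mul_comm (xpow _)]

theorem opNum_eq_antisymmetrization (s : ℤˣ) (r : ℕ) (f : Xi m) :
    opNum s r f = ∑ w : RowPerm m, (sgn w : ℤ) • actPoly w
      (∑ J ∈ IndexSets m r, opT s t J (xpow (delta m)) * opT s q J f) := by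
  rw [opNum_eq_sum_smul]
  refine Finset.sum_congr rfl fun w _ => congrArg _ ?_
  rw [← sum_indexSets_actSet r w, map_sum]
  refine Finset.sum_congr rfl fun J hJ => ?_
  have hJ := entrywiseDisjoint_of_mem hJ
  conv_lhs => rw [← f.2 w]
  rw [map_mul, ← opT_actSet_actPoly hJ, ← opT_actSet_actPoly hJ, actPoly_xpow]

theorem opNum_monSym (s : ℤˣ) (r : ℕ) (α : EPart m) :
    opNum s r (monSym α : Poly m) = ∑ β ∈ orbit α.1, ∑ J ∈ IndexSets m r,
      (t ^ pairing (delta m) J * q ^ pairing β J) • alternant (seqMove s J (delta m + β)) := by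
  have hterm : ∀ J ∈ IndexSets m r, opT s t J (xpow (delta m)) * opT s q J (monSym α : Poly m) =
      ∑ β ∈ orbit α.1, (t ^ pairing (delta m) J * q ^ pairing β J) •
        xpow (seqMove s J (delta m + β)) := by
    intro J hJ
    have hJ := entrywiseDisjoint_of_mem hJ
    simp only [coe_monSym, map_sum, Finset.mul_sum, opT_xpow hJ, seqMove_add, xpow_add,
      MvPolynomial.smul_eq_C_mul, map_mul]
    exact Finset.sum_congr rfl fun β _ => mul_mul_mul_comm _ _ _ _
  rw [opNum_eq_antisymmetrization, Finset.sum_congr rfl hterm, Finset.sum_comm]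
  simp only [alternant, map_sum, map_smul, Finset.smul_sum, smul_comm _ (_ : F)]
  rw [Finset.sum_comm]
  exact Finset.sum_congr rfl fun β _ => Finset.sum_comm

theorem sum_seqMove (hJ : EntrywiseDisjoint J) (s : ℤˣ) (β : Var m → ℕ) :
    ∑ v, seqMove s J β v = ∑ v, β v :=
  Equiv.sum_comp (moveEquiv hJ (-s)) β

/-- The coefficient of the Schur function `s_β` in `D^r_± m_α`. -/
def opSchurMatrix (s : ℤˣ) (r : ℕ) {n : ℕ} (α β : Zn m n) : F :=
  ∑ γ ∈ orbit α.1.1, ∑ J ∈ IndexSets m r, t ^ pairing (delta m) J * q ^ pairing γ J *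
    (altCoeff (seqMove s J (delta m + γ)) (symbol β.1) : F)

theorem opNum_monSym_eq_sum_symbol (s : ℤˣ) (r : ℕ) {n : ℕ} (α : Zn m n) :
    opNum s r (monSym α.1 : Poly m) =
      ∑ β : Zn m n, opSchurMatrix s r α β • alternant (symbol β.1) := by
  simp only [opNum_monSym, opSchurMatrix, Finset.sum_smul]
  rw [Finset.sum_comm (t := orbit _)]
  refine Finset.sum_congr rfl fun γ hγ => ?_
  rw [Finset.sum_comm]
  refine Finset.sum_congr rfl fun J hJ => ?_
  have hsum : ∑ v, seqMove s J (delta m + γ) v = n + ∑ v, delta m v := by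
    rw [sum_seqMove (entrywiseDisjoint_of_mem hJ)]
    simp only [Pi.add_apply, Finset.sum_add_distrib]
    rw [sum_of_mem_orbit hγ, α.2, add_comm]
  rw [alternant_eq_sum_symbol hsum, Finset.smul_sum]
  exact Finset.sum_congr rfl fun β _ => smul_smul _ _ _

theorem opSchurMatrix_eq_zero {n : ℕ} {prec : Zn m n → Zn m n → Prop} (h : IsAdmissible prec)
    (s : ℤˣ) (r : ℕ) {α β : Zn m n} (hαβ : familyRank prec α < familyRank prec β) :
    opSchurMatrix s r α β = 0 := by
  refine Finset.sum_eq_zero fun γ hγ => Finset.sum_eq_zero fun J hJ => ?_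
  have hmap := map_univ_seqMove (entrywiseDisjoint_of_mem hJ) s (delta m + γ)
  suffices altCoeff (seqMove s J (delta m + γ)) (symbol β.1) = 0 by
    rw [this, Int.cast_zero, mul_zero]
  by_contra hc
  obtain rfl | hne := eq_or_ne γ α.1.1
  · rw [← symbol_eq_add] at hmap hc
    exact hαβ.ne' (h.familyRank_eq ((map_univ_eq_of_altCoeff_ne_zero hc).trans hmap))
  · exact hαβ.not_gt (h.familyRank_lt_of_altCoeff_ne_zero hγ hne hmap hc)

end MacdonaldOperators

section PowerSeries

variable {R A A' : Type*} [CommRing R] [CommRing A] [CommRing A'] [Algebra R A] [Algebra R A']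

/-- The power series `∑ f(d) z^d Y^d` in `Y`, that is, the power series with coefficients `f`
evaluated at `z Y`. -/
def serAt (f : ℕ → R) (z : A) : PowerSeries A :=
  PowerSeries.mk fun d => algebraMap R A (f d) * z ^ d

/-- The power series `1 - z Y` in `Y`. -/
def linAt (z : A) : PowerSeries A := 1 - PowerSeries.C z * PowerSeries.X

theorem coeff_serAt (f : ℕ → R) (z : A) (d : ℕ) :
    PowerSeries.coeff d (serAt f z) = algebraMap R A (f d) * z ^ d :=
  PowerSeries.coeff_mk _ _

theorem map_serAt (T : A →ₐ[R] A') (f : ℕ → R) (z : A) :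
    PowerSeries.map (T : A →+* A') (serAt f z) = serAt f (T z) := by
  ext d
  simp [coeff_serAt]

theorem map_linAt (T : A →+* A') (z : A) : PowerSeries.map T (linAt z) = linAt (T z) := by
  simp [linAt]

theorem rescale_serAt (f : ℕ → R) (u z : A) :
    PowerSeries.rescale u (serAt f z) = serAt f (u * z) := by
  ext d
  rw [PowerSeries.coeff_rescale, coeff_serAt, coeff_serAt, mul_pow, mul_left_comm]

theorem constantCoeff_linAt (z : A) : PowerSeries.constantCoeff (linAt z) = 1 := by
  simp [linAt]

theorem coeff_succ_mul_linAt (φ : PowerSeries A) (z : A) (d : ℕ) :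
    PowerSeries.coeff (d + 1) (φ * linAt z) =
      PowerSeries.coeff (d + 1) φ - PowerSeries.coeff d φ * z := by
  rw [linAt, mul_sub, mul_one, map_sub, mul_comm (PowerSeries.C z), ← mul_assoc,
    PowerSeries.coeff_mul_C, PowerSeries.coeff_succ_mul_X]

theorem serAt_one_mul_linAt (z : A) : serAt (fun _ => (1 : R)) z * linAt z = 1 := by
  ext d
  cases d with
  | zero => simp [serAt, linAt]
  | succ d => simp [coeff_succ_mul_linAt, coeff_serAt, pow_succ, PowerSeries.coeff_one]

end PowerSeries

section QDifference

variable {e : ℕ} {R : Type*} [CommRing R] {R' : Type*} [CommRing R']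

/-- The sequences `c a` of coefficients of power series `c_a(Z)`, indexed by `a : ZMod e`, with
constant terms `1` and `(1 - Z)^{[a = 0]} c_a(Z) = (1 - t Z)^{[a = 1]} c_{a-1}(q Z)`. -/
structure IsQSolution (q t : R) (c : ZMod e → ℕ → R) : Prop where
  zero : ∀ a, c a 0 = 1
  succ : ∀ a d, c a (d + 1) - (if a = 0 then c a d else 0) =
    q ^ (d + 1) * c (a - 1) (d + 1) - (if a = 1 then t * q ^ d * c (a - 1) d else 0)

theorem IsQSolution.map {q t : R} {c : ZMod e → ℕ → R} (h : IsQSolution q t c) (φ : R →+* R') :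
    IsQSolution (φ q) (φ t) fun a d => φ (c a d) where
  zero a := by rw [h.zero, map_one]
  succ a d := by
    simpa only [map_sub, apply_ite φ, map_mul, map_pow, map_zero] using congrArg φ (h.succ a d)

theorem eq_zero_of_cyclic_recurrence {Q : R} (hQ : IsUnit (1 - Q ^ e)) {g : ZMod e → R}
    (hg : ∀ a, g a = Q * g (a - 1)) : g = 0 := by
  have hiter (i : ℕ) (a : ZMod e) : g a = Q ^ i * g (a - i) := by
    induction i with
    | zero => simp
    | succ i ih => rw [ih, hg (a - i), Nat.cast_succ, sub_sub, pow_succ, mul_assoc]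
  funext a
  have hround := hiter e a
  rw [ZMod.natCast_self, sub_zero] at hround
  exact hQ.mul_right_eq_zero.1 (by linear_combination hround)

theorem exists_cyclic_recurrence {Q : R} (hQ : IsUnit (1 - Q ^ e)) (f : ZMod e → R) :
    ∃ g : ZMod e → R, ∀ a, g a = Q * g (a - 1) + f a := by
  obtain ⟨u, hu⟩ := hQ
  refine ⟨fun a => (↑u⁻¹ : R) * ∑ i ∈ range e, Q ^ i * f (a - i), fun a => ?_⟩
  have hshift : Q * ∑ i ∈ range e, Q ^ i * f (a - 1 - i) =
      ∑ i ∈ range e, Q ^ i * f (a - i) + Q ^ e * f a - f a := by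
    have hsucc := Finset.sum_range_succ (fun i : ℕ => Q ^ i * f (a - i)) e
    rw [Finset.sum_range_succ'] at hsucc
    simp only [Nat.cast_zero, sub_zero, pow_zero, one_mul, ZMod.natCast_self] at hsucc
    rw [← hsucc, Finset.mul_sum, add_sub_cancel_right]
    refine Finset.sum_congr rfl fun i _ => ?_
    rw [pow_succ', mul_assoc, sub_sub, add_comm (1 : ZMod e), Nat.cast_succ]
  have hinv : (↑u⁻¹ : R) * (1 - Q ^ e) = 1 := by rw [← hu, Units.inv_mul]
  linear_combination (-(↑u⁻¹ : R)) * hshift + f a * hinv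

theorem IsQSolution.unique {q t : R} (hq : ∀ d : ℕ, IsUnit (1 - q ^ ((d + 1) * e)))
    {c c' : ZMod e → ℕ → R} (h : IsQSolution q t c) (h' : IsQSolution q t c') : c = c' := by
  suffices ∀ d a, c a d = c' a d from funext fun a => funext fun d => this d a
  intro d
  induction d with
  | zero => intro a; rw [h.zero, h'.zero]
  | succ d ih =>
    have hdiff : (fun a => c a (d + 1) - c' a (d + 1)) = 0 :=
      eq_zero_of_cyclic_recurrence (Q := q ^ (d + 1)) (by rw [← pow_mul]; exact hq d) fun a => by
        have hc := h.succ a d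
        rw [ih, ih] at hc
        linear_combination hc - h'.succ a d
    exact fun a => sub_eq_zero.1 (congrFun hdiff a)

theorem exists_isQSolution {q : R} (t : R) (hq : ∀ d : ℕ, IsUnit (1 - q ^ ((d + 1) * e))) :
    ∃ c : ZMod e → ℕ → R, IsQSolution q t c := by
  choose next hnext using fun (d : ℕ) (f : ZMod e → R) =>
    exists_cyclic_recurrence (Q := q ^ (d + 1)) (by rw [← pow_mul]; exact hq d) f
  let source (d : ℕ) (g : ZMod e → R) (a : ZMod e) : R :=
    (if a = 0 then g a else 0) - if a = 1 then t * q ^ d * g (a - 1) else 0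
  let c (d : ℕ) : ZMod e → R := Nat.rec (fun _ => 1) (fun d g => next d (source d g)) d
  refine ⟨fun a d => c d a, fun a => rfl, fun a d => ?_⟩
  have hc : c (d + 1) a = q ^ (d + 1) * c (d + 1) (a - 1) + source d (c d) a := hnext d _ a
  linear_combination hc

theorem isQSolution_zero_zero : IsQSolution (0 : R) (0 : R)
    (fun (a : ZMod e) d => if a = 0 ∨ d = 0 then 1 else 0) where
  zero a := by simp
  succ a d := by by_cases h : a = 0 <;> simp [h]

theorem IsQSolution.serAt_mul_linAt {q t : R} {c : ZMod e → ℕ → R} (h : IsQSolution q t c)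
    {A : Type*} [CommRing A] [Algebra R A] (a : ZMod e) (z : A) :
    serAt (c a) z * (if a = 0 then linAt z else 1) =
      serAt (c (a - 1)) (algebraMap R A q * z) *
        (if a = 1 then linAt (algebraMap R A t * z) else 1) := by
  ext d
  cases d with
  | zero =>
    simp only [PowerSeries.coeff_zero_eq_constantCoeff_apply, map_mul, apply_ite,
      constantCoeff_linAt, ite_self, mul_one]
    simp only [← PowerSeries.coeff_zero_eq_constantCoeff_apply, coeff_serAt, h.zero, pow_zero]
  | succ d =>
    have hsucc := congrArg (fun r => algebraMap R A r * z ^ (d + 1)) (h.succ a d)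
    simp only [map_sub, apply_ite (algebraMap R A), map_mul, map_pow, map_zero] at hsucc
    simp only [mul_ite, mul_one, apply_ite (PowerSeries.coeff (d + 1)), coeff_succ_mul_linAt,
      coeff_serAt, mul_pow]
    split_ifs at hsucc ⊢ <;> linear_combination hsucc

end QDifference

section GeneratingFunctions

variable {e : ℕ} {m : ZMod e → ℕ} {R : Type*} [CommRing R] {R' : Type*} [CommRing R']

/-- The residue `a` such that `k' = k ∓ a`, where `∓` is opposite to the sign `s`. -/
def rowDist (s : ℤˣ) (k k' : ZMod e) : ZMod e := ((s : ℤ) : ZMod e) * (k - k')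

theorem intUnit_cast_mul_self (s : ℤˣ) : ((s : ℤ) : ZMod e) * ((s : ℤ) : ZMod e) = 1 := by
  rw [← Int.cast_mul, ← Units.val_mul, Int.units_mul_self, Units.val_one, Int.cast_one]

theorem rowDist_shift_left (s : ℤˣ) (k k' : ZMod e) :
    rowDist s (shift s k 1) k' = rowDist s k k' - 1 := by
  simp only [rowDist, shift, Nat.cast_one]
  linear_combination (-1 : ZMod e) * intUnit_cast_mul_self (e := e) s

theorem rowDist_shift_right (s : ℤˣ) (k k' : ZMod e) :
    rowDist s k (shift s k' 1) = rowDist s k k' + 1 := by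
  simp only [rowDist, shift, Nat.cast_one]
  linear_combination intUnit_cast_mul_self (e := e) s

theorem rowDist_eq_iff (s : ℤˣ) (k k' : ZMod e) (a : ℕ) :
    rowDist s k k' = a ↔ k' = shift s k a := by
  have hs := intUnit_cast_mul_self (e := e) s
  simp only [rowDist, shift]
  constructor
  · intro h
    linear_combination (-((s : ℤ) : ZMod e)) * h + (k - k') * hs
  · rintro rfl
    linear_combination (a : ZMod e) * hs

theorem rowDist_neg (s : ℤˣ) (k k' : ZMod e) : rowDist (-s) k k' = rowDist s k' k := by
  simp only [rowDist, Units.val_neg, Int.cast_neg]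
  ring

theorem shift_zero (s : ℤˣ) (k : ZMod e) : shift s k 0 = k := by simp [shift]

theorem shift_shift_one (s : ℤˣ) (k : ZMod e) (a : ℕ) :
    shift s (shift s k a) 1 = shift s k (a + 1) := by
  simp only [shift]
  push_cast
  ring

variable [NeZero e]

theorem prod_ite_rowDist_eq {M : Type*} [CommMonoid M] (s : ℤˣ) (k : ZMod e) (a : ℕ)
    (f : Var m → M) :
    (∏ v : Var m, if rowDist s k v.1 = a then f v else 1) =
      ∏ i : Fin (m (shift s k a)), f ⟨shift s k a, i⟩ := by
  simp only [rowDist_eq_iff]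
  rw [Fintype.prod_sigma, Fintype.prod_eq_single (shift s k a)]
  · exact Finset.prod_congr rfl fun i _ => if_pos rfl
  · exact fun k' hk' => Finset.prod_eq_one fun i _ => if_neg hk'

/-- The generating function of the `g_{d,±}^{(k)}`: the product of the power series
`c_a(x_v Y)`, where `a` is the distance from the row `k` to the row of `v`. -/
def gSer (m : ZMod e → ℕ) (c : ZMod e → ℕ → R) (s : ℤˣ) (k : ZMod e) :
    PowerSeries (MvPolynomial (Var m) R) :=
  ∏ v : Var m, serAt (c (rowDist s k v.1)) (MvPolynomial.X v : MvPolynomial (Var m) R)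

theorem map_gSer (φ : R →+* R') (c : ZMod e → ℕ → R) (s : ℤˣ) (k : ZMod e) :
    PowerSeries.map (MvPolynomial.map φ) (gSer m c s k) = gSer m (fun a d => φ (c a d)) s k := by
  rw [gSer, map_prod]
  refine Finset.prod_congr rfl fun v _ => ?_
  ext d
  simp [coeff_serAt]

theorem rename_gSer (c : ZMod e → ℕ → R) (s : ℤˣ) (k : ZMod e) (w : RowPerm m) :
    PowerSeries.map ((MvPolynomial.rename (toPerm w) :
      MvPolynomial (Var m) R →ₐ[R] MvPolynomial (Var m) R) : _ →+* _) (gSer m c s k) =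
        gSer m c s k := by
  simp only [gSer, map_prod, map_serAt, MvPolynomial.rename_X]
  exact Equiv.prod_comp (toPerm w) fun v =>
    serAt (c (rowDist s k v.1)) (MvPolynomial.X v : MvPolynomial (Var m) R)

theorem constantCoeff_gSer {q t : R} {c : ZMod e → ℕ → R} (hc : IsQSolution q t c) (s : ℤˣ)
    (k : ZMod e) : PowerSeries.constantCoeff (gSer m c s k) = 1 := by
  rw [gSer, map_prod]
  refine Finset.prod_eq_one fun v _ => ?_
  rw [← PowerSeries.coeff_zero_eq_constantCoeff_apply, coeff_serAt, hc.zero, map_one, pow_zero,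
    mul_one]

theorem gSer_mul_prod_linAt {q t : R} {c : ZMod e → ℕ → R} (hc : IsQSolution q t c) (s : ℤˣ)
    (k : ZMod e) (u : R) :
    PowerSeries.rescale (MvPolynomial.C u) (gSer m c s k) *
        ∏ i : Fin (m k), linAt (MvPolynomial.C u * MvPolynomial.X ⟨k, i⟩ :
          MvPolynomial (Var m) R) =
      PowerSeries.rescale (MvPolynomial.C (q * u)) (gSer m c s (shift s k 1)) *
        ∏ i : Fin (m (shift s k 1)),
          linAt (MvPolynomial.C (t * u) * MvPolynomial.X ⟨shift s k 1, i⟩ :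
            MvPolynomial (Var m) R) := by
  have hzero := prod_ite_rowDist_eq s k 0 fun v : Var m =>
    linAt (MvPolynomial.C u * MvPolynomial.X v : MvPolynomial (Var m) R)
  have hone := prod_ite_rowDist_eq s k 1 fun v : Var m =>
    linAt (MvPolynomial.C (t * u) * MvPolynomial.X v : MvPolynomial (Var m) R)
  rw [shift_zero] at hzero
  rw [← hzero, ← hone, gSer, gSer, map_prod, map_prod, ← Finset.prod_mul_distrib,
    ← Finset.prod_mul_distrib]
  refine Finset.prod_congr rfl fun v _ => ?_
  have hv := hc.serAt_mul_linAt (rowDist s k v.1)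
    (MvPolynomial.C u * MvPolynomial.X v : MvPolynomial (Var m) R)
  rw [rescale_serAt, rescale_serAt, rowDist_shift_left, Nat.cast_zero, Nat.cast_one, hv]
  simp only [MvPolynomial.algebraMap_eq, map_mul, mul_assoc]

end GeneratingFunctions

section QAdicLimit

open Filter Topology

variable {e : ℕ} {m : ZMod e → ℕ}

theorem tendsto_q_pow : Tendsto (fun N : ℕ => q ^ N) atTop (𝓝 0) := by
  refine Valued.tendsto_zero_pow_of_v_lt_one ?_
  rw [q, RatFunc.v_def, Polynomial.valuation_X_eq_neg_one, ← WithZero.exp_zero,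
    WithZero.exp_lt_exp]
  exact neg_one_lt_zero

theorem tendsto_mul_of_finite {ι : Type*} [Finite ι] {f : ℕ → F} (hf : Tendsto f atTop (𝓝 0))
    (a : ι → F) (κ : ℕ → ι) : Tendsto (fun N => f N * a (κ N)) atTop (𝓝 0) := by
  have hfixed (i : ι) : Tendsto (fun N => f N * a i) atTop (𝓝 0) := by
    simpa only [zero_mul] using hf.mul_const (a i)
  intro U hU
  have hev : ∀ᶠ N in atTop, ∀ i, f N * a i ∈ U := eventually_all.2 fun i => hfixed i hU
  change ∀ᶠ N in atTop, f N * a (κ N) ∈ U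
  filter_upwards [hev] with N hN using hN (κ N)

theorem tendsto_coeff_mul (φ : PowerSeries (Poly m)) {ψ : ℕ → PowerSeries (Poly m)}
    {ψ' : PowerSeries (Poly m)}
    (hψ : ∀ d (μ : Var m →₀ ℕ), Tendsto (fun N => MvPolynomial.coeff μ (PowerSeries.coeff d (ψ N)))
      atTop (𝓝 (MvPolynomial.coeff μ (PowerSeries.coeff d ψ')))) (d : ℕ) (μ : Var m →₀ ℕ) :
    Tendsto (fun N => MvPolynomial.coeff μ (PowerSeries.coeff d (φ * ψ N))) atTop
      (𝓝 (MvPolynomial.coeff μ (PowerSeries.coeff d (φ * ψ')))) := by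
  simp only [PowerSeries.coeff_mul, MvPolynomial.coeff_sum, MvPolynomial.coeff_mul]
  exact tendsto_finsetSum _ fun i _ => tendsto_finsetSum _ fun x _ => (hψ i.2 x.2).const_mul _

variable [NeZero e]

theorem gSer_eq_gPartial_mul {c : ZMod e → ℕ → F} (hc : IsQSolution q t c) (s : ℤˣ) (k : ZMod e)
    (N : ℕ) :
    gSer m c s k = gPartial s k N *
      PowerSeries.rescale (MvPolynomial.C (q ^ N)) (gSer m c s (shift s k N)) := by
  induction N with
  | zero => simp [gPartial, shift_zero]
  | succ N ih =>
    have hstep := gSer_mul_prod_linAt (m := m) hc s (shift s k N) (q ^ N)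
    rw [shift_shift_one, ← pow_succ'] at hstep
    have hinv : (∏ i : Fin (m (shift s k N)), linAt (MvPolynomial.C (q ^ N) *
          MvPolynomial.X ⟨shift s k N, i⟩ : Poly m)) *
        ∏ i : Fin (m (shift s k N)), PowerSeries.invOfUnit (linAt (MvPolynomial.C (q ^ N) *
          MvPolynomial.X ⟨shift s k N, i⟩ : Poly m)) 1 = 1 := by
      rw [← Finset.prod_mul_distrib]
      exact Finset.prod_eq_one fun i _ => PowerSeries.mul_invOfUnit _ _ (constantCoeff_linAt _)
    have hpartial : gPartial (m := m) s k (N + 1) = gPartial s k N *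
        ((∏ i : Fin (m (shift s k (N + 1))), linAt (MvPolynomial.C (t * q ^ N) *
            MvPolynomial.X ⟨shift s k (N + 1), i⟩ : Poly m)) *
          ∏ i : Fin (m (shift s k N)), PowerSeries.invOfUnit (linAt (MvPolynomial.C (q ^ N) *
            MvPolynomial.X ⟨shift s k N, i⟩ : Poly m)) 1) :=
      Finset.prod_range_succ _ _
    rw [ih, hpartial, mul_assoc (gPartial s k N), mul_right_comm, mul_comm (Finset.prod _ _),
      ← hstep, mul_assoc, hinv, mul_one]

theorem tendsto_coeff_rescale_q_pow {H : ZMod e → PowerSeries (Poly m)}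
    (hH : ∀ k, PowerSeries.constantCoeff (H k) = 1) (κ : ℕ → ZMod e) (d : ℕ) (μ : Var m →₀ ℕ) :
    Tendsto (fun N => MvPolynomial.coeff μ (PowerSeries.coeff d
        (PowerSeries.rescale (MvPolynomial.C (q ^ N)) (H (κ N))))) atTop
      (𝓝 (MvPolynomial.coeff μ (PowerSeries.coeff d 1))) := by
  simp only [PowerSeries.coeff_rescale, ← map_pow, MvPolynomial.coeff_C_mul]
  cases d with
  | zero => simp [hH]
  | succ d =>
    rw [PowerSeries.coeff_one, if_neg d.succ_ne_zero, MvPolynomial.coeff_zero]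
    have hpow := tendsto_q_pow.pow (d + 1)
    rw [zero_pow d.succ_ne_zero] at hpow
    exact tendsto_mul_of_finite hpow
      (fun k => MvPolynomial.coeff μ (PowerSeries.coeff (d + 1) (H k))) κ

theorem tendsto_coeff_gPartial {c : ZMod e → ℕ → F} (hc : IsQSolution q t c) (s : ℤˣ) (k : ZMod e)
    (d : ℕ) (μ : Var m →₀ ℕ) :
    Tendsto (fun N => MvPolynomial.coeff μ (PowerSeries.coeff d (gPartial (m := m) s k N)))
      atTop (𝓝 (MvPolynomial.coeff μ (PowerSeries.coeff d (gSer m c s k)))) := by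
  let H (k : ZMod e) : PowerSeries (Poly m) := PowerSeries.invOfUnit (gSer m c s k) 1
  have hH (k : ZMod e) : PowerSeries.constantCoeff (H k) = 1 := by
    simp [H, PowerSeries.constantCoeff_invOfUnit]
  have hmul (N : ℕ) : gPartial s k N = gSer m c s k *
      PowerSeries.rescale (MvPolynomial.C (q ^ N)) (H (shift s k N)) := by
    rw [gSer_eq_gPartial_mul hc s k N, mul_assoc, ← map_mul,
      PowerSeries.mul_invOfUnit _ _ (constantCoeff_gSer hc s _), map_one, mul_one]
  simp only [hmul]
  conv => rhs; rw [← mul_one (gSer m c s k)]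
  exact tendsto_coeff_mul _ (tendsto_coeff_rescale_q_pow hH _) d μ

theorem coeff_gSer_mem_Xi (c : ZMod e → ℕ → F) (s : ℤˣ) (k : ZMod e) (d : ℕ) :
    PowerSeries.coeff d (gSer m c s k) ∈ Xi m := fun w => by
  have hcoeff := congrArg (PowerSeries.coeff d) (rename_gSer (m := m) c s k w)
  rwa [PowerSeries.coeff_map] at hcoeff

theorem coe_gOne {c : ZMod e → ℕ → F} (hc : IsQSolution q t c) (s : ℤˣ) (k : ZMod e) (d : ℕ) :
    ((gOne s k d : Xi m) : Poly m) = PowerSeries.coeff d (gSer m c s k) := by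
  have hlim := tendsto_coeff_gPartial (m := m) hc s k d
  have hspec : IsGCoeff s k d (gOne (m := m) s k d) :=
    Classical.epsilon_spec ⟨⟨_, coeff_gSer_mem_Xi c s k d⟩, hlim⟩
  ext μ
  exact tendsto_nhds_unique (hspec μ) (hlim μ)

end QAdicLimit

section CauchyDeterminant

variable {S : Type*} [CommRing S]

theorem exists_prod_sub_eq {ι : Type*} (s : Finset ι) (y : ι → S) :
    ∃ C : ℕ → S, ∀ v w : S, ∏ l ∈ s, (w - v * y l) =
      ∑ k ∈ range (#s + 1), v ^ k * w ^ (#s - k) * C k := by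
  classical
  refine ⟨fun k => ∑ τ ∈ powersetCard k s, ∏ l ∈ τ, -y l, fun v w => ?_⟩
  simp only [sub_eq_add_neg, add_comm w, ← mul_neg]
  rw [Finset.prod_add, Finset.sum_powerset]
  refine Finset.sum_congr rfl fun k _ => ?_
  rw [Finset.mul_sum]
  refine Finset.sum_congr rfl fun τ hτ => ?_
  obtain ⟨hsub, hcard⟩ := Finset.mem_powersetCard.1 hτ
  rw [Finset.prod_mul_distrib, Finset.prod_const, Finset.prod_const,
    Finset.card_sdiff_of_subset hsub, hcard]
  ring

theorem exists_projVandermonde_mul {n : ℕ} (y : Fin n → S) :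
    ∃ C : Matrix (Fin n) (Fin n) S, ∀ v w : Fin n → S,
      Matrix.projVandermonde v w * C =
        Matrix.of fun i j => ∏ l ∈ univ.erase j, (w i - v i * y l) := by
  choose C hC using fun j : Fin n => exists_prod_sub_eq (univ.erase j) y
  refine ⟨Matrix.of fun k j => C j k, fun v w => ?_⟩
  ext i j
  have hcard : #(univ.erase j) + 1 = n := by
    rw [Finset.card_erase_add_one (mem_univ j), Finset.card_fin]
  rw [Matrix.of_apply, hC, Matrix.mul_apply, hcard, Finset.sum_range]
  refine Finset.sum_congr rfl fun k _ => ?_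
  rw [Matrix.projVandermonde_apply, Matrix.of_apply, Fin.val_rev]
  congr 3
  omega

theorem prod_prod_erase_sub {n : ℕ} (y : Fin n → S) :
    ∏ j, ∏ l ∈ univ.erase j, (y j - y l) =
      (∏ i, ∏ j ∈ Ioi i, (y i - y j)) * ∏ i, ∏ j ∈ Ioi i, (y j - y i) := by
  have herase (j : Fin n) : univ.erase j = Ioi j ∪ Iio j := by
    ext l
    simp only [mem_erase, mem_univ, and_true, mem_union, mem_Ioi, mem_Iio]
    rw [ne_comm, ne_iff_lt_or_gt]
  have hdisj (j : Fin n) : Disjoint (Ioi j) (Iio j) :=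
    Finset.disjoint_left.2 fun l hl hl' => lt_asymm (mem_Ioi.1 hl) (mem_Iio.1 hl')
  simp only [herase, Finset.prod_union (hdisj _), Finset.prod_mul_distrib]
  congr 1
  exact Finset.prod_comm' (by simp)

theorem of_prod_erase_sub_eq_diagonal {n : ℕ} (y : Fin n → S) :
    (Matrix.of fun i j => ∏ l ∈ univ.erase j, (y i - y l)) =
      Matrix.diagonal fun j => ∏ l ∈ univ.erase j, (y j - y l) := by
  ext i j
  rw [Matrix.of_apply]
  obtain rfl | hij := eq_or_ne i j
  · rw [Matrix.diagonal_apply_eq]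
  · rw [Matrix.diagonal_apply_ne _ hij]
    exact Finset.prod_eq_zero (mem_erase.2 ⟨hij, mem_univ _⟩) (sub_self _)

theorem det_prod_erase_one_sub [IsDomain S] {n : ℕ} (x y : Fin n → S)
    (hy : Function.Injective y) :
    (Matrix.of fun i j => ∏ l ∈ univ.erase j, (1 - x i * y l)).det =
      (∏ i, ∏ j ∈ Ioi i, (x i - x j)) * ∏ i, ∏ j ∈ Ioi i, (y i - y j) := by
  obtain ⟨C, hC⟩ := exists_projVandermonde_mul y
  have hdetC : C.det = ∏ i, ∏ j ∈ Ioi i, (y j - y i) := by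
    have hdiag := congrArg Matrix.det (hC (fun _ => 1) y)
    simp only [one_mul, of_prod_erase_sub_eq_diagonal, Matrix.det_mul, Matrix.det_diagonal,
      Matrix.det_projVandermonde, prod_prod_erase_sub] at hdiag
    refine mul_left_cancel₀ ?_ hdiag
    refine Finset.prod_ne_zero_iff.2 fun i _ => Finset.prod_ne_zero_iff.2 fun j hj => ?_
    exact sub_ne_zero.2 fun hij => (mem_Ioi.1 hj).ne (hy hij)
  rw [← hC x fun _ => 1, Matrix.det_mul, Matrix.det_projVandermonde, hdetC,
    ← Finset.prod_mul_distrib, ← Finset.prod_mul_distrib]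
  refine Finset.prod_congr rfl fun i _ => ?_
  rw [← Finset.prod_mul_distrib, ← Finset.prod_mul_distrib]
  exact Finset.prod_congr rfl fun j _ => by ring

theorem det_cauchy_mul [IsDomain S] {n : ℕ} (x y : Fin n → S) (hy : Function.Injective y)
    (G : Matrix (Fin n) (Fin n) S) (hG : ∀ i j, G i j * (1 - x i * y j) = 1) :
    G.det * ∏ i, ∏ j, (1 - x i * y j) =
      (∏ i, ∏ j ∈ Ioi i, (x i - x j)) * ∏ i, ∏ j ∈ Ioi i, (y i - y j) := by
  rw [← det_prod_erase_one_sub x y hy, mul_comm, ← Matrix.det_mul_column]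
  congr 1
  ext i j
  simp only [Matrix.of_apply]
  rw [← Finset.mul_prod_erase univ _ (mem_univ j), mul_right_comm, mul_comm (1 - _), hG, one_mul]

end CauchyDeterminant

section RowDeterminants

variable {e : ℕ} [NeZero e] {m : ZMod e → ℕ}

theorem sum_sgn_smul_prod {A : Type*} [CommRing A] (f : Var m → Var m → A) :
    ∑ w : RowPerm m, (sgn w : ℤ) • ∏ v, f (toPerm w v) v =
      ∏ k, (Matrix.of fun i j : Fin (m k) => f ⟨k, i⟩ ⟨k, j⟩).det := by
  simp only [Matrix.det_apply', Matrix.of_apply]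
  rw [Finset.prod_univ_sum, Fintype.piFinset_univ]
  refine Finset.sum_congr rfl fun w _ => ?_
  rw [Finset.prod_mul_distrib, zsmul_eq_mul, Fintype.prod_sigma, sgn, Units.coe_prod,
    Int.cast_prod]
  rfl

theorem alternant_delta_eq_prod :
    alternant (delta m) = ∏ k, ∏ i : Fin (m k), ∏ j ∈ Ioi i,
      (MvPolynomial.X ⟨k, i⟩ - MvPolynomial.X ⟨k, j⟩ : Poly m) := by
  have hxpow (w : RowPerm m) : (xpow (actSeq w (delta m)) : Poly m) =
      ∏ v, (MvPolynomial.X (toPerm w v) : Poly m) ^ delta m v := by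
    rw [xpow_eq_prod, ← Equiv.prod_comp (toPerm w)]
    simp only [actSeq_toPerm]
  simp only [alternant_eq_sum, hxpow]
  rw [sum_sgn_smul_prod fun u v => (MvPolynomial.X u : Poly m) ^ delta m v]
  refine Finset.prod_congr rfl fun k _ => ?_
  have hvandermonde := Matrix.det_projVandermonde (fun _ : Fin (m k) => (1 : Poly m))
    fun i => MvPolynomial.X ⟨k, i⟩
  simp only [one_mul] at hvandermonde
  rw [← hvandermonde]
  congr 1
  ext1 i j
  rw [Matrix.projVandermonde_apply, Matrix.of_apply, one_pow, one_mul, Fin.val_rev]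
  congr 1
  simp only [delta]
  omega

end RowDeterminants

section TwoSetsOfVariables

variable {e : ℕ} {m : ZMod e → ℕ}

/-- Polynomials in two sets of variables `x` and `y`. -/
abbrev Poly₂ (m : ZMod e → ℕ) : Type := MvPolynomial (Var m ⊕ Var m) F

/-- The embedding of the polynomials in `x`. -/
def inX : Poly m →ₐ[F] Poly₂ m := MvPolynomial.rename Sum.inl

/-- The embedding of the polynomials in `y`. -/
def inY : Poly m →ₐ[F] Poly₂ m := MvPolynomial.rename Sum.inr

/-- The exchange of `x` and `y`. -/
def swapXY : Poly₂ m →ₐ[F] Poly₂ m := MvPolynomial.rename Sum.swap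

/-- The action of the row permutations on the variables `x`. -/
def actX (w : RowPerm m) : Poly₂ m →ₐ[F] Poly₂ m := MvPolynomial.rename (Sum.map (toPerm w) id)

/-- The substitution `T_{u,J}` in the variables `x`. -/
def opTX (s : ℤˣ) (u : F) (J : Finset (∀ k : ZMod e, Fin (m k))) : Poly₂ m →ₐ[F] Poly₂ m :=
  MvPolynomial.aeval (Sum.elim
    (fun v => MvPolynomial.C (occVal u J v) * MvPolynomial.X (Sum.inl (move s J v)))
    fun v => MvPolynomial.X (Sum.inr v))

/-- The substitution `T_{u,J}` in the variables `y`. -/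
def opTY (s : ℤˣ) (u : F) (J : Finset (∀ k : ZMod e, Fin (m k))) : Poly₂ m →ₐ[F] Poly₂ m :=
  MvPolynomial.aeval (Sum.elim (fun v => MvPolynomial.X (Sum.inl v))
    fun v => MvPolynomial.C (occVal u J v) * MvPolynomial.X (Sum.inr (move s J v)))

/-- The product `x_u y_v`. -/
def xy (u v : Var m) : Poly₂ m := MvPolynomial.X (Sum.inl u) * MvPolynomial.X (Sum.inr v)

theorem swapXY_xy (u v : Var m) : swapXY (xy u v) = xy v u := by
  simp [swapXY, xy, mul_comm]

theorem actX_xy (w : RowPerm m) (u v : Var m) : actX w (xy u v) = xy (toPerm w u) v := by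
  simp [actX, xy]

theorem opTX_xy (s : ℤˣ) (a : F) (J : Finset (∀ k : ZMod e, Fin (m k))) (u v : Var m) :
    opTX s a J (xy u v) = MvPolynomial.C (occVal a J u) * xy (move s J u) v := by
  simp [opTX, xy, mul_assoc]

theorem opTY_xy (s : ℤˣ) (a : F) (J : Finset (∀ k : ZMod e, Fin (m k))) (u v : Var m) :
    opTY s a J (xy u v) = MvPolynomial.C (occVal a J v) * xy u (move s J v) := by
  simp [opTY, xy, mul_left_comm]

theorem swapXY_inX (f : Poly m) : swapXY (inX f) = inY f := by
  rw [swapXY, inX, inY, MvPolynomial.rename_rename]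
  rfl

theorem swapXY_inY (f : Poly m) : swapXY (inY f) = inX f := by
  rw [swapXY, inX, inY, MvPolynomial.rename_rename]
  rfl

theorem opTX_inX (s : ℤˣ) (a : F) (J : Finset (∀ k : ZMod e, Fin (m k))) (f : Poly m) :
    opTX s a J (inX f) = inX (opT s a J f) := by
  suffices (opTX s a J).comp (inX (m := m)) = inX.comp (opT s a J) from DFunLike.congr_fun this f
  refine MvPolynomial.algHom_ext fun v => ?_
  simp only [AlgHom.comp_apply, opT_X, map_mul]
  simp [inX, opTX]

theorem opTX_inY (s : ℤˣ) (a : F) (J : Finset (∀ k : ZMod e, Fin (m k))) (f : Poly m) :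
    opTX s a J (inY f) = inY f := by
  suffices (opTX s a J).comp (inY (m := m)) = inY from DFunLike.congr_fun this f
  exact MvPolynomial.algHom_ext fun v => by simp [inY, opTX]

theorem swapXY_opTX (s : ℤˣ) (a : F) (J : Finset (∀ k : ZMod e, Fin (m k))) (f : Poly₂ m) :
    swapXY (opTX s a J f) = opTY s a J (swapXY f) := by
  suffices swapXY.comp (opTX s a J) = (opTY s a J).comp (swapXY (m := m)) from
    DFunLike.congr_fun this f
  refine MvPolynomial.algHom_ext ?_
  rintro (v | v) <;> simp [swapXY, opTX, opTY]

theorem opTY_inY (s : ℤˣ) (a : F) (J : Finset (∀ k : ZMod e, Fin (m k))) (f : Poly m) :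
    opTY s a J (inY f) = inY (opT s a J f) := by
  rw [← swapXY_inX, ← swapXY_opTX, opTX_inX, swapXY_inX]

theorem opTY_inX (s : ℤˣ) (a : F) (J : Finset (∀ k : ZMod e, Fin (m k))) (f : Poly m) :
    opTY s a J (inX f) = inX f := by
  rw [← swapXY_inY, ← swapXY_opTX, opTX_inY, swapXY_inY]

theorem opTX_actSet_actX {J : Finset (∀ k : ZMod e, Fin (m k))} (hJ : EntrywiseDisjoint J)
    (s : ℤˣ) (a : F) (w : RowPerm m) (f : Poly₂ m) :
    opTX s a (actSet w J) (actX w f) = actX w (opTX s a J f) := by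
  suffices (opTX s a (actSet w J)).comp (actX w) = (actX w).comp (opTX s a J) from
    DFunLike.congr_fun this f
  refine MvPolynomial.algHom_ext ?_
  rintro (v | v)
  · simp [actX, opTX, occVal, occ_actSet, move_actSet hJ]
  · simp [actX, opTX]

theorem opTY_actX (J : Finset (∀ k : ZMod e, Fin (m k))) (s : ℤˣ) (a : F) (w : RowPerm m)
    (f : Poly₂ m) : opTY s a J (actX w f) = actX w (opTY s a J f) := by
  suffices (opTY s a J).comp (actX w) = (actX w).comp (opTY s a J) from DFunLike.congr_fun this f
  refine MvPolynomial.algHom_ext ?_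
  rintro (v | v) <;> simp [actX, opTY]

theorem coeff_inX_mul_inY (a b : Var m →₀ ℕ) (f g : Poly m) :
    MvPolynomial.coeff (Finsupp.sumElim a b) (inX f * inY g) =
      MvPolynomial.coeff a f * MvPolynomial.coeff b g := by
  induction f using MvPolynomial.induction_on' with
  | add p p' hp hp' => simp only [map_add, add_mul, MvPolynomial.coeff_add, hp, hp']
  | monomial a' r =>
    induction g using MvPolynomial.induction_on' with
    | add p p' hp hp' => simp only [map_add, mul_add, MvPolynomial.coeff_add, hp, hp']
    | monomial b' r' =>
      have hsum : Finsupp.sumElim a' b' = Finsupp.sumElim a b ↔ a' = a ∧ b' = b := by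
        simp only [Finsupp.ext_iff, Sum.forall, Finsupp.sumElim_inl, Finsupp.sumElim_inr]
      rw [inX, inY, MvPolynomial.rename_monomial, MvPolynomial.rename_monomial,
        MvPolynomial.monomial_mul, ← Finsupp.sumElim_eq_add]
      simp only [MvPolynomial.coeff_monomial, hsum, ite_zero_mul_ite_zero]

end TwoSetsOfVariables

section Kernel

variable {e : ℕ} {m : ZMod e → ℕ}

/-- The action on power series of an endomorphism of the algebra of coefficients. -/
abbrev mapCoeff (T : Poly₂ m →ₐ[F] Poly₂ m) : PowerSeries (Poly₂ m) →+* PowerSeries (Poly₂ m) :=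
  PowerSeries.map (T : Poly₂ m →+* Poly₂ m)

theorem mapCoeff_congr {T T' U U' : Poly₂ m →ₐ[F] Poly₂ m} (h : ∀ f, T (T' f) = U (U' f))
    (φ : PowerSeries (Poly₂ m)) : mapCoeff T (mapCoeff T' φ) = mapCoeff U (mapCoeff U' φ) := by
  ext1 d
  simp only [PowerSeries.coeff_map, RingHom.coe_coe, h]

theorem rowDist_eq_zero_iff (s : ℤˣ) (k k' : ZMod e) : rowDist s k k' = 0 ↔ k = k' := by
  rw [eq_comm (a := k)]
  simpa only [Nat.cast_zero, shift_zero] using rowDist_eq_iff s k k' 0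

theorem det_serAt_mul_prod_linAt (k : ZMod e) :
    (Matrix.of fun i j : Fin (m k) =>
        serAt (fun _ => (1 : F)) (xy (⟨k, i⟩ : Var m) ⟨k, j⟩)).det *
        ∏ i : Fin (m k), ∏ j : Fin (m k), linAt (xy (⟨k, i⟩ : Var m) ⟨k, j⟩) =
      PowerSeries.X ^ (∑ i : Fin (m k), #(Ioi i)) *
        (PowerSeries.C (∏ i : Fin (m k), ∏ j ∈ Ioi i,
          (MvPolynomial.X (Sum.inl ⟨k, i⟩) - MvPolynomial.X (Sum.inl ⟨k, j⟩))) *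
        PowerSeries.C (∏ i : Fin (m k), ∏ j ∈ Ioi i,
          (MvPolynomial.X (Sum.inr ⟨k, i⟩) - MvPolynomial.X (Sum.inr ⟨k, j⟩)))) := by
  have hlin (i j : Fin (m k)) : linAt (xy (⟨k, i⟩ : Var m) ⟨k, j⟩) =
      1 - (PowerSeries.X * PowerSeries.C (MvPolynomial.X (Sum.inl ⟨k, i⟩))) *
        PowerSeries.C (MvPolynomial.X (Sum.inr ⟨k, j⟩) : Poly₂ m) := by
    rw [linAt, xy, map_mul]
    ring
  have hinj : Function.Injective fun i : Fin (m k) =>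
      PowerSeries.C (MvPolynomial.X (Sum.inr ⟨k, i⟩) : Poly₂ m) := fun i j hij => by
    simpa using MvPolynomial.X_injective (PowerSeries.C_injective hij)
  simp only [hlin]
  rw [det_cauchy_mul _ _ hinj _ fun i j => by rw [← hlin]; exact serAt_one_mul_linAt _]
  simp only [← mul_sub, Finset.prod_mul_distrib, Finset.prod_const, Finset.prod_pow_eq_pow_sum,
    ← map_sub, ← map_prod]
  rw [mul_assoc]

variable [NeZero e]

/-- The Macdonald kernel `∏ c_a(x_u y_v Z)`, where `a` is the distance from the row of `v` to the
row of `u`; the variable `Z` keeps track of the degree. -/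
def kernel (m : ZMod e → ℕ) (c : ZMod e → ℕ → F) (s : ℤˣ) : PowerSeries (Poly₂ m) :=
  ∏ u : Var m, ∏ v : Var m, serAt (c (rowDist s v.1 u.1)) (xy u v)

/-- The inverse `∏ (1 - x_u y_v Z)`, over positions `u` and `v` in the same row, of the Cauchy
kernel. -/
def cauchyInv (m : ZMod e → ℕ) : PowerSeries (Poly₂ m) :=
  ∏ u : Var m, ∏ v : Var m, if v.1 = u.1 then linAt (xy u v) else 1

/-- The product of geometric series `∏ 1 / (1 - x_v y_v Z)`. -/
def diagKernel (m : ZMod e → ℕ) : PowerSeries (Poly₂ m) :=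
  ∏ v : Var m, serAt (fun _ => (1 : F)) (xy v v)

/-- The antisymmetrisation of `diagKernel` in the variables `x`, a product of Cauchy
determinants. -/
def altKernel (m : ZMod e → ℕ) : PowerSeries (Poly₂ m) :=
  ∑ w : RowPerm m, (sgn w : ℤ) • mapCoeff (actX w) (diagKernel m)

theorem cauchyInv_eq_prod_rowDist (s : ℤˣ) : cauchyInv m =
    ∏ u : Var m, ∏ v : Var m, if rowDist s v.1 u.1 = 0 then linAt (xy u v) else 1 := by
  simp only [cauchyInv, rowDist_eq_zero_iff]

/-- The `q`-difference equation of the series `c_a`, multiplied over all pairs of positions. -/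
theorem mapCoeff_opTX_kernel_mul {c : ZMod e → ℕ → F} (hc : IsQSolution q t c)
    {J : Finset (∀ k, Fin (m k))} (hJ : EntrywiseDisjoint J) (s : ℤˣ) :
    mapCoeff (opTX s q J) (kernel m c s) * mapCoeff (opTX s t J) (cauchyInv m) =
      kernel m c s * cauchyInv m := by
  rw [cauchyInv_eq_prod_rowDist s, kernel, ← Finset.prod_mul_distrib]
  conv_rhs => rw [← Equiv.prod_comp (moveEquiv hJ s)]
  rw [map_prod, map_prod, ← Finset.prod_mul_distrib]
  refine Finset.prod_congr rfl fun u _ => ?_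
  rw [map_prod, map_prod, ← Finset.prod_mul_distrib, ← Finset.prod_mul_distrib]
  refine Finset.prod_congr rfl fun v _ => ?_
  rw [map_serAt, opTX_xy, apply_ite (mapCoeff (opTX s t J)), map_one, map_linAt, RingHom.coe_coe,
    opTX_xy]
  change _ = serAt (c (rowDist s v.1 (move s J u).1)) (xy (move s J u) v) *
    if rowDist s v.1 (move s J u).1 = 0 then linAt (xy (move s J u) v) else 1
  by_cases hu : Occ J u
  · have hocc (a : F) : occVal a J u = a := if_pos hu
    have hrow : rowDist s v.1 (move s J u).1 = rowDist s v.1 u.1 + 1 := by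
      obtain ⟨i, hi, hiu⟩ := hu.exists_mem
      rw [hiu, move_of_mem hJ s hi, rowDist_shift_right]
    rw [hc.serAt_mul_linAt (rowDist s v.1 (move s J u).1), hocc, hocc, hrow,
      add_sub_cancel_right]
    simp only [add_eq_right, MvPolynomial.algebraMap_eq]
  · have hocc (a : F) : occVal a J u = 1 := if_neg hu
    rw [move_of_not_occ s hu, hocc, hocc, map_one, one_mul]

theorem mapCoeff_opTX_diagKernel {J : Finset (∀ k, Fin (m k))} (hJ : EntrywiseDisjoint J)
    (s : ℤˣ) (a : F) :
    mapCoeff (opTX s a J) (diagKernel m) = mapCoeff (opTY (-s) a J) (diagKernel m) := by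
  rw [diagKernel, map_prod, map_prod]
  conv_rhs => rw [← Equiv.prod_comp (moveEquiv hJ s)]
  refine Finset.prod_congr rfl fun v _ => ?_
  rw [map_serAt, map_serAt, opTX_xy, opTY_xy]
  simp only [moveEquiv, Equiv.coe_fn_mk]
  rw [move_neg_move hJ, occVal_move hJ]

theorem sum_mapCoeff_opTX_altKernel (r : ℕ) (s : ℤˣ) (a : F) :
    ∑ J ∈ IndexSets m r, mapCoeff (opTX s a J) (altKernel m) =
      ∑ J ∈ IndexSets m r, mapCoeff (opTY (-s) a J) (altKernel m) := by
  simp only [altKernel, map_sum, map_zsmul]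
  rw [Finset.sum_comm]
  conv_rhs => rw [Finset.sum_comm]
  refine Finset.sum_congr rfl fun w _ => ?_
  rw [← sum_indexSets_actSet r w]
  refine Finset.sum_congr rfl fun J hJ => congrArg _ ?_
  have hJ' := entrywiseDisjoint_of_mem hJ
  rw [mapCoeff_congr (opTX_actSet_actX hJ' s a w), mapCoeff_congr (opTY_actX J (-s) a w),
    mapCoeff_opTX_diagKernel hJ']

theorem altKernel_eq_prod_det : altKernel m = ∏ k, (Matrix.of fun i j : Fin (m k) =>
    serAt (fun _ => (1 : F)) (xy (⟨k, i⟩ : Var m) ⟨k, j⟩)).det := by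
  rw [← sum_sgn_smul_prod fun u v : Var m => serAt (fun _ => (1 : F)) (xy u v), altKernel]
  simp only [diagKernel, map_prod, map_serAt, actX_xy]

theorem cauchyInv_eq_prod : cauchyInv m = ∏ k, ∏ i : Fin (m k), ∏ j : Fin (m k),
    linAt (xy (⟨k, i⟩ : Var m) ⟨k, j⟩) := by
  rw [cauchyInv, Fintype.prod_sigma]
  refine Finset.prod_congr rfl fun k _ => Finset.prod_congr rfl fun i _ => ?_
  rw [Fintype.prod_sigma, Fintype.prod_eq_single k]
  · simp only [if_true]
  · exact fun k' hk' => Finset.prod_eq_one fun j _ => if_neg hk'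

theorem sum_delta : ∑ v, delta m v = ∑ k, ∑ i : Fin (m k), #(Ioi i) := by
  simp only [Fintype.sum_sigma, Fin.card_Ioi, delta]

theorem altKernel_mul_cauchyInv : altKernel m * cauchyInv m =
    PowerSeries.X ^ (∑ v, delta m v) *
      PowerSeries.C (inX (alternant (delta m)) * inY (alternant (delta m))) := by
  rw [altKernel_eq_prod_det, cauchyInv_eq_prod, ← Finset.prod_mul_distrib]
  simp only [det_serAt_mul_prod_linAt, Finset.prod_mul_distrib, Finset.prod_pow_eq_pow_sum]
  rw [← sum_delta, ← map_prod, ← map_prod, ← map_mul, alternant_delta_eq_prod]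
  simp [inX, inY]

theorem cauchyInv_ne_zero : cauchyInv m ≠ 0 := by
  have hone : PowerSeries.constantCoeff (cauchyInv m) = 1 := by
    simp only [cauchyInv, map_prod]
    refine Finset.prod_eq_one fun u _ => Finset.prod_eq_one fun v _ => ?_
    split_ifs
    · exact constantCoeff_linAt _
    · exact map_one _
  intro hzero
  rw [hzero, map_zero] at hone
  exact zero_ne_one hone

theorem mapCoeff_swapXY_kernel (c : ZMod e → ℕ → F) (s : ℤˣ) :
    mapCoeff swapXY (kernel m c (-s)) = kernel m c s := by
  simp only [kernel, map_prod, map_serAt, swapXY_xy, rowDist_neg]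
  exact Finset.prod_comm

theorem mapCoeff_swapXY_cauchyInv : mapCoeff swapXY (cauchyInv m) = cauchyInv m := by
  simp only [cauchyInv, map_prod, apply_ite (mapCoeff swapXY), map_one, map_linAt,
    RingHom.coe_coe, swapXY_xy]
  rw [Finset.prod_comm]
  simp only [eq_comm]

theorem mapCoeff_swapXY_altKernel : mapCoeff swapXY (altKernel m) = altKernel m := by
  refine mul_right_cancel₀ (cauchyInv_ne_zero (m := m)) ?_
  conv_lhs => rw [← mapCoeff_swapXY_cauchyInv, ← map_mul, altKernel_mul_cauchyInv]
  rw [altKernel_mul_cauchyInv, map_mul, map_pow, PowerSeries.map_X, PowerSeries.map_C,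
    RingHom.coe_coe, map_mul, swapXY_inX, swapXY_inY, mul_comm (inY _)]

theorem sum_mul_opTX_kernel {c : ZMod e → ℕ → F} (hc : IsQSolution q t c) (s : ℤˣ) (r : ℕ) :
    PowerSeries.X ^ (∑ v, delta m v) * ∑ J ∈ IndexSets m r,
      PowerSeries.C (inX (opT s t J (alternant (delta m))) * inY (alternant (delta m))) *
        mapCoeff (opTX s q J) (kernel m c s) =
      kernel m c s * cauchyInv m *
        ∑ J ∈ IndexSets m r, mapCoeff (opTX s t J) (altKernel m) := by
  rw [Finset.mul_sum, Finset.mul_sum]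
  refine Finset.sum_congr rfl fun J hJ => ?_
  have halt := congrArg (mapCoeff (opTX s t J)) (altKernel_mul_cauchyInv (m := m))
  rw [map_mul, map_mul, map_pow, PowerSeries.map_X, PowerSeries.map_C, RingHom.coe_coe, map_mul,
    opTX_inX, opTX_inY] at halt
  rw [← mul_assoc, ← halt, ← mapCoeff_opTX_kernel_mul hc (entrywiseDisjoint_of_mem hJ)]
  ring

theorem sum_mul_opTY_kernel {c : ZMod e → ℕ → F} (hc : IsQSolution q t c) (s : ℤˣ) (r : ℕ) :
    PowerSeries.X ^ (∑ v, delta m v) * ∑ J ∈ IndexSets m r,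
      PowerSeries.C (inY (opT (-s) t J (alternant (delta m))) * inX (alternant (delta m))) *
        mapCoeff (opTY (-s) q J) (kernel m c s) =
      kernel m c s * cauchyInv m *
        ∑ J ∈ IndexSets m r, mapCoeff (opTY (-s) t J) (altKernel m) := by
  have hswap (a : F) (J : Finset (∀ k, Fin (m k))) :=
    mapCoeff_congr (swapXY_opTX (-s) a J)
  simpa only [map_mul, map_pow, PowerSeries.map_X, map_sum, PowerSeries.map_C, RingHom.coe_coe,
    hswap, mapCoeff_swapXY_kernel, mapCoeff_swapXY_cauchyInv, mapCoeff_swapXY_altKernel,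
    swapXY_inX, swapXY_inY] using
    congrArg (mapCoeff swapXY) (sum_mul_opTX_kernel (m := m) hc (-s) r)

theorem sum_opTX_kernel_eq_sum_opTY_kernel {c : ZMod e → ℕ → F} (hc : IsQSolution q t c)
    (s : ℤˣ) (r : ℕ) (n : ℕ) :
    ∑ J ∈ IndexSets m r,
      inX (opT s t J (alternant (delta m))) * inY (alternant (delta m)) *
        opTX s q J (PowerSeries.coeff n (kernel m c s)) =
    ∑ J ∈ IndexSets m r,
      inY (opT (-s) t J (alternant (delta m))) * inX (alternant (delta m)) *
        opTY (-s) q J (PowerSeries.coeff n (kernel m c s)) := by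
  have hseries := mul_left_cancel₀ (pow_ne_zero _ PowerSeries.X_ne_zero) <|
    (sum_mul_opTX_kernel (m := m) hc s r).trans <|
      (congrArg _ (sum_mapCoeff_opTX_altKernel r s t)).trans (sum_mul_opTY_kernel hc s r).symm
  simpa only [map_sum, PowerSeries.coeff_C_mul, PowerSeries.coeff_map, RingHom.coe_coe] using
    congrArg (PowerSeries.coeff n) hseries

end Kernel

section SymmetricPolynomials

variable {e : ℕ} [NeZero e] {m : ZMod e → ℕ}

theorem mapDomain_expo (w : RowPerm m) (β : Var m → ℕ) :
    (expo β).mapDomain (toPerm w) = expo (actSeq w β) := by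
  ext v
  obtain ⟨v, rfl⟩ := (toPerm w).surjective v
  rw [Finsupp.mapDomain_apply (toPerm w).injective]
  exact (actSeq_toPerm w β v).symm

theorem coeff_actSeq {f : Poly m} (hf : f ∈ Xi m) (w : RowPerm m) (β : Var m → ℕ) :
    MvPolynomial.coeff (expo (actSeq w β)) f = MvPolynomial.coeff (expo β) f := by
  conv_lhs => rw [← hf w]
  rw [← mapDomain_expo, actPoly, MvPolynomial.coeff_rename_mapDomain _ (toPerm w).injective]

theorem degree_expo (β : Var m → ℕ) : (expo β).degree = ∑ v, β v :=
  Finsupp.degree_eq_sum _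

theorem isHomogeneous_xpow (β : Var m → ℕ) : (xpow β).IsHomogeneous (∑ v, β v) :=
  MvPolynomial.isHomogeneous_monomial _ (degree_expo β)

theorem isHomogeneous_monSym {n : ℕ} (α : Zn m n) : (monSym α.1 : Poly m).IsHomogeneous n := by
  rw [coe_monSym]
  refine MvPolynomial.IsHomogeneous.sum _ _ _ fun β hβ => ?_
  have hsum : ∑ v, β v = n := (sum_of_mem_orbit hβ).trans α.2
  exact hsum ▸ isHomogeneous_xpow β

theorem eq_of_coeff_expo_eq {n : ℕ} {f g : Poly m} (hf : f ∈ Xi m) (hg : g ∈ Xi m)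
    (hfn : f.IsHomogeneous n) (hgn : g.IsHomogeneous n)
    (h : ∀ γ : Zn m n,
      MvPolynomial.coeff (expo γ.1.1) f = MvPolynomial.coeff (expo γ.1.1) g) : f = g := by
  ext μ
  obtain ⟨β, rfl⟩ : ∃ β, expo β = μ := Finsupp.equivFunOnFinite.symm.surjective μ
  by_cases hβ : ∑ v, β v = n
  · obtain ⟨w, hw⟩ := exists_rowAntitone_actSeq β
    rw [← coeff_actSeq hf w, ← coeff_actSeq hg w]
    exact h ⟨⟨actSeq w β, hw⟩, (sum_actSeq w β).trans hβ⟩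
  · rw [← degree_expo] at hβ
    rw [hfn.coeff_eq_zero hβ, hgn.coeff_eq_zero hβ]

theorem coeff_monSym_zn {n : ℕ} (α γ : Zn m n) :
    MvPolynomial.coeff (expo γ.1.1) (monSym α.1 : Poly m) = if α = γ then 1 else 0 := by
  simp only [coeff_monSym, Subtype.ext_iff (a1 := α)]

theorem coeff_sum_smul_monSym {n : ℕ} (b : Zn m n → F) (γ : Zn m n) :
    MvPolynomial.coeff (expo γ.1.1) (∑ α : Zn m n, b α • (monSym α.1 : Poly m)) = b γ := by
  simp only [MvPolynomial.coeff_sum, MvPolynomial.coeff_smul, coeff_monSym_zn, smul_eq_mul,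
    mul_ite, mul_one, mul_zero, Finset.sum_ite_eq', mem_univ, if_true]

theorem eq_sum_coeff_smul_monSym {n : ℕ} {f : Poly m} (hf : f ∈ Xi m) (hn : f.IsHomogeneous n) :
    f = ∑ γ : Zn m n, MvPolynomial.coeff (expo γ.1.1) f • (monSym γ.1 : Poly m) := by
  refine eq_of_coeff_expo_eq hf (Subalgebra.sum_mem _ fun γ _ => Subalgebra.smul_mem _ ?_ _) hn
    (MvPolynomial.IsHomogeneous.sum _ _ _ fun γ _ => ?_) fun γ =>
      (coeff_sum_smul_monSym (fun α => MvPolynomial.coeff (expo α.1.1) f) γ).symm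
  · exact (monSym γ.1).2
  · exact (MvPolynomial.homogeneousSubmodule (Var m) F n).smul_mem _ (isHomogeneous_monSym γ)

theorem sum_finsuppAntidiag_eq_sum_orbit {A : Type*} [AddCommMonoid A] (n : ℕ)
    (h : (Var m → ℕ) → A) :
    ∑ l ∈ finsuppAntidiag univ n, h l = ∑ α : Zn m n, ∑ β ∈ orbit α.1.1, h β := by
  rw [Finset.sum_sigma']
  symm
  refine Finset.sum_bij (fun x _ => expo x.2) ?_ ?_ ?_ fun _ _ => rfl
  · rintro ⟨α, β⟩ hx
    rw [mem_sigma] at hx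
    exact mem_finsuppAntidiag.2 ⟨(sum_of_mem_orbit hx.2).trans α.2, subset_univ _⟩
  · rintro ⟨α, β⟩ hx ⟨α', β'⟩ hx' heq
    obtain rfl : β = β' := Finsupp.equivFunOnFinite.symm.injective heq
    obtain ⟨w, hw⟩ : ∃ w, actSeq w α.1.1 = β := mem_orbit.1 (mem_sigma.1 hx).2
    have hα : α.1.1 ∈ orbit α'.1.1 := by
      rw [← actSeq_inv_actSeq w α.1.1, hw]
      exact actSeq_mem_orbit w⁻¹ (mem_sigma.1 hx').2
    rw [Subtype.ext (Subtype.ext (eq_of_mem_orbit_of_rowAntitone hα α.1.2))]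
  · intro l hl
    obtain ⟨w, hw⟩ := exists_rowAntitone_actSeq l
    refine ⟨⟨⟨⟨actSeq w l, hw⟩, (sum_actSeq w l).trans (mem_finsuppAntidiag.1 hl).1⟩, l⟩,
      mem_sigma.2 ⟨mem_univ _, mem_orbit.2 ⟨w⁻¹, actSeq_inv_actSeq w l⟩⟩,
      Finsupp.equivFunOnFinite.symm_apply_apply l⟩

end SymmetricPolynomials

section GFunctions

variable {e : ℕ} [NeZero e] {m : ZMod e → ℕ}

/-- The product `g_β` of coefficients of the series `gSer m c s k`, over an arbitrary coefficient
ring. -/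
def gPoly {R : Type*} [CommRing R] (c : ZMod e → ℕ → R) (s : ℤˣ) (β : Var m → ℕ) :
    MvPolynomial (Var m) R :=
  ∏ v, PowerSeries.coeff (β v) (gSer m c s v.1)

/-- The matrix of the coefficients of the `g_α` with respect to the monomial basis. -/
def gMat (m : ZMod e → ℕ) (n : ℕ) {R : Type*} [CommRing R] (c : ZMod e → ℕ → R) (s : ℤˣ) :
    Matrix (Zn m n) (Zn m n) R :=
  Matrix.of fun α γ => MvPolynomial.coeff (expo γ.1.1) (gPoly c s α.1.1)

theorem map_gMat (n : ℕ) {R R' : Type*} [CommRing R] [CommRing R'] (φ : R →+* R')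
    (c : ZMod e → ℕ → R) (s : ℤˣ) :
    (gMat m n c s).map φ = gMat m n (fun a d => φ (c a d)) s := by
  ext α γ
  simp only [gMat, Matrix.map_apply, Matrix.of_apply, gPoly, ← map_gSer φ, PowerSeries.coeff_map]
  rw [← map_prod, MvPolynomial.coeff_map]

theorem coe_gFun {c : ZMod e → ℕ → F} (hc : IsQSolution q t c) (s : ℤˣ) (α : EPart m) :
    ((gFun s α : Xi m) : Poly m) = gPoly c s α.1 := by
  rw [gPoly, ← Finset.prod_congr rfl fun v _ => coe_gOne hc s v.1 (α.1 v)]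
  exact map_prod (Xi m).val (fun v : Var m => gOne s v.1 (α.1 v)) univ

theorem gPoly_mem_Xi (c : ZMod e → ℕ → F) (s : ℤˣ) (β : Var m → ℕ) : gPoly c s β ∈ Xi m :=
  Subalgebra.prod_mem _ fun v _ => coeff_gSer_mem_Xi c s v.1 (β v)

theorem isHomogeneous_coeff_gSer (c : ZMod e → ℕ → F) (s : ℤˣ) (k : ZMod e) (d : ℕ) :
    (PowerSeries.coeff d (gSer m c s k)).IsHomogeneous d := by
  rw [gSer, PowerSeries.coeff_prod]
  refine MvPolynomial.IsHomogeneous.sum _ _ _ fun l hl => ?_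
  rw [← (mem_finsuppAntidiag.1 hl).1]
  refine MvPolynomial.IsHomogeneous.prod _ _ _ fun u _ => ?_
  rw [coeff_serAt]
  exact MvPolynomial.isHomogeneous_C_mul_X_pow _ u (l u)

theorem isHomogeneous_gPoly (c : ZMod e → ℕ → F) (s : ℤˣ) {n : ℕ} (α : Zn m n) :
    (gPoly c s α.1.1).IsHomogeneous n := by
  have hprod : (gPoly c s α.1.1).IsHomogeneous (∑ v, α.1.1 v) :=
    MvPolynomial.IsHomogeneous.prod _ _ _ fun v _ => isHomogeneous_coeff_gSer c s v.1 _
  rwa [α.2] at hprod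

theorem gPoly_eq_sum (c : ZMod e → ℕ → F) (s : ℤˣ) {n : ℕ} (α : Zn m n) :
    gPoly c s α.1.1 = ∑ γ : Zn m n, gMat m n c s α γ • (monSym γ.1 : Poly m) :=
  eq_sum_coeff_smul_monSym (gPoly_mem_Xi c s _) (isHomogeneous_gPoly c s α)

theorem gPoly_of_mem_orbit (c : ZMod e → ℕ → F) (s : ℤˣ) {α β : Var m → ℕ} (h : β ∈ orbit α) :
    gPoly c s β = gPoly c s α := by
  obtain ⟨w, rfl⟩ := mem_orbit.1 h
  rw [gPoly, ← Equiv.prod_comp (toPerm w)]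
  refine Finset.prod_congr rfl fun v _ => ?_
  rw [actSeq_toPerm]
  rfl

theorem kernel_eq_prod_rescale (c : ZMod e → ℕ → F) (s : ℤˣ) : kernel m c s =
    ∏ v : Var m, PowerSeries.rescale (MvPolynomial.X (Sum.inr v))
      (PowerSeries.map ((inX : Poly m →ₐ[F] Poly₂ m) : Poly m →+* Poly₂ m) (gSer m c s v.1)) := by
  rw [kernel, Finset.prod_comm]
  refine Finset.prod_congr rfl fun v _ => ?_
  rw [gSer, map_prod, map_prod]
  refine Finset.prod_congr rfl fun u _ => ?_
  rw [map_serAt, rescale_serAt, xy, mul_comm, inX, MvPolynomial.rename_X]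

theorem coeff_kernel_eq_sum_gPoly (c : ZMod e → ℕ → F) (s : ℤˣ) (n : ℕ) :
    PowerSeries.coeff n (kernel m c s) =
      ∑ α : Zn m n, inX (gPoly c s α.1.1) * inY (monSym α.1 : Poly m) := by
  have hterm (l : Var m → ℕ) : ∏ v, PowerSeries.coeff (l v)
      (PowerSeries.rescale (MvPolynomial.X (Sum.inr v)) (PowerSeries.map
        ((inX : Poly m →ₐ[F] Poly₂ m) : Poly m →+* Poly₂ m) (gSer m c s v.1))) =
      inX (gPoly c s l) * inY (xpow l) := by
    rw [gPoly, xpow_eq_prod, map_prod, map_prod, ← Finset.prod_mul_distrib]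
    refine Finset.prod_congr rfl fun v _ => ?_
    rw [PowerSeries.coeff_rescale, PowerSeries.coeff_map, mul_comm, map_pow, inY,
      MvPolynomial.rename_X, RingHom.coe_coe]
  rw [kernel_eq_prod_rescale, PowerSeries.coeff_prod]
  simp only [hterm]
  rw [sum_finsuppAntidiag_eq_sum_orbit n fun l => inX (gPoly c s l) * inY (xpow l)]
  refine Finset.sum_congr rfl fun α _ => ?_
  rw [coe_monSym, map_sum, Finset.mul_sum]
  exact Finset.sum_congr rfl fun β hβ => by rw [gPoly_of_mem_orbit c s hβ]

theorem coeff_kernel (c : ZMod e → ℕ → F) (s : ℤˣ) (n : ℕ) :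
    PowerSeries.coeff n (kernel m c s) = ∑ α : Zn m n, ∑ β : Zn m n,
      gMat m n c s α β • (inX (monSym β.1 : Poly m) * inY (monSym α.1 : Poly m)) := by
  rw [coeff_kernel_eq_sum_gPoly]
  refine Finset.sum_congr rfl fun α _ => ?_
  rw [gPoly_eq_sum, map_sum, Finset.sum_mul]
  simp only [map_smul, smul_mul_assoc]

theorem coeff_sum_inX_mul_inY {n : ℕ} (M : Matrix (Zn m n) (Zn m n) F) (α β : Zn m n) :
    MvPolynomial.coeff (Finsupp.sumElim (expo β.1.1) (expo α.1.1))
      (∑ α' : Zn m n, ∑ β' : Zn m n,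
        M α' β' • (inX (monSym β'.1 : Poly m) * inY (monSym α'.1 : Poly m))) = M α β := by
  simp only [MvPolynomial.coeff_sum, MvPolynomial.coeff_smul, coeff_inX_mul_inY, coeff_monSym_zn,
    smul_eq_mul, mul_ite, mul_one, mul_zero]
  rw [Fintype.sum_eq_single α fun α' hα' => by simp only [if_neg hα', Finset.sum_const_zero]]
  simp only [if_true, Finset.sum_ite_eq', mem_univ]

theorem matrix_eq_of_sum_inX_mul_inY_eq {n : ℕ} {M M' : Matrix (Zn m n) (Zn m n) F}
    (h : ∑ α : Zn m n, ∑ β : Zn m n,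
        M α β • (inX (monSym β.1 : Poly m) * inY (monSym α.1 : Poly m)) =
      ∑ α : Zn m n, ∑ β : Zn m n,
        M' α β • (inX (monSym β.1 : Poly m) * inY (monSym α.1 : Poly m))) : M = M' := by
  ext α β
  rw [← coeff_sum_inX_mul_inY M, h, coeff_sum_inX_mul_inY]

theorem gMat_transpose (c : ZMod e → ℕ → F) (s : ℤˣ) (n : ℕ) :
    (gMat m n c (-s)).transpose = gMat m n c s := by
  apply matrix_eq_of_sum_inX_mul_inY_eq
  rw [← coeff_kernel, ← mapCoeff_swapXY_kernel, PowerSeries.coeff_map, RingHom.coe_coe,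
    coeff_kernel, map_sum, Finset.sum_comm]
  simp only [map_sum, map_smul, map_mul, swapXY_inX, swapXY_inY, Matrix.transpose_apply,
    mul_comm (inX _)]

end GFunctions

section CauchyKernel

variable {e : ℕ} {m : ZMod e → ℕ}

/-- The solution of the `q`-difference equation for `q = t = 0`; its kernel is the Cauchy kernel. -/
def solZero : ZMod e → ℕ → F := fun a d => if a = 0 ∨ d = 0 then 1 else 0

theorem serAt_solZero_zero {A : Type*} [CommRing A] [Algebra F A] (z : A) :
    serAt (solZero (0 : ZMod e)) z = serAt (fun _ => (1 : F)) z :=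
  congrArg (serAt · z) (funext fun _ => if_pos (Or.inl rfl))

theorem serAt_solZero_of_ne_zero {A : Type*} [CommRing A] [Algebra F A] {a : ZMod e}
    (ha : a ≠ 0) (z : A) : serAt (solZero a) z = 1 := by
  ext d
  rw [coeff_serAt, PowerSeries.coeff_one]
  by_cases hd : d = 0 <;> simp [solZero, ha, hd]

theorem actX_inX (w : RowPerm m) (f : Poly m) : actX w (inX f) = inX (actPoly w f) := by
  rw [actX, inX, actPoly, MvPolynomial.rename_rename, MvPolynomial.rename_rename]
  rfl

theorem actX_inY (w : RowPerm m) (f : Poly m) : actX w (inY f) = inY f := by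
  rw [actX, inY, MvPolynomial.rename_rename]
  rfl

variable [NeZero e]

theorem kernel_solZero_mul_cauchyInv : kernel m solZero 1 * cauchyInv m = 1 := by
  rw [cauchyInv_eq_prod_rowDist 1, kernel, ← Finset.prod_mul_distrib]
  refine Finset.prod_eq_one fun u _ => ?_
  rw [← Finset.prod_mul_distrib]
  refine Finset.prod_eq_one fun v _ => ?_
  split_ifs with hdist
  · rw [hdist, serAt_solZero_zero, serAt_one_mul_linAt]
  · rw [serAt_solZero_of_ne_zero hdist, mul_one]

theorem altKernel_eq_mul_kernel_solZero : altKernel m = PowerSeries.X ^ (∑ v, delta m v) *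
    (PowerSeries.C (inX (alternant (delta m)) * inY (alternant (delta m))) *
      kernel m solZero 1) := by
  linear_combination kernel m solZero 1 * altKernel_mul_cauchyInv (m := m) -
    altKernel m * kernel_solZero_mul_cauchyInv (m := m)

/-- The matrix of `monToSchur` over a ring. -/
def schurMat (m : ZMod e → ℕ) (n : ℕ) (R : Type*) [CommRing R] : Matrix (Zn m n) (Zn m n) R :=
  Matrix.of fun α β => (monToSchur α β : R)

theorem coeff_alternant_symbol {n : ℕ} (β κ : Zn m n) :
    MvPolynomial.coeff (expo (symbol κ.1)) (alternant (symbol β.1)) =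
      if β = κ then (1 : F) else 0 := by
  rw [coeff_alternant, altCoeff_symbol]
  push_cast
  simp only [Subtype.ext_iff (a1 := β)]

theorem coeff_alternant_delta_mul_monSym {n : ℕ} (α κ : Zn m n) :
    MvPolynomial.coeff (expo (symbol κ.1)) (alternant (delta m) * (monSym α.1 : Poly m)) =
      schurMat m n F α κ := by
  simp only [alternant_delta_mul_monSym, MvPolynomial.coeff_sum, MvPolynomial.coeff_smul,
    coeff_alternant_symbol, smul_eq_mul, mul_ite, mul_one, mul_zero, Finset.sum_ite_eq', mem_univ,
    if_true, schurMat, Matrix.of_apply]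

theorem coeff_diagKernel (n : ℕ) : PowerSeries.coeff n (diagKernel m) =
    ∑ l ∈ finsuppAntidiag univ n, inX (xpow l) * inY (xpow l) := by
  rw [diagKernel, PowerSeries.coeff_prod]
  refine Finset.sum_congr rfl fun l _ => ?_
  rw [xpow_eq_prod, map_prod, map_prod, ← Finset.prod_mul_distrib]
  refine Finset.prod_congr rfl fun v _ => ?_
  simp [coeff_serAt, xy, inX, inY, mul_pow]

theorem coeff_altKernel (n : ℕ) : PowerSeries.coeff n (altKernel m) =
    ∑ l ∈ finsuppAntidiag univ n, inX (alternant l) * inY (xpow l) := by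
  simp only [altKernel, map_sum, map_zsmul, PowerSeries.coeff_map, RingHom.coe_coe,
    coeff_diagKernel, map_mul, actX_inX, actX_inY, alternant, Finset.sum_mul, Finset.smul_sum,
    smul_mul_assoc]
  exact Finset.sum_comm

theorem coeff_coeff_altKernel {n : ℕ} (κ κ' : Zn m n) :
    MvPolynomial.coeff (Finsupp.sumElim (expo (symbol κ.1)) (expo (symbol κ'.1)))
      (PowerSeries.coeff (n + ∑ v, delta m v) (altKernel m)) = if κ' = κ then 1 else 0 := by
  have hmem : expo (symbol κ'.1) ∈ finsuppAntidiag univ (n + ∑ v, delta m v) :=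
    mem_finsuppAntidiag.2 ⟨(sum_symbol κ'.1).trans (congrArg (· + _) κ'.2), subset_univ _⟩
  have hxpow (l : Var m →₀ ℕ) : MvPolynomial.coeff (expo (symbol κ'.1)) (xpow l) =
      if l = expo (symbol κ'.1) then 1 else 0 := by
    rw [coeff_xpow]
    exact if_congr (Equiv.eq_symm_apply Finsupp.equivFunOnFinite).symm rfl rfl
  simp only [coeff_altKernel, MvPolynomial.coeff_sum, coeff_inX_mul_inY, hxpow, mul_ite, mul_one,
    mul_zero, Finset.sum_ite_eq', if_pos hmem]
  exact coeff_alternant_symbol κ' κ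

theorem coeff_alternant_delta_mul_sum {n : ℕ} (M : Matrix (Zn m n) (Zn m n) F) (κ κ' : Zn m n) :
    MvPolynomial.coeff (Finsupp.sumElim (expo (symbol κ.1)) (expo (symbol κ'.1)))
      (inX (alternant (delta m)) * inY (alternant (delta m)) * ∑ α : Zn m n, ∑ β : Zn m n,
        M α β • (inX (monSym β.1 : Poly m) * inY (monSym α.1 : Poly m))) =
      ((schurMat m n F).transpose * M * schurMat m n F) κ' κ := by
  rw [Matrix.mul_assoc]
  simp only [Finset.mul_sum, MvPolynomial.coeff_sum, mul_smul_comm, MvPolynomial.coeff_smul,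
    mul_mul_mul_comm (inX _), ← map_mul, coeff_inX_mul_inY, coeff_alternant_delta_mul_monSym,
    smul_eq_mul, Matrix.mul_apply, Matrix.transpose_apply]
  exact Finset.sum_congr rfl fun α _ => Finset.sum_congr rfl fun β _ => by ring

theorem schurMat_gram_solZero (n : ℕ) :
    (schurMat m n F).transpose * gMat m n solZero 1 * schurMat m n F = 1 := by
  ext κ' κ
  rw [← coeff_alternant_delta_mul_sum, ← coeff_kernel, ← PowerSeries.coeff_C_mul,
    ← PowerSeries.coeff_X_pow_mul _ _ n, ← altKernel_eq_mul_kernel_solZero,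
    coeff_coeff_altKernel, Matrix.one_apply]

end CauchyKernel

section Conjugation

theorem ratMap_algebraMap {K L : Type} [Field K] [Field L] (φ : K →+* L) (p : Polynomial K) :
    ratMap φ (algebraMap _ _ p) = algebraMap _ _ (p.map φ) := by
  have hdiv := RatFunc.map_apply_div (φ := Polynomial.mapRingHom φ)
    (hφ := nonZeroDivisors_le_comap_nonZeroDivisors_of_injective _
      (Polynomial.map_injective φ φ.injective)) p 1
  simp only [map_one, div_one] at hdiv
  exact hdiv

theorem ratMap_X {K L : Type} [Field K] [Field L] (φ : K →+* L) :
    ratMap φ RatFunc.X = RatFunc.X := by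
  rw [← RatFunc.algebraMap_X, ratMap_algebraMap, Polynomial.map_X, RatFunc.algebraMap_X]

theorem ratMap_C {K L : Type} [Field K] [Field L] (φ : K →+* L) (a : K) :
    ratMap φ (RatFunc.C a) = RatFunc.C (φ a) := by
  rw [← RatFunc.algebraMap_C, ratMap_algebraMap, Polynomial.map_C, RatFunc.algebraMap_C]

theorem ratMap_involutive {K : Type} [Field K] {φ : K →+* K} (hφ : Function.Involutive φ) :
    Function.Involutive (ratMap φ) := by
  have hcomp : φ.comp φ = RingHom.id K := RingHom.ext hφ
  intro f
  induction f using RatFunc.induction_on with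
  | f p q _ =>
    simp only [map_div₀, ratMap_algebraMap, Polynomial.map_map, hcomp, Polynomial.map_id]

theorem conjF_conjF (f : F) : conjF (conjF f) = f :=
  ratMap_involutive (ratMap_involutive Complex.conj_conj) f

theorem conjF_q : conjF q = q := ratMap_X _

theorem conjF_t : conjF t = t := by
  rw [conjF, t, ratMap_C, ratMap_X]

end Conjugation

section GroundField

variable (e : ℕ) [NeZero e]

theorem isUnit_one_sub_q_pow (d : ℕ) : IsUnit (1 - q ^ ((d + 1) * e)) := by
  suffices hne : q ^ ((d + 1) * e) ≠ 1 from
    IsUnit.mk0 (G₀ := F) _ (sub_ne_zero.2 hne.symm)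
  intro hone
  have hpoly : (Polynomial.X : Polynomial (RatFunc ℂ)) ^ ((d + 1) * e) = 1 :=
    RatFunc.algebraMap_injective _ (by rwa [map_pow, RatFunc.algebraMap_X, map_one])
  have hdeg := congrArg Polynomial.natDegree hpoly
  rw [Polynomial.natDegree_X_pow, Polynomial.natDegree_one] at hdeg
  exact mul_ne_zero d.succ_ne_zero (NeZero.ne e) hdeg

/-- The solution of the `q`-difference equation over `F`: the coefficients of the series whose
products are the generating series of the `g_d`. -/
def gCoeff : ZMod e → ℕ → F := (exists_isQSolution t (isUnit_one_sub_q_pow e)).choose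

theorem isQSolution_gCoeff : IsQSolution q t (gCoeff e) :=
  (exists_isQSolution t (isUnit_one_sub_q_pow e)).choose_spec

variable {e}

theorem IsQSolution.eq_gCoeff {c : ZMod e → ℕ → F} (hc : IsQSolution q t c) : c = gCoeff e :=
  hc.unique (isUnit_one_sub_q_pow e) (isQSolution_gCoeff e)

theorem gMat_map_conjF {m : ZMod e → ℕ} (n : ℕ) (s : ℤˣ) :
    (gMat m n (gCoeff e) s).map conjF = gMat m n (gCoeff e) s := by
  have hconj := (isQSolution_gCoeff e).map conjF
  rw [conjF_q, conjF_t] at hconj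
  rw [map_gMat, hconj.eq_gCoeff]

end GroundField

section Specialization

theorem exists_localization_at_ker {R₀ : Type} {K L : Type*} [CommRing R₀] [Field K] [Field L]
    {ι₀ : R₀ →+* K} (hι₀ : Function.Injective ι₀) (ε₀ : R₀ →+* L) :
    ∃ (R : Type) (_ : CommRing R) (φ : R₀ →+* R) (ι : R →+* K) (ε : R →+* L),
      Function.Injective ι ∧ IsLocalHom ε ∧ ι.comp φ = ι₀ ∧ ε.comp φ = ε₀ := by
  let P : Ideal R₀ := RingHom.ker ε₀
  have : P.IsPrime := RingHom.ker_isPrime ε₀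
  have hι (y : P.primeCompl) : IsUnit (ι₀ y) :=
    IsUnit.mk0 _ fun hy => y.2 (by
      rw [(map_eq_zero_iff ι₀ hι₀).1 hy]
      exact P.zero_mem)
  have hε (y : P.primeCompl) : IsUnit (ε₀ y) := IsUnit.mk0 _ y.2
  refine ⟨Localization P.primeCompl, inferInstance, algebraMap R₀ _, IsLocalization.lift hι,
    IsLocalization.lift hε, ?_, ⟨fun x hx => ?_⟩, IsLocalization.lift_comp hι,
    IsLocalization.lift_comp hε⟩
  · refine (IsLocalization.lift_injective_iff hι).2 fun x y => ⟨fun hxy => ?_, fun hxy => ?_⟩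
    · have hlift := congrArg (IsLocalization.lift hι) hxy
      rwa [IsLocalization.lift_eq, IsLocalization.lift_eq] at hlift
    · rw [hι₀ hxy]
  · obtain ⟨a, y, rfl⟩ := IsLocalization.exists_mk'_eq P.primeCompl x
    refine (IsLocalization.AtPrime.isUnit_mk'_iff (Localization P.primeCompl) P a y).2 fun ha =>
      hx.ne_zero ?_
    rw [IsLocalization.lift_mk', RingHom.mem_ker.1 ha, zero_mul]

theorem exists_specialization : ∃ (R : Type) (_ : CommRing R) (ι ε : R →+* F) (q' t' : R),
    Function.Injective ι ∧ IsLocalHom ε ∧ ι q' = q ∧ ι t' = t ∧ ε q' = 0 ∧ ε t' = 0 := by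
  let ι₀ : Polynomial (Polynomial ℂ) →+* F := (algebraMap (Polynomial (RatFunc ℂ)) F).comp
    (Polynomial.mapRingHom (algebraMap (Polynomial ℂ) (RatFunc ℂ)))
  have hι₀ : Function.Injective ι₀ := (RatFunc.algebraMap_injective (RatFunc ℂ)).comp
    (Polynomial.map_injective _ (RatFunc.algebraMap_injective ℂ))
  let ε₀ : Polynomial (Polynomial ℂ) →+* F :=
    (algebraMap ℂ F).comp (Polynomial.constantCoeff.comp Polynomial.constantCoeff)
  obtain ⟨R, _, φ, ι, ε, hι, hε, hιφ, hεφ⟩ := exists_localization_at_ker hι₀ ε₀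
  refine ⟨R, inferInstance, ι, ε, φ Polynomial.X, φ (Polynomial.C Polynomial.X), hι, hε, ?_, ?_,
    ?_, ?_⟩
  · rw [← RingHom.comp_apply, hιφ]
    simp [ι₀, q]
  · rw [← RingHom.comp_apply, hιφ]
    simp [ι₀, t]
  · rw [← RingHom.comp_apply, hεφ]
    simp [ε₀]
  · rw [← RingHom.comp_apply, hεφ]
    simp [ε₀]

theorem isUnit_det_of_map_eq_one {R K n : Type*} [CommRing R] [CommRing K] [Fintype n]
    [DecidableEq n] (ε : R →+* K) [IsLocalHom ε] {H : Matrix n n R} (hH : H.map ε = 1) :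
    IsUnit H.det := by
  refine isUnit_of_map_unit ε _ ?_
  rw [RingHom.map_det, RingHom.mapMatrix_apply, hH, Matrix.det_one]
  exact isUnit_one

theorem map_inv_of_isUnit_det {R K n : Type*} [CommRing R] [CommRing K] [Fintype n]
    [DecidableEq n] (φ : R →+* K) {H : Matrix n n R} (hH : IsUnit H.det) :
    H⁻¹.map φ = (H.map φ)⁻¹ := by
  refine (Matrix.inv_eq_left_inv ?_).symm
  rw [← Matrix.map_mul, Matrix.nonsing_inv_mul _ hH, Matrix.map_one _ (map_zero φ) (map_one φ)]

theorem det_submatrix_inv_map_ne_zero {R K L n κ : Type*} [CommRing R] [CommRing K] [CommRing L]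
    [Nontrivial L] [Fintype n] [DecidableEq n] [Fintype κ] [DecidableEq κ] {ι : R →+* K}
    (hι : Function.Injective ι) (ε : R →+* L) [IsLocalHom ε] {H : Matrix n n R}
    (hH : H.map ε = 1) {f : κ → n} (hf : Function.Injective f) :
    ((H.map ι)⁻¹.submatrix f f).det ≠ 0 := by
  have hdet := isUnit_det_of_map_eq_one ε hH
  rw [← map_inv_of_isUnit_det ι hdet, Matrix.submatrix_map, ← RingHom.mapMatrix_apply,
    ← RingHom.map_det, Ne, map_eq_zero_iff ι hι]
  intro hzero
  have hone : ε (H⁻¹.submatrix f f).det = 1 := by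
    rw [RingHom.map_det, RingHom.mapMatrix_apply, ← Matrix.submatrix_map,
      map_inv_of_isUnit_det ε hdet, hH, inv_one, Matrix.submatrix_one _ hf, Matrix.det_one]
  rw [hzero, map_zero] at hone
  exact zero_ne_one hone

variable {e : ℕ} [NeZero e] {m : ZMod e → ℕ}

theorem map_schurMat {R R' : Type*} [CommRing R] [CommRing R'] (n : ℕ) (φ : R →+* R') :
    (schurMat m n R).map φ = schurMat m n R' := by
  ext α β
  exact map_intCast φ _

/-- The matrix `Sᵀ G S` with `S` the matrix of the monomial symmetric polynomials on the Schur
basis and `G` that of the `g_α` on the monomial basis; it is the inverse of the Gram matrix of the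
Schur polynomials. -/
def schurGramInv {R : Type*} [CommRing R] (m : ZMod e → ℕ) (n : ℕ) (c : ZMod e → ℕ → R) :
    Matrix (Zn m n) (Zn m n) R :=
  (schurMat m n R).transpose * gMat m n c 1 * schurMat m n R

theorem map_schurGramInv {R R' : Type*} [CommRing R] [CommRing R'] (n : ℕ) (φ : R →+* R')
    (c : ZMod e → ℕ → R) :
    (schurGramInv m n c).map φ = schurGramInv m n fun a d => φ (c a d) := by
  rw [schurGramInv, Matrix.map_mul, Matrix.map_mul, Matrix.transpose_map, map_schurMat, map_gMat,
    schurGramInv]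

theorem exists_specialization_schurGramInv (m : ZMod e → ℕ) (n : ℕ) :
    ∃ (R : Type) (_ : CommRing R) (ι ε : R →+* F) (H : Matrix (Zn m n) (Zn m n) R),
      Function.Injective ι ∧ IsLocalHom ε ∧ H.map ι = schurGramInv m n (gCoeff e) ∧
        H.map ε = 1 := by
  obtain ⟨R, _, ι, ε, q', t', hι, hε, hq, ht, hq0, ht0⟩ := exists_specialization
  have hpow (d : ℕ) : 1 - (0 : F) ^ ((d + 1) * e) = 1 := by
    rw [zero_pow (mul_ne_zero d.succ_ne_zero (NeZero.ne e)), sub_zero]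
  obtain ⟨c, hc⟩ := exists_isQSolution (e := e) (q := q') t' fun d =>
    isUnit_of_map_unit ε _ (by
      rw [map_sub, map_one, map_pow, hq0, hpow]
      exact isUnit_one)
  have hcι := hc.map ι
  have hcε := hc.map ε
  rw [hq, ht] at hcι
  rw [hq0, ht0] at hcε
  refine ⟨R, inferInstance, ι, ε, schurGramInv m n c, hι, hε, ?_, ?_⟩
  · rw [map_schurGramInv, hcι.eq_gCoeff]
  · rw [map_schurGramInv, hcε.unique (fun d => (hpow d).symm ▸ isUnit_one) isQSolution_zero_zero]
    exact schurMat_gram_solZero n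

theorem isUnit_det_schurGramInv (n : ℕ) : IsUnit (schurGramInv m n (gCoeff e)).det := by
  obtain ⟨R, _, ι, ε, H, -, hε, hHι, hHε⟩ := exists_specialization_schurGramInv m n
  rw [← hHι, ← RingHom.mapMatrix_apply, ← RingHom.map_det]
  exact (isUnit_det_of_map_eq_one ε hHε).map ι

theorem isUnit_det_gMat (n : ℕ) : IsUnit (gMat m n (gCoeff e) 1).det := by
  have hdet := isUnit_det_schurGramInv (m := m) n
  rw [schurGramInv, Matrix.det_mul, Matrix.det_mul] at hdet
  exact isUnit_of_mul_isUnit_right (isUnit_of_mul_isUnit_left hdet)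

theorem det_submatrix_schurGramInv_inv_ne_zero (n : ℕ) {κ : Type*} [Fintype κ] [DecidableEq κ]
    {f : κ → Zn m n} (hf : Function.Injective f) :
    ((schurGramInv m n (gCoeff e))⁻¹.submatrix f f).det ≠ 0 := by
  obtain ⟨R, _, ι, ε, H, hι, hε, hHι, hHε⟩ := exists_specialization_schurGramInv m n
  exact hHι ▸ det_submatrix_inv_map_ne_zero hι ε hHε hf

end Specialization

section SchurPolynomials

theorem sum_mul_apply_smul {ι R M : Type*} [Fintype ι] [Semiring R] [AddCommMonoid M] [Module R M]
    (A B : Matrix ι ι R) (v : ι → M) (α : ι) :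
    ∑ β, (A * B) α β • v β = ∑ γ, A α γ • ∑ β, B γ β • v β := by
  simp only [Matrix.mul_apply, Finset.sum_smul, Finset.smul_sum, mul_smul]
  exact Finset.sum_comm

theorem sum_one_apply_smul {ι R M : Type*} [Fintype ι] [DecidableEq ι] [Semiring R]
    [AddCommMonoid M] [Module R M] (v : ι → M) (α : ι) :
    ∑ β, (1 : Matrix ι ι R) α β • v β = v α := by
  simp only [Matrix.one_apply, ite_smul, one_smul, zero_smul, Finset.sum_ite_eq, mem_univ, if_true]

variable {e : ℕ} {m : ZMod e → ℕ}

theorem toRat_injective : Function.Injective (toRat : Xi m → RatFn m) :=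
  (IsFractionRing.injective (Poly m) (RatFn m)).comp Subtype.val_injective

theorem coe_sum_smul {ι : Type*} (s : Finset ι) (c : ι → F) (f : ι → Xi m) :
    ((∑ i ∈ s, c i • f i : Xi m) : Poly m) = ∑ i ∈ s, c i • (f i : Poly m) :=
  map_sum (Xi m).val (fun i => c i • f i) s

theorem toRat_sum_smul {ι : Type*} (s : Finset ι) (c : ι → F) (f : ι → Xi m) :
    toRat (∑ i ∈ s, c i • f i) = ∑ i ∈ s, c i • toRat (f i) := by
  rw [toRat, coe_sum_smul, map_sum]
  exact Finset.sum_congr rfl fun i _ => map_smul (IsScalarTower.toAlgHom F (Poly m) (RatFn m)) _ _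

variable [NeZero e]

/-- The matrix expressing the Schur polynomials in terms of the monomial symmetric polynomials. -/
def schurToMon (m : ZMod e → ℕ) (n : ℕ) : Matrix (Zn m n) (Zn m n) F :=
  (schurMat m n F).transpose * gMat m n solZero 1

theorem schurToMon_mul_schurMat (n : ℕ) : schurToMon m n * schurMat m n F = 1 :=
  schurMat_gram_solZero n

theorem schurMat_mul_schurToMon (n : ℕ) : schurMat m n F * schurToMon m n = 1 :=
  mul_eq_one_comm.1 (schurToMon_mul_schurMat n)

theorem schurToMon_map_conjF (n : ℕ) : (schurToMon m n).map conjF = schurToMon m n := by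
  have hsol : (fun a d => conjF (solZero a d)) = (solZero : ZMod e → ℕ → F) := by
    funext a d
    simp only [solZero, apply_ite conjF, map_one, map_zero]
  rw [schurToMon, Matrix.map_mul, Matrix.transpose_map, map_schurMat, map_gMat, hsol]

theorem schurMat_eq {n : ℕ} {prec : Zn m n → Zn m n → Prop} (h : IsAdmissible prec)
    {α β : Zn m n} (hle : familyRank prec α ≤ familyRank prec β) :
    schurMat m n F α β = if α = β then 1 else 0 := by
  rw [schurMat, Matrix.of_apply, monToSchur_eq h hle]
  split_ifs
  · exact Int.cast_one
  · exact Int.cast_zero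

theorem schurToMon_eq {n : ℕ} {prec : Zn m n → Zn m n → Prop} (h : IsAdmissible prec)
    {α β : Zn m n} (hle : familyRank prec α ≤ familyRank prec β) :
    schurToMon m n α β = if α = β then 1 else 0 := by
  induction hr : familyRank prec α using Nat.strong_induction_on generalizing α with
  | _ r ih =>
    have hinv : ∑ γ, schurMat m n F α γ * schurToMon m n γ β = if α = β then 1 else 0 := by
      rw [← Matrix.mul_apply, schurMat_mul_schurToMon, Matrix.one_apply]
    rw [← hinv, Fintype.sum_eq_single α, schurMat_eq h le_rfl, if_pos rfl, one_mul]
    intro γ hne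
    rcases lt_or_ge (familyRank prec γ) (familyRank prec α) with hγ | hγ
    · rw [ih _ (hr ▸ hγ) (hγ.le.trans hle) rfl, if_neg, mul_zero]
      rintro rfl
      exact hle.not_gt hγ
    · rw [schurMat_eq h hγ, if_neg hne.symm, zero_mul]

/-- The Schur polynomial `s_α`. -/
def schurXi {n : ℕ} (α : Zn m n) : Xi m := ∑ β, schurToMon m n α β • monSym β.1

theorem monSym_eq_sum_schurXi {n : ℕ} (α : Zn m n) :
    monSym α.1 = ∑ β, schurMat m n F α β • schurXi β := by
  simp only [schurXi]
  rw [← sum_mul_apply_smul, schurMat_mul_schurToMon,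
    sum_one_apply_smul (fun β : Zn m n => monSym β.1)]

theorem alternant_delta_mul_schurXi {n : ℕ} (α : Zn m n) :
    alternant (delta m) * (schurXi α : Poly m) = alternant (symbol α.1) := by
  rw [schurXi, coe_sum_smul, Finset.mul_sum]
  simp only [mul_smul_comm, alternant_delta_mul_monSym]
  calc ∑ β, schurToMon m n α β • ∑ κ : Zn m n, (monToSchur β κ : F) • alternant (symbol κ.1)
      = ∑ κ : Zn m n, (schurToMon m n * schurMat m n F) α κ • alternant (symbol κ.1) :=
        (sum_mul_apply_smul _ _ _ α).symm
    _ = alternant (symbol α.1) := by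
        rw [schurToMon_mul_schurMat, sum_one_apply_smul fun κ : Zn m n => alternant (symbol κ.1)]

theorem algebraMap_alternant_delta_ne_zero :
    algebraMap (Poly m) (RatFn m) (alternant (delta m)) ≠ 0 :=
  (map_ne_zero_iff _ (IsFractionRing.injective _ _)).2 alternant_delta_ne_zero

theorem toRat_schurXi {n : ℕ} (α : Zn m n) : toRat (schurXi α) = schur α.1 := by
  rw [schur, eq_div_iff algebraMap_alternant_delta_ne_zero, toRat, ← map_mul, mul_comm,
    alternant_delta_mul_schurXi]
  rfl

end SchurPolynomials

section OperatorMatrix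

theorem sum_smul_mul_left {K S ι : Type*} [CommRing K] [CommRing S] [Algebra K S] [Fintype ι]
    (A b : Matrix ι ι K) (a a' : S) (x y : ι → S) :
    ∑ α, ∑ β, A α β • ((a * ∑ γ, b β γ • x γ) * (a' * y α)) =
      a * a' * ∑ α, ∑ β, (A * b) α β • (x β * y α) := by
  rw [Finset.mul_sum]
  refine Finset.sum_congr rfl fun α _ => ?_
  rw [sum_mul_apply_smul A b fun β => x β * y α, Finset.mul_sum]
  refine Finset.sum_congr rfl fun β _ => ?_
  simp only [← smul_mul_assoc _ (x _), ← Finset.sum_mul]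
  rw [mul_mul_mul_comm, mul_smul_comm]

theorem sum_smul_mul_right {K S ι : Type*} [CommRing K] [CommRing S] [Algebra K S] [Fintype ι]
    (A b : Matrix ι ι K) (a a' : S) (x y : ι → S) :
    ∑ α, ∑ β, A α β • ((a * x β) * (a' * ∑ γ, b α γ • y γ)) =
      a * a' * ∑ α, ∑ β, (b.transpose * A) α β • (x β * y α) := by
  have hleft := sum_smul_mul_left A.transpose b a' a y x
  have htranspose (α β : ι) : (A.transpose * b) α β = (b.transpose * A) β α := by
    rw [← Matrix.transpose_apply (b.transpose * A), Matrix.transpose_mul,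
      Matrix.transpose_transpose]
  rw [Finset.sum_comm, Finset.sum_comm (f := fun α β => (b.transpose * A) α β • (x β * y α)),
    mul_comm a a']
  simpa only [Matrix.transpose_apply, htranspose, mul_comm (_ * _ : S) (_ * _),
    mul_comm (y _) (x _)] using hleft

variable {e : ℕ} [NeZero e] {m : ZMod e → ℕ}

/-- The matrix of `D^r_±` on the monomial basis. -/
def opMat (m : ZMod e → ℕ) (n : ℕ) (s : ℤˣ) (r : ℕ) : Matrix (Zn m n) (Zn m n) F :=
  Matrix.of (opSchurMatrix s r) * schurToMon m n

theorem opNum_monSym_eq (s : ℤˣ) (r : ℕ) {n : ℕ} (α : Zn m n) :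
    opNum s r (monSym α.1 : Poly m) =
      alternant (delta m) * ∑ β, opMat m n s r α β • (monSym β.1 : Poly m) := by
  rw [opNum_monSym_eq_sum_symbol, opMat, sum_mul_apply_smul (Matrix.of (opSchurMatrix s r))
    (schurToMon m n) (fun β : Zn m n => (monSym β.1 : Poly m)) α, Finset.mul_sum]
  refine Finset.sum_congr rfl fun β _ => ?_
  rw [mul_smul_comm, ← coe_sum_smul, ← alternant_delta_mul_schurXi]
  rfl

theorem opMat_map_conjF (s : ℤˣ) (r n : ℕ) : (opMat m n s r).map conjF = opMat m n s r := by
  rw [opMat, Matrix.map_mul, schurToMon_map_conjF]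
  congr 1
  ext α β
  simp [opSchurMatrix, conjF_q, conjF_t]

theorem opMat_eq_zero {n : ℕ} {prec : Zn m n → Zn m n → Prop} (h : IsAdmissible prec) (s : ℤˣ)
    (r : ℕ) {α β : Zn m n} (hlt : familyRank prec α < familyRank prec β) :
    opMat m n s r α β = 0 := by
  rw [opMat, Matrix.mul_apply]
  refine Finset.sum_eq_zero fun γ _ => ?_
  rcases le_or_gt (familyRank prec γ) (familyRank prec α) with hγ | hγ
  · rw [schurToMon_eq h (hγ.trans hlt.le), if_neg, mul_zero]
    rintro rfl
    exact hγ.not_gt hlt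
  · rw [Matrix.of_apply, opSchurMatrix_eq_zero h s r hγ, zero_mul]

/-- The numerator `a_δ(x) D^r_±` acting on the variables `x`, multiplied by `a_δ(y)`. -/
def opNumX (m : ZMod e → ℕ) (s : ℤˣ) (r : ℕ) : Poly₂ m →ₗ[F] Poly₂ m :=
  ∑ J ∈ IndexSets m r, LinearMap.mulLeft F
    (inX (opT s t J (alternant (delta m))) * inY (alternant (delta m))) ∘ₗ (opTX s q J).toLinearMap

/-- The numerator `a_δ(y) D^r_±` acting on the variables `y`, multiplied by `a_δ(x)`. -/
def opNumY (m : ZMod e → ℕ) (s : ℤˣ) (r : ℕ) : Poly₂ m →ₗ[F] Poly₂ m :=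
  ∑ J ∈ IndexSets m r, LinearMap.mulLeft F
    (inY (opT s t J (alternant (delta m))) * inX (alternant (delta m))) ∘ₗ (opTY s q J).toLinearMap

theorem opNumX_inX_mul_inY (s : ℤˣ) (r : ℕ) (f g : Poly m) :
    opNumX m s r (inX f * inY g) = inX (opNum s r f) * inY (alternant (delta m) * g) := by
  rw [opNumX, LinearMap.sum_apply, opNum_apply, map_sum, Finset.sum_mul]
  refine Finset.sum_congr rfl fun J _ => ?_
  simp only [LinearMap.comp_apply, LinearMap.mulLeft_apply, AlgHom.toLinearMap_apply, map_mul,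
    opTX_inX, opTX_inY]
  ring

theorem opNumY_inX_mul_inY (s : ℤˣ) (r : ℕ) (f g : Poly m) :
    opNumY m s r (inX f * inY g) = inX (alternant (delta m) * f) * inY (opNum s r g) := by
  rw [opNumY, LinearMap.sum_apply, opNum_apply, map_sum, Finset.mul_sum]
  refine Finset.sum_congr rfl fun J _ => ?_
  simp only [LinearMap.comp_apply, LinearMap.mulLeft_apply, AlgHom.toLinearMap_apply, map_mul,
    opTY_inX, opTY_inY]
  ring

theorem opNumX_kernel (s : ℤˣ) (r n : ℕ) :
    opNumX m s r (PowerSeries.coeff n (kernel m (gCoeff e) s)) =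
      opNumY m (-s) r (PowerSeries.coeff n (kernel m (gCoeff e) s)) := by
  simpa only [opNumX, opNumY, LinearMap.sum_apply, LinearMap.comp_apply, LinearMap.mulLeft_apply,
    AlgHom.toLinearMap_apply] using
      sum_opTX_kernel_eq_sum_opTY_kernel (m := m) (isQSolution_gCoeff e) s r n

theorem inX_mul_inY_alternant_delta_ne_zero :
    inX (alternant (delta m)) * inY (alternant (delta m)) ≠ 0 :=
  mul_ne_zero
    ((map_ne_zero_iff _ (MvPolynomial.rename_injective _ Sum.inl_injective)).2
      alternant_delta_ne_zero)
    ((map_ne_zero_iff _ (MvPolynomial.rename_injective _ Sum.inr_injective)).2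
      alternant_delta_ne_zero)

theorem gMat_mul_opMat (r n : ℕ) :
    gMat m n (gCoeff e) 1 * opMat m n 1 r =
      (opMat m n (-1) r).transpose * gMat m n (gCoeff e) 1 := by
  have hX : opNumX m 1 r (PowerSeries.coeff n (kernel m (gCoeff e) 1)) =
      inX (alternant (delta m)) * inY (alternant (delta m)) *
        ∑ α : Zn m n, ∑ β : Zn m n, (gMat m n (gCoeff e) 1 * opMat m n 1 r) α β •
          (inX (monSym β.1 : Poly m) * inY (monSym α.1 : Poly m)) := by
    rw [coeff_kernel, ← sum_smul_mul_left]
    simp only [map_sum, map_smul, opNumX_inX_mul_inY, opNum_monSym_eq, map_mul]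
  have hY : opNumY m (-1) r (PowerSeries.coeff n (kernel m (gCoeff e) 1)) =
      inX (alternant (delta m)) * inY (alternant (delta m)) *
        ∑ α : Zn m n, ∑ β : Zn m n, ((opMat m n (-1) r).transpose * gMat m n (gCoeff e) 1) α β •
          (inX (monSym β.1 : Poly m) * inY (monSym α.1 : Poly m)) := by
    rw [coeff_kernel, ← sum_smul_mul_right]
    simp only [map_sum, map_smul, opNumY_inX_mul_inY, opNum_monSym_eq, map_mul]
  exact matrix_eq_of_sum_inX_mul_inY_eq (mul_left_cancel₀ inX_mul_inY_alternant_delta_ne_zero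
    (hX.symm.trans ((opNumX_kernel 1 r n).trans hY)))

end OperatorMatrix

section Orthogonalization

variable {K V ι κ : Type*} [Field K] [AddCommGroup V] [Module K V] {σ τ : K →+* K}

/-- The Gram matrix of a family of vectors with respect to a sesquilinear form. -/
def gramMatrix (B : V →ₛₗ[σ] V →ₛₗ[τ] K) (v : ι → V) : Matrix ι ι K :=
  Matrix.of fun i j => B (v i) (v j)

theorem gramMatrix_apply (B : V →ₛₗ[σ] V →ₛₗ[τ] K) (v : ι → V) (i j : ι) :
    gramMatrix B v i j = B (v i) (v j) := rfl

theorem gramMatrix_flip (B : V →ₛₗ[σ] V →ₛₗ[τ] K) (v : ι → V) :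
    gramMatrix B.flip v = (gramMatrix B v).transpose := rfl

theorem eq_zero_of_mem_span_of_det_gramMatrix_ne_zero [Fintype ι] [DecidableEq ι]
    (B : V →ₛₗ[σ] V →ₛₗ[τ] K) {v : ι → V} (hdet : (gramMatrix B v).det ≠ 0) {x : V}
    (hx : x ∈ Submodule.span K (Set.range v)) (horth : ∀ j, B x (v j) = 0) : x = 0 := by
  obtain ⟨c, rfl⟩ := (Submodule.mem_span_range_iff_exists_fun K).1 hx
  have hvec : Matrix.vecMul (fun i => σ (c i)) (gramMatrix B v) = 0 := by
    funext j
    simpa [Matrix.vecMul, dotProduct, gramMatrix_apply, LinearMap.sum_apply] using horth j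
  refine Finset.sum_eq_zero fun i _ => ?_
  have hc : σ (c i) = 0 := congrFun (Matrix.eq_zero_of_vecMul_eq_zero hdet hvec) i
  rw [(map_eq_zero σ).1 hc, zero_smul]

theorem exists_sub_mem_span_forall_eq_zero [Fintype ι] [DecidableEq ι]
    (hσ : Function.Surjective σ) (B : V →ₛₗ[σ] V →ₛₗ[τ] K) {v : ι → V}
    (hdet : (gramMatrix B v).det ≠ 0) (z : V) :
    ∃ x, x - z ∈ Submodule.span K (Set.range v) ∧ ∀ j, B x (v j) = 0 := by
  choose c hc using fun i => hσ (Matrix.vecMul (fun j => -B z (v j)) (gramMatrix B v)⁻¹ i)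
  have hvec : Matrix.vecMul (fun i => σ (c i)) (gramMatrix B v) = fun j => -B z (v j) := by
    rw [funext hc, Matrix.vecMul_vecMul, Matrix.nonsing_inv_mul _ (isUnit_iff_ne_zero.2 hdet),
      Matrix.vecMul_one]
  refine ⟨z + ∑ i, c i • v i, ?_, fun j => ?_⟩
  · rw [add_sub_cancel_left]
    exact (Submodule.mem_span_range_iff_exists_fun K).2 ⟨c, rfl⟩
  · have hj := congrFun hvec j
    simp only [Matrix.vecMul, dotProduct, gramMatrix_apply] at hj
    simp only [map_add, map_sum, LinearMap.add_apply, LinearMap.sum_apply, LinearMap.map_smulₛₗ,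
      LinearMap.smul_apply, smul_eq_mul, hj, add_neg_cancel]

section LowerSpan

variable [Preorder κ] {ρ : ι → κ} {v w : ι → V}

/-- The span of the members of rank less than `r` of a family `v` with rank function `ρ`. -/
def lowerSpan (K : Type*) {V ι κ : Type*} [Field K] [AddCommGroup V] [Module K V] [Preorder κ]
    (ρ : ι → κ) (v : ι → V) (r : κ) : Submodule K V :=
  Submodule.span K (v '' {i | ρ i < r})

theorem mem_lowerSpan_of_lt {i : ι} {r : κ} (h : ρ i < r) : v i ∈ lowerSpan K ρ v r :=
  Submodule.subset_span (Set.mem_image_of_mem v h)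

theorem lowerSpan_le {r : κ} {W : Submodule K V} (h : ∀ i, ρ i < r → v i ∈ W) :
    lowerSpan K ρ v r ≤ W :=
  Submodule.span_le.2 (Set.image_subset_iff.2 h)

theorem lowerSpan_mono {r r' : κ} (h : r ≤ r') : lowerSpan K ρ v r ≤ lowerSpan K ρ v r' :=
  lowerSpan_le fun _ hi => mem_lowerSpan_of_lt (hi.trans_le h)

theorem lowerSpan_eq_span_range (r : κ) :
    lowerSpan K ρ v r = Submodule.span K (Set.range fun i : {i // ρ i < r} => v i) :=
  congrArg _ (Set.image_eq_range _ _)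

theorem mem_lowerSpan_iff [Fintype ι] {r : κ} {x : V} :
    x ∈ lowerSpan K ρ v r ↔
      ∃ c : ι → K, (∀ i, ¬ ρ i < r → c i = 0) ∧ x = ∑ i, c i • v i := by
  refine ⟨fun hx => ?_, fun ⟨c, hc, hx⟩ => hx ▸ Submodule.sum_mem _ fun i _ => ?_⟩
  · obtain ⟨l, hl, rfl⟩ := (Finsupp.mem_span_image_iff_linearCombination K).1 hx
    exact ⟨l, fun i hi => Finsupp.notMem_support_iff.1 fun h => hi (hl h),
      Finsupp.sum_fintype _ _ fun _ => zero_smul _ _⟩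
  · by_cases hi : ρ i < r
    · exact Submodule.smul_mem _ _ (mem_lowerSpan_of_lt hi)
    · rw [hc i hi, zero_smul]
      exact Submodule.zero_mem _

/-- The family `w` differs from `v` by combinations of members of `v` of smaller rank. -/
def IsUnitriangular (K : Type*) {V ι κ : Type*} [Field K] [AddCommGroup V] [Module K V]
    [Preorder κ] (ρ : ι → κ) (v w : ι → V) : Prop :=
  ∀ i, w i - v i ∈ lowerSpan K ρ v (ρ i)

theorem IsUnitriangular.lowerSpan_eq [WellFoundedLT κ] (h : IsUnitriangular K ρ v w) (r : κ) :
    lowerSpan K ρ w r = lowerSpan K ρ v r := by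
  apply le_antisymm
  · refine lowerSpan_le fun i hi => ?_
    rw [← sub_add_cancel (w i) (v i)]
    exact Submodule.add_mem _ (lowerSpan_mono hi.le (h i)) (mem_lowerSpan_of_lt hi)
  · induction r using WellFoundedLT.induction with
    | ind r ih =>
      refine lowerSpan_le fun i hi => ?_
      rw [← sub_sub_cancel (w i) (v i)]
      exact Submodule.sub_mem _ (mem_lowerSpan_of_lt hi) (lowerSpan_mono hi.le (ih _ hi (h i)))

theorem IsUnitriangular.sub_mem {w' : ι → V} (hw : IsUnitriangular K ρ v w)
    (hw' : IsUnitriangular K ρ v w') (i : ι) : w i - w' i ∈ lowerSpan K ρ v (ρ i) := by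
  rw [← sub_sub_sub_cancel_right (w i) (w' i) (v i)]
  exact Submodule.sub_mem _ (hw i) (hw' i)

theorem map_mem_lowerSpan [Fintype ι] {T : V →ₗ[K] V} {b : Matrix ι ι K}
    (hT : ∀ i, T (v i) = ∑ j, b i j • v j) (hb : ∀ i j, ¬ ρ j ≤ ρ i → b i j = 0) {r : κ} {x : V}
    (hx : x ∈ lowerSpan K ρ v r) : T x ∈ lowerSpan K ρ v r := by
  suffices lowerSpan K ρ v r ≤ (lowerSpan K ρ v r).comap T from this hx
  refine lowerSpan_le fun i hi => ?_
  rw [Submodule.mem_comap, hT, mem_lowerSpan_iff]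
  exact ⟨b i, fun j hj => hb i j fun hle => hj (hle.trans_lt hi), rfl⟩

theorem apply_eq_zero_of_mem_lowerSpan (f : V →ₛₗ[τ] K) {r : κ} (h : ∀ i, ρ i < r → f (v i) = 0)
    {x : V} (hx : x ∈ lowerSpan K ρ v r) : f x = 0 :=
  (lowerSpan_le (W := LinearMap.ker f) h) hx

end LowerSpan

section Biorthogonal

variable [LinearOrder κ] [Fintype ι] [DecidableEq ι] {ρ : ι → κ}
  {v u p : ι → V} {B : V →ₛₗ[σ] V →ₛₗ[τ] K}

theorem eq_of_isUnitriangular_of_orthogonal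
    (hdet : ∀ r, (gramMatrix B fun i : {i // ρ i < r} => v i).det ≠ 0) {p' : ι → V}
    (hp : IsUnitriangular K ρ v p) (hp' : IsUnitriangular K ρ v p')
    (horth : ∀ i, ∀ y ∈ lowerSpan K ρ v (ρ i), B (p i) y = 0)
    (horth' : ∀ i, ∀ y ∈ lowerSpan K ρ v (ρ i), B (p' i) y = 0) : p = p' := by
  funext i
  refine sub_eq_zero.1 (eq_zero_of_mem_span_of_det_gramMatrix_ne_zero B (hdet (ρ i)) ?_ fun j => ?_)
  · rw [← lowerSpan_eq_span_range]
    exact hp.sub_mem hp' i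
  · have hj := mem_lowerSpan_of_lt (K := K) (v := v) j.2
    rw [map_sub, LinearMap.sub_apply, horth i _ hj, horth' i _ hj, sub_zero]

theorem exists_isUnitriangular_orthogonal (hσ : Function.Surjective σ)
    (hdet : ∀ r, (gramMatrix B fun i : {i // ρ i < r} => v i).det ≠ 0) :
    ∃ p, IsUnitriangular K ρ v p ∧ ∀ i, ∀ y ∈ lowerSpan K ρ v (ρ i), B (p i) y = 0 := by
  choose p hp horth using fun i =>
    exists_sub_mem_span_forall_eq_zero hσ B (hdet (ρ i)) (v i)
  simp only [← lowerSpan_eq_span_range] at hp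
  exact ⟨p, hp, fun i y hy =>
    apply_eq_zero_of_mem_lowerSpan (B (p i)) (fun j hj => horth i ⟨j, hj⟩) hy⟩

theorem map_eq_sum_of_isUnitriangular_of_orthogonal [WellFoundedLT κ]
    (hdet : ∀ r, (gramMatrix B fun i : {i // ρ i < r} => v i).det ≠ 0)
    (hu : IsUnitriangular K ρ v u) (hp : IsUnitriangular K ρ v p)
    (horth : ∀ i, ∀ y ∈ lowerSpan K ρ v (ρ i), B (p i) y = 0)
    {T T' : V →ₗ[K] V} (hadj : ∀ x y, B (T x) y = B x (T' y)) {b b' : Matrix ι ι K}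
    (hT : ∀ i, T (u i) = ∑ j, b i j • u j) (hb : ∀ i j, ¬ ρ j ≤ ρ i → b i j = 0)
    (hT' : ∀ i, T' (u i) = ∑ j, b' i j • u j) (hb' : ∀ i j, ¬ ρ j ≤ ρ i → b' i j = 0) (i : ι) :
    T (p i) = ∑ j with ρ j = ρ i, b i j • p j := by
  have hspan (r : κ) : lowerSpan K ρ u r = lowerSpan K ρ v r := hu.lowerSpan_eq r
  have hhead : T (p i - u i) ∈ lowerSpan K ρ v (ρ i) := by
    rw [← hspan]
    exact map_mem_lowerSpan hT hb (hspan _ ▸ hp.sub_mem hu i)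
  have htail : ∑ j with ¬ ρ j = ρ i, b i j • u j ∈ lowerSpan K ρ v (ρ i) := by
    refine Submodule.sum_mem _ fun j hj => ?_
    rcases lt_or_ge (ρ i) (ρ j) with hlt | hle
    · rw [hb i j hlt.not_ge, zero_smul]
      exact Submodule.zero_mem _
    · rw [← hspan]
      exact Submodule.smul_mem _ _
        (mem_lowerSpan_of_lt (hle.lt_of_ne (Finset.mem_filter.1 hj).2))
  have hblock : ∑ j with ρ j = ρ i, b i j • (u j - p j) ∈ lowerSpan K ρ v (ρ i) :=
    Submodule.sum_mem _ fun j hj =>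
      Submodule.smul_mem _ _ ((Finset.mem_filter.1 hj).2 ▸ hu.sub_mem hp j)
  refine sub_eq_zero.1 (eq_zero_of_mem_span_of_det_gramMatrix_ne_zero B (hdet (ρ i)) ?_ fun k => ?_)
  · rw [← lowerSpan_eq_span_range]
    have hsplit := Finset.sum_filter_add_sum_filter_not univ (fun j => ρ j = ρ i)
      fun j => b i j • u j
    convert Submodule.add_mem _ (Submodule.add_mem _ hhead htail) hblock using 1
    simp only [map_sub, hT, ← hsplit, smul_sub, Finset.sum_sub_distrib]
    abel
  · have hk := mem_lowerSpan_of_lt (K := K) (v := v) k.2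
    have hTk : T' (v k) ∈ lowerSpan K ρ v (ρ i) := by
      rw [← hspan] at hk ⊢
      exact map_mem_lowerSpan hT' hb' hk
    rw [map_sub, LinearMap.sub_apply, hadj, horth i _ hTk, map_sum, LinearMap.sum_apply, zero_sub,
      neg_eq_zero]
    refine Finset.sum_eq_zero fun j hj => ?_
    rw [LinearMap.map_smulₛₗ, LinearMap.smul_apply,
      horth j _ (by rwa [(Finset.mem_filter.1 hj).2]), smul_zero]

end Biorthogonal

end Orthogonalization

section ScalarProduct

variable {e : ℕ} [NeZero e] {m : ZMod e → ℕ}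

theorem linearIndependent_monSym : LinearIndependent F (monSym : EPart m → Xi m) := by
  rw [linearIndependent_iff']
  intro s g hg α hα
  have hcoe : ∑ γ ∈ s, g γ • (monSym γ : Poly m) = 0 := by
    rw [← coe_sum_smul, hg, ZeroMemClass.coe_zero]
  have hcoeff := congrArg (MvPolynomial.coeff (expo α.1)) hcoe
  simpa [MvPolynomial.coeff_sum, coeff_monSym, hα] using hcoeff

theorem homogeneousComponent_mem_Xi {f : Poly m} (hf : f ∈ Xi m) (n : ℕ) :
    MvPolynomial.homogeneousComponent n f ∈ Xi m := by
  intro w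
  ext μ
  obtain ⟨β, rfl⟩ : ∃ β, expo β = μ := Finsupp.equivFunOnFinite.symm.surjective μ
  have hβ : expo β = (expo (actSeq w⁻¹ β)).mapDomain (toPerm w) := by
    rw [mapDomain_expo, actSeq_mul, mul_inv_cancel]
    rfl
  conv_lhs => rw [hβ]
  rw [actPoly, MvPolynomial.coeff_rename_mapDomain _ (toPerm w).injective,
    MvPolynomial.coeff_homogeneousComponent, MvPolynomial.coeff_homogeneousComponent,
    coeff_actSeq hf, degree_expo, degree_expo, sum_actSeq]

theorem eq_sum_sum_coeff_smul_monSym (f : Xi m) :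
    f = ∑ n ∈ range ((f : Poly m).totalDegree + 1), ∑ γ : Zn m n,
      MvPolynomial.coeff (expo γ.1.1) (MvPolynomial.homogeneousComponent n (f : Poly m)) •
        monSym γ.1 := by
  apply Subtype.ext
  refine (MvPolynomial.sum_homogeneousComponent (f : Poly m)).symm.trans (Eq.symm ?_)
  refine (map_sum (Xi m).val _ _).trans (Finset.sum_congr rfl fun n _ => ?_)
  exact (coe_sum_smul _ _ _).trans (eq_sum_coeff_smul_monSym (homogeneousComponent_mem_Xi f.2 n)
    (MvPolynomial.homogeneousComponent_isHomogeneous n (f : Poly m))).symm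

theorem span_monSym : ⊤ ≤ Submodule.span F (Set.range (monSym : EPart m → Xi m)) := by
  intro f _
  rw [eq_sum_sum_coeff_smul_monSym f]
  exact Submodule.sum_mem _ fun n _ => Submodule.sum_mem _ fun γ _ =>
    Submodule.smul_mem _ _ (Submodule.subset_span (Set.mem_range_self _))

/-- The basis of monomial symmetric polynomials. -/
def monBasis (m : ZMod e → ℕ) : Module.Basis (EPart m) F (Xi m) :=
  Module.Basis.mk linearIndependent_monSym span_monSym

theorem monBasis_apply (α : EPart m) : monBasis m α = monSym α := Module.Basis.mk_apply _ _ _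

/-- The sesquilinear form with given values on the monomial basis. -/
def monForm (N : EPart m → EPart m → F) : Xi m →ₗ[F] Xi m →ₛₗ[conjF] F :=
  (monBasis m).constr F fun α =>
    conjF.toSemilinearMap.comp ((monBasis m).constr F fun β => conjF (N α β))

theorem monForm_monSym (N : EPart m → EPart m → F) (α β : EPart m) :
    monForm N (monSym α) (monSym β) = N α β := by
  rw [← monBasis_apply α, monForm, Module.Basis.constr_basis, LinearMap.comp_apply,
    ← monBasis_apply β, Module.Basis.constr_basis]
  exact conjF_conjF _

theorem gFun_eq_sum (s : ℤˣ) {n : ℕ} (α : Zn m n) :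
    gFun s α.1 = ∑ γ, gMat m n (gCoeff e) s α γ • monSym γ.1 := by
  apply Subtype.ext
  rw [coe_sum_smul, coe_gFun (isQSolution_gCoeff e), gPoly_eq_sum]

theorem map_gFun_left (B : Xi m →ₗ[F] Xi m →ₛₗ[conjF] F) {n : ℕ} (α : Zn m n) (g : Xi m) :
    B (gFun 1 α.1) g = ∑ γ, gMat m n (gCoeff e) 1 α γ * B (monSym γ.1) g := by
  rw [gFun_eq_sum, map_sum, LinearMap.sum_apply]
  simp only [map_smul, LinearMap.smul_apply, smul_eq_mul]

theorem map_gFun_right (B : Xi m →ₗ[F] Xi m →ₛₗ[conjF] F) {n : ℕ} (β : Zn m n) (f : Xi m) :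
    B f (gFun (-1) β.1) = ∑ γ, B f (monSym γ.1) * gMat m n (gCoeff e) 1 γ β := by
  rw [gFun_eq_sum, map_sum]
  refine Finset.sum_congr rfl fun γ _ => ?_
  have hreal : conjF (gMat m n (gCoeff e) (-1) β γ) = gMat m n (gCoeff e) (-1) β γ := by
    conv_rhs => rw [← gMat_map_conjF n (-1), Matrix.map_apply]
  rw [LinearMap.map_smulₛₗ, hreal, smul_eq_mul, mul_comm, ← gMat_transpose (gCoeff e) 1,
    Matrix.transpose_apply]

theorem IsScalarProduct.gMat_mul_gramMatrix {B : Xi m →ₗ[F] Xi m →ₛₗ[conjF] F}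
    (hB : IsScalarProduct B) (n : ℕ) :
    gMat m n (gCoeff e) 1 * gramMatrix B (fun α : Zn m n => monSym α.1) = 1 := by
  ext α β
  rw [Matrix.mul_apply]
  simp only [gramMatrix_apply]
  rw [← map_gFun_left, (hB α.1 β.1).1, Matrix.one_apply]
  simp only [Subtype.ext_iff]

theorem IsScalarProduct.gramMatrix_monSym_eq {B : Xi m →ₗ[F] Xi m →ₛₗ[conjF] F}
    (hB : IsScalarProduct B) (n : ℕ) :
    gramMatrix B (fun α : Zn m n => monSym α.1) = (gMat m n (gCoeff e) 1)⁻¹ :=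
  (Matrix.inv_eq_right_inv (hB.gMat_mul_gramMatrix n)).symm

theorem IsScalarProduct.apply_eq_zero {B : Xi m →ₗ[F] Xi m →ₛₗ[conjF] F}
    (hB : IsScalarProduct B) {α β : EPart m} (hne : ∑ v, α.1 v ≠ ∑ v, β.1 v) :
    B (monSym α) (monSym β) = 0 := by
  have hmul : (gMat m (∑ v, α.1 v) (gCoeff e) 1).mulVec
      (fun γ => B (monSym γ.1) (monSym β)) = 0 := by
    funext κ
    have hκ : κ.1 ≠ β := fun h => hne (h ▸ κ.2.symm)
    rw [Matrix.mulVec, dotProduct, ← map_gFun_left, (hB κ.1 β).1, if_neg hκ, Pi.zero_apply]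
  have hzero := congrArg ((gMat m (∑ v, α.1 v) (gCoeff e) 1)⁻¹.mulVec) hmul
  rw [Matrix.mulVec_mulVec, Matrix.nonsing_inv_mul _ (isUnit_det_gMat _), Matrix.one_mulVec,
    Matrix.mulVec_zero] at hzero
  exact congrFun hzero ⟨α, rfl⟩

theorem IsScalarProduct.unique {B B' : Xi m →ₗ[F] Xi m →ₛₗ[conjF] F} (hB : IsScalarProduct B)
    (hB' : IsScalarProduct B') : B = B' := by
  refine (monBasis m).ext fun α => (monBasis m).ext fun β => ?_
  rw [monBasis_apply, monBasis_apply]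
  by_cases hαβ : ∑ v, α.1 v = ∑ v, β.1 v
  · have hgram (n : ℕ) := (hB.gramMatrix_monSym_eq n).trans (hB'.gramMatrix_monSym_eq n).symm
    exact congrFun (congrFun (hgram _) ⟨α, hαβ⟩) ⟨β, rfl⟩
  · rw [hB.apply_eq_zero hαβ, hB'.apply_eq_zero hαβ]

open Classical in
/-- The values `⟨m_α, m_β⟩` of the scalar product: the inverse, degree by degree, of the matrix of
the `g_{α,+}` on the monomial basis. -/
def gramEntry (α β : EPart m) : F :=
  if h : ∑ v, β.1 v = ∑ v, α.1 v then (gMat m (∑ v, α.1 v) (gCoeff e) 1)⁻¹ ⟨α, rfl⟩ ⟨β, h⟩ else 0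

theorem gramEntry_eq_inv {n : ℕ} (α β : Zn m n) :
    gramEntry α.1 β.1 = (gMat m n (gCoeff e) 1)⁻¹ α β := by
  obtain ⟨α, rfl⟩ := α
  exact dif_pos β.2

theorem gramEntry_eq_zero {α β : EPart m} (h : ∑ v, β.1 v ≠ ∑ v, α.1 v) : gramEntry α β = 0 :=
  dif_neg h

theorem monForm_gramEntry_gFun_left {n : ℕ} (α : Zn m n) (β : EPart m) :
    monForm gramEntry (gFun 1 α.1) (monSym β) = if α.1 = β then 1 else 0 := by
  rw [map_gFun_left]
  simp only [monForm_monSym]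
  by_cases hβ : ∑ v, β.1 v = n
  · simp only [fun γ : Zn m n => gramEntry_eq_inv γ ⟨β, hβ⟩]
    rw [← Matrix.mul_apply, Matrix.mul_nonsing_inv _ (isUnit_det_gMat n), Matrix.one_apply]
    simp only [Subtype.ext_iff]
  · rw [if_neg fun h : α.1 = β => hβ (h ▸ α.2)]
    exact Finset.sum_eq_zero fun γ _ => by rw [gramEntry_eq_zero (γ.2.symm ▸ hβ), mul_zero]

theorem monForm_gramEntry_gFun_right {n : ℕ} (α : EPart m) (β : Zn m n) :
    monForm gramEntry (monSym α) (gFun (-1) β.1) = if α = β.1 then 1 else 0 := by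
  rw [map_gFun_right]
  simp only [monForm_monSym]
  by_cases hα : ∑ v, α.1 v = n
  · simp only [gramEntry_eq_inv (⟨α, hα⟩ : Zn m n)]
    rw [← Matrix.mul_apply, Matrix.nonsing_inv_mul _ (isUnit_det_gMat n), Matrix.one_apply]
    simp only [Subtype.ext_iff]
  · rw [if_neg fun h : α = β.1 => hα (h ▸ β.2)]
    exact Finset.sum_eq_zero fun γ _ => by
      rw [gramEntry_eq_zero (γ.2.symm ▸ Ne.symm hα), zero_mul]

theorem exists_isScalarProduct (m : ZMod e → ℕ) :
    ∃ B : Xi m →ₗ[F] Xi m →ₛₗ[conjF] F, IsScalarProduct B :=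
  ⟨monForm gramEntry, fun α β =>
    ⟨monForm_gramEntry_gFun_left ⟨α, rfl⟩ β, monForm_gramEntry_gFun_right α ⟨β, rfl⟩⟩⟩

theorem map_sum_smul_sum_smul (B : Xi m →ₗ[F] Xi m →ₛₗ[conjF] F) {n : ℕ}
    (a b : Zn m n → F) (f g : Zn m n → Xi m) :
    B (∑ γ, a γ • f γ) (∑ κ, b κ • g κ) = ∑ κ, (∑ γ, a γ * B (f γ) (g κ)) * conjF (b κ) := by
  rw [map_sum]
  refine Finset.sum_congr rfl fun κ _ => ?_
  rw [LinearMap.map_smulₛₗ, smul_eq_mul, mul_comm, map_sum, LinearMap.sum_apply]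
  simp only [map_smul, LinearMap.smul_apply, smul_eq_mul]

theorem IsScalarProduct.gramMatrix_schurXi_eq {B : Xi m →ₗ[F] Xi m →ₛₗ[conjF] F}
    (hB : IsScalarProduct B) (n : ℕ) :
    gramMatrix B (schurXi (m := m) (n := n)) =
      (schurGramInv m n (gCoeff e))⁻¹ := by
  have hgram : gramMatrix B (schurXi (m := m) (n := n)) =
      schurToMon m n * gramMatrix B (fun α : Zn m n => monSym α.1) *
        (schurToMon m n).transpose := by
    ext α β
    rw [gramMatrix_apply, schurXi, schurXi, map_sum_smul_sum_smul, Matrix.mul_apply]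
    refine Finset.sum_congr rfl fun κ _ => ?_
    rw [Matrix.mul_apply, Matrix.transpose_apply]
    exact congrArg _ (congrFun (congrFun (schurToMon_map_conjF n) β) κ)
  have hcancel : (schurToMon m n).transpose * (schurMat m n F).transpose = 1 := by
    rw [← Matrix.transpose_mul, schurMat_mul_schurToMon, Matrix.transpose_one]
  refine (Matrix.inv_eq_left_inv ?_).symm
  rw [hgram]
  calc schurToMon m n * gramMatrix B (fun α : Zn m n => monSym α.1) *
        (schurToMon m n).transpose * schurGramInv m n (gCoeff e)
      = schurToMon m n * (gramMatrix B (fun α : Zn m n => monSym α.1) *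
          ((schurToMon m n).transpose * (schurMat m n F).transpose) *
          gMat m n (gCoeff e) 1) * schurMat m n F := by
        simp only [schurGramInv, Matrix.mul_assoc]
    _ = 1 := by
        rw [hcancel, Matrix.mul_one, mul_eq_one_comm.1 (hB.gMat_mul_gramMatrix n), Matrix.mul_one,
          schurToMon_mul_schurMat]

theorem IsScalarProduct.det_gramMatrix_schurXi_ne_zero {B : Xi m →ₗ[F] Xi m →ₛₗ[conjF] F}
    (hB : IsScalarProduct B) {n : ℕ} {κ : Type*} [Fintype κ] [DecidableEq κ] {f : κ → Zn m n}
    (hf : Function.Injective f) :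
    (gramMatrix B fun i => schurXi (f i)).det ≠ 0 := by
  have hminor := det_submatrix_schurGramInv_inv_ne_zero n hf
  rwa [← hB.gramMatrix_schurXi_eq n] at hminor

end ScalarProduct

section MacdonaldFunctions

variable {e : ℕ} [NeZero e] {m : ZMod e → ℕ} {n : ℕ} {prec : Zn m n → Zn m n → Prop}
  {B : Xi m →ₗ[F] Xi m →ₛₗ[conjF] F} {P : ℤˣ → Zn m n → Xi m}

theorem det_gramMatrix_lower_schurXi_ne_zero (hB : IsScalarProduct B)
    (prec : Zn m n → Zn m n → Prop) (r : ℕ) :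
    (gramMatrix B fun α : {α // familyRank prec α < r} => schurXi α.1).det ≠ 0 :=
  hB.det_gramMatrix_schurXi_ne_zero Subtype.val_injective

theorem det_gramMatrix_flip_lower_schurXi_ne_zero (hB : IsScalarProduct B)
    (prec : Zn m n → Zn m n → Prop) (r : ℕ) :
    (gramMatrix B.flip fun α : {α // familyRank prec α < r} => schurXi α.1).det ≠ 0 := by
  rw [gramMatrix_flip, Matrix.det_transpose]
  exact det_gramMatrix_lower_schurXi_ne_zero hB prec r

theorem IsAdmissible.exists_expansion_iff (h : IsAdmissible prec) (α : Zn m n) (x : Xi m) :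
    (∃ u : Zn m n → F, (∀ β, ¬ (prec β α ∧ ¬ Similar β α) → u β = 0) ∧
        toRat x = schur α.1 + ∑ β, u β • schur β.1) ↔
      x - schurXi α ∈ lowerSpan F (familyRank prec) schurXi (familyRank prec α) := by
  simp only [mem_lowerSpan_iff, h.familyRank_lt_iff]
  refine exists_congr fun u => and_congr_right fun _ => ?_
  rw [sub_eq_iff_eq_add', ← toRat_injective.eq_iff]
  simp only [← toRat_schurXi, ← toRat_sum_smul]
  simp only [toRat, Subalgebra.coe_add, map_add]

theorem IsMacdonald.isUnitriangular (h : IsAdmissible prec) (hP : IsMacdonald prec B P) (s : ℤˣ) :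
    IsUnitriangular F (familyRank prec) schurXi (P s) :=
  fun α => (h.exists_expansion_iff α (P s α)).1 (hP.expansion s α)

theorem IsMacdonald.apply_eq_zero_left (h : IsAdmissible prec) (hP : IsMacdonald prec B P)
    (α : Zn m n) {y : Xi m}
    (hy : y ∈ lowerSpan F (familyRank prec) schurXi (familyRank prec α)) : B (P 1 α) y = 0 := by
  rw [← (hP.isUnitriangular h (-1)).lowerSpan_eq] at hy
  exact apply_eq_zero_of_mem_lowerSpan (B (P 1 α)) (fun β hβ => hP.orthogonal α β fun hs =>
    hβ.ne' (h.familyRank_eq hs)) hy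

theorem IsMacdonald.apply_eq_zero_right (h : IsAdmissible prec) (hP : IsMacdonald prec B P)
    (α : Zn m n) {y : Xi m}
    (hy : y ∈ lowerSpan F (familyRank prec) schurXi (familyRank prec α)) :
    B y (P (-1) α) = 0 := by
  rw [← (hP.isUnitriangular h 1).lowerSpan_eq] at hy
  exact apply_eq_zero_of_mem_lowerSpan (B.flip (P (-1) α)) (fun β hβ =>
    hP.orthogonal β α fun hs => hβ.ne (h.familyRank_eq hs)) hy

theorem exists_isMacdonald (h : IsAdmissible prec) (hB : IsScalarProduct B) :
    ∃ P, IsMacdonald prec B P := by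
  obtain ⟨P₁, hP₁, horth₁⟩ := exists_isUnitriangular_orthogonal Function.surjective_id
    (det_gramMatrix_lower_schurXi_ne_zero hB prec)
  obtain ⟨P₂, hP₂, horth₂⟩ := exists_isUnitriangular_orthogonal
    (Function.Involutive.surjective conjF_conjF) (det_gramMatrix_flip_lower_schurXi_ne_zero hB prec)
  refine ⟨fun s => if s = 1 then P₁ else P₂, fun s α => ?_, fun α β hns => ?_⟩
  · rw [h.exists_expansion_iff]
    split_ifs
    · exact hP₁ α
    · exact hP₂ α
  · rw [if_pos rfl, if_neg (by decide)]
    rcases lt_trichotomy (familyRank prec α) (familyRank prec β) with hlt | heq | hlt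
    · refine horth₂ β _ ?_
      rw [← hP₁.lowerSpan_eq]
      exact mem_lowerSpan_of_lt hlt
    · exact absurd (h.familyRank_eq_iff.1 heq) hns
    · refine horth₁ α _ ?_
      rw [← hP₂.lowerSpan_eq]
      exact mem_lowerSpan_of_lt hlt

theorem IsMacdonald.unique (h : IsAdmissible prec) (hB : IsScalarProduct B)
    {P' : ℤˣ → Zn m n → Xi m} (hP : IsMacdonald prec B P) (hP' : IsMacdonald prec B P') :
    P = P' := by
  funext s
  have huni := hP.isUnitriangular h s
  have huni' := hP'.isUnitriangular h s
  rcases Int.units_eq_one_or s with rfl | rfl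
  · exact eq_of_isUnitriangular_of_orthogonal (det_gramMatrix_lower_schurXi_ne_zero hB prec)
      huni huni' (fun α _ => hP.apply_eq_zero_left h α) (fun α _ => hP'.apply_eq_zero_left h α)
  · exact eq_of_isUnitriangular_of_orthogonal (det_gramMatrix_flip_lower_schurXi_ne_zero hB prec)
      huni huni' (fun α _ => hP.apply_eq_zero_right h α) (fun α _ => hP'.apply_eq_zero_right h α)

end MacdonaldFunctions

section OperatorsOnMacdonaldFunctions

variable {e : ℕ} [NeZero e] {m : ZMod e → ℕ} {n : ℕ}

theorem IsAdmissible.isUnitriangular_monSym {prec : Zn m n → Zn m n → Prop}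
    (h : IsAdmissible prec) :
    IsUnitriangular F (familyRank prec) schurXi fun α : Zn m n => (monSym α.1 : Xi m) := by
  intro α
  refine mem_lowerSpan_iff.2 ⟨fun β => schurMat m n F α β - if α = β then 1 else 0,
    fun β hβ => sub_eq_zero.2 (schurMat_eq h (not_lt.1 hβ)), ?_⟩
  simp only [sub_smul, Finset.sum_sub_distrib, ← monSym_eq_sum_schurXi, ite_smul, one_smul,
    zero_smul, Finset.sum_ite_eq, Finset.mem_univ, if_true]

/-- The Macdonald operator `D^r_±` as an endomorphism of the space of symmetric polynomials. -/
def opXi (m : ZMod e → ℕ) (s : ℤˣ) (r : ℕ) : Xi m →ₗ[F] Xi m :=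
  (monBasis m).constr F fun α =>
    ∑ β : Zn m (∑ v, α.1 v), opMat m _ s r ⟨α, rfl⟩ β • monSym β.1

theorem opXi_monSym (s : ℤˣ) (r : ℕ) (α : Zn m n) :
    opXi m s r (monSym α.1) = ∑ β : Zn m n, opMat m n s r α β • monSym β.1 := by
  obtain ⟨α, rfl⟩ := α
  rw [opXi, ← monBasis_apply, Module.Basis.constr_basis]

theorem alternant_delta_mul_opXi (s : ℤˣ) (r : ℕ) (f : Xi m) :
    alternant (delta m) * (opXi m s r f : Poly m) = opNum s r (f : Poly m) := by
  suffices LinearMap.mulLeft F (alternant (delta m)) ∘ₗ (Xi m).val.toLinearMap ∘ₗ opXi m s r =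
      opNum s r ∘ₗ (Xi m).val.toLinearMap from LinearMap.congr_fun this f
  refine (monBasis m).ext fun α => ?_
  rw [monBasis_apply]
  refine Eq.trans ?_ (opNum_monSym_eq s r (⟨α, rfl⟩ : Zn m _)).symm
  rw [← coe_sum_smul, ← opXi_monSym]
  rfl

theorem toRat_opXi (s : ℤˣ) (r : ℕ) (f : Xi m) : toRat (opXi m s r f) = opD s r (f : Poly m) := by
  rw [opD_eq, ← alternant_delta_mul_opXi, map_mul,
    inv_mul_cancel_left₀ algebraMap_alternant_delta_ne_zero, toRat]

theorem isMonomialMatrix_iff (s : ℤˣ) (r : ℕ) (b : Zn m n → Zn m n → F) :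
    IsMonomialMatrix s r b ↔ b = opMat m n s r := by
  have hindep : LinearIndependent F fun β : Zn m n => (monSym β.1 : Xi m) :=
    linearIndependent_monSym.comp _ Subtype.val_injective
  simp only [IsMonomialMatrix, ← toRat_opXi, ← toRat_sum_smul, toRat_injective.eq_iff,
    opXi_monSym]
  refine ⟨fun hb => funext fun α => ?_, fun hb α => hb ▸ rfl⟩
  exact (hindep.fintypeLinearCombination_injective (hb α)).symm

theorem IsScalarProduct.opMat_mul_gramMatrix {B : Xi m →ₗ[F] Xi m →ₛₗ[conjF] F}
    (hB : IsScalarProduct B) (r n : ℕ) :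
    opMat m n 1 r * gramMatrix B (fun α : Zn m n => monSym α.1) =
      gramMatrix B (fun α : Zn m n => monSym α.1) * (opMat m n (-1) r).transpose := by
  have hdual := mul_eq_one_comm.1 (hB.gMat_mul_gramMatrix n)
  calc opMat m n 1 r * gramMatrix B (fun α : Zn m n => monSym α.1)
      = gramMatrix B (fun α : Zn m n => monSym α.1) * (gMat m n (gCoeff e) 1 * opMat m n 1 r) *
          gramMatrix B (fun α : Zn m n => monSym α.1) := by
        rw [← Matrix.mul_assoc, hdual, Matrix.one_mul]
    _ = gramMatrix B (fun α : Zn m n => monSym α.1) * (opMat m n (-1) r).transpose := by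
        rw [gMat_mul_opMat, Matrix.mul_assoc, Matrix.mul_assoc, hB.gMat_mul_gramMatrix,
          Matrix.mul_one]

theorem map_opXi_monSym_left (B : Xi m →ₗ[F] Xi m →ₛₗ[conjF] F) (s : ℤˣ) (r : ℕ) (α : Zn m n)
    (g : Xi m) :
    B (opXi m s r (monSym α.1)) g = ∑ γ, opMat m n s r α γ * B (monSym γ.1) g := by
  rw [opXi_monSym, map_sum, LinearMap.sum_apply]
  simp only [map_smul, LinearMap.smul_apply, smul_eq_mul]

theorem map_opXi_monSym_right (B : Xi m →ₗ[F] Xi m →ₛₗ[conjF] F) (s : ℤˣ) (r : ℕ) (β : Zn m n)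
    (f : Xi m) :
    B f (opXi m s r (monSym β.1)) = ∑ γ, B f (monSym γ.1) * opMat m n s r β γ := by
  rw [opXi_monSym, map_sum]
  refine Finset.sum_congr rfl fun γ _ => ?_
  rw [LinearMap.map_smulₛₗ, smul_eq_mul, mul_comm]
  exact congrArg _ (congrFun (congrFun (opMat_map_conjF s r n) β) γ)

theorem IsScalarProduct.apply_opXi_monSym {B : Xi m →ₗ[F] Xi m →ₛₗ[conjF] F}
    (hB : IsScalarProduct B) (r : ℕ) (α β : EPart m) :
    B (opXi m 1 r (monSym α)) (monSym β) = B (monSym α) (opXi m (-1) r (monSym β)) := by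
  rw [map_opXi_monSym_right B (-1) r (⟨β, rfl⟩ : Zn m _)]
  by_cases hαβ : ∑ v, α.1 v = ∑ v, β.1 v
  · rw [map_opXi_monSym_left B 1 r (⟨α, hαβ⟩ : Zn m _)]
    exact congrFun (congrFun (hB.opMat_mul_gramMatrix r _) ⟨α, hαβ⟩) ⟨β, rfl⟩
  · rw [map_opXi_monSym_left B 1 r (⟨α, rfl⟩ : Zn m _),
      Finset.sum_eq_zero fun γ _ => by rw [hB.apply_eq_zero (γ.2.trans_ne hαβ), mul_zero],
      Finset.sum_eq_zero fun γ _ => by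
        rw [hB.apply_eq_zero (γ.2.symm ▸ hαβ : ∑ v, α.1 v ≠ ∑ v, γ.1.1 v), zero_mul]]

theorem IsScalarProduct.apply_opXi_left {B : Xi m →ₗ[F] Xi m →ₛₗ[conjF] F}
    (hB : IsScalarProduct B) (r : ℕ) (f g : Xi m) :
    B (opXi m 1 r f) g = B f (opXi m (-1) r g) := by
  suffices B ∘ₗ opXi m 1 r = B.compl₂ (opXi m (-1) r) from
    LinearMap.congr_fun (LinearMap.congr_fun this f) g
  refine (monBasis m).ext fun α => (monBasis m).ext fun β => ?_
  rw [monBasis_apply, monBasis_apply]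
  exact hB.apply_opXi_monSym r α β

theorem IsMacdonald.opXi_eq_sum {prec : Zn m n → Zn m n → Prop} (h : IsAdmissible prec)
    {B : Xi m →ₗ[F] Xi m →ₛₗ[conjF] F} (hB : IsScalarProduct B) {P : ℤˣ → Zn m n → Xi m}
    (hP : IsMacdonald prec B P) (s : ℤˣ) (r : ℕ) (α : Zn m n) :
    opXi m s r (P s α) =
      ∑ β with familyRank prec β = familyRank prec α, opMat m n s r α β • P s β := by
  have hlower (s : ℤˣ) (α β : Zn m n) (hβ : ¬ familyRank prec β ≤ familyRank prec α) :
      opMat m n s r α β = 0 := opMat_eq_zero h s r (not_le.1 hβ)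
  rcases Int.units_eq_one_or s with rfl | rfl
  · exact map_eq_sum_of_isUnitriangular_of_orthogonal
      (det_gramMatrix_lower_schurXi_ne_zero hB prec) h.isUnitriangular_monSym
      (hP.isUnitriangular h 1) (fun α _ => hP.apply_eq_zero_left h α) (hB.apply_opXi_left r)
      (opXi_monSym 1 r) (hlower 1) (opXi_monSym (-1) r) (hlower (-1)) α
  · exact map_eq_sum_of_isUnitriangular_of_orthogonal
      (det_gramMatrix_flip_lower_schurXi_ne_zero hB prec) h.isUnitriangular_monSym
      (hP.isUnitriangular h (-1)) (fun α _ => hP.apply_eq_zero_right h α)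
      (fun f g => (hB.apply_opXi_left r g f).symm)
      (opXi_monSym (-1) r) (hlower (-1)) (opXi_monSym 1 r) (hlower 1) α

open Classical in
theorem IsMacdonald.opD_eq_sum {prec : Zn m n → Zn m n → Prop} (h : IsAdmissible prec)
    {B : Xi m →ₗ[F] Xi m →ₛₗ[conjF] F} (hB : IsScalarProduct B) {P : ℤˣ → Zn m n → Xi m}
    (hP : IsMacdonald prec B P) (s : ℤˣ) (r : ℕ) (α : Zn m n) :
    opD s r (P s α : Poly m) =
      ∑ β : Zn m n with Similar β α, opMat m n s r α β • toRat (P s β) := by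
  rw [← toRat_opXi, hP.opXi_eq_sum h hB, toRat_sum_smul]
  simp only [h.familyRank_eq_iff]

end OperatorsOnMacdonaldFunctions

end WMac

end

open Classical in
theorem proposition2p7 {e : ℕ} [NeZero e] (m : ZMod e → ℕ) (hm : ∀ k, 0 < m k) (n : ℕ)
    (prec : WMac.Zn m n → WMac.Zn m n → Prop) (hprec : WMac.IsAdmissible prec) :
    (∃! B : WMac.Xi m →ₗ[WMac.F] WMac.Xi m →ₛₗ[WMac.conjF] WMac.F, WMac.IsScalarProduct B) ∧
    ∀ B : WMac.Xi m →ₗ[WMac.F] WMac.Xi m →ₛₗ[WMac.conjF] WMac.F, WMac.IsScalarProduct B →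
      (∃! P : ℤˣ → WMac.Zn m n → WMac.Xi m, WMac.IsMacdonald prec B P) ∧
      ∀ P : ℤˣ → WMac.Zn m n → WMac.Xi m, WMac.IsMacdonald prec B P →
        ∀ (s : ℤˣ) (r : ℕ), 1 ≤ r → (∀ k, r ≤ m k) →
          (∃! b : WMac.Zn m n → WMac.Zn m n → WMac.F, WMac.IsMonomialMatrix s r b) ∧
          ∀ b : WMac.Zn m n → WMac.Zn m n → WMac.F, WMac.IsMonomialMatrix s r b →
            ∀ α : WMac.Zn m n,
              WMac.opD s r (P s α : WMac.Poly m) =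
                ∑ β : WMac.Zn m n with WMac.Similar β α, b α β • WMac.toRat (P s β) := by
  refine ⟨?_, fun B hB => ⟨?_, fun P hP s r _ _ => ⟨?_, fun b hb α => ?_⟩⟩⟩
  · obtain ⟨B, hB⟩ := WMac.exists_isScalarProduct m
    exact ⟨B, hB, fun B' hB' => hB'.unique hB⟩
  · obtain ⟨P, hP⟩ := WMac.exists_isMacdonald hprec hB
    exact ⟨P, hP, fun P' hP' => hP'.unique hprec hB hP⟩
  · exact ⟨WMac.opMat m n s r, (WMac.isMonomialMatrix_iff s r _).2 rfl,
      fun b => (WMac.isMonomialMatrix_iff s r b).1⟩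
  · rw [(WMac.isMonomialMatrix_iff s r b).1 hb]
    exact hP.opD_eq_sum hprec hB s r α
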